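/- **Setting.** Let $\Lambda=\{\lambda_1,\dots,\lambda_N\}$ be $N\ge 1$ levels of an underspecified POMDP with finite action set $A$, state space $S$, Markov transitions $P_\lambda(\cdot\mid s,a)$, initial laws $\rho_\lambda$, observations $o=o_\lambda(s)$, bounded rewards $r_\lambda(s,a)$, discount factor $\gamma\in[0,1]$ and episodes of length $T<\infty$ (steps $t=0,\dots,T-1$). For a trajectory $\tau$ put $R^t(\tau,\lambda)=\sum_{k\ge t}\gamma^k r_\lambda(s_k,a_k)$ and $R=R^0$; let $J(\pi,\lambda)=\mathbb E_{\tau\sim\pi(\lambda)}R(\tau,\lambda)$, and let $R_*$ bound $|R^t(\tau,\lambda)|$ for all $t,\lambda$ and almost all trajectories $\tau$ of the agent. The policy $\pi_x(a\mid o)$, $x\in\mathbb R^d$, satisfies $\pi_x(a\mid o)\ge\zeta>0$ for all $x,a,o$, and each $x\mapsto\pi_x(a\mid o)$ is $L$-Lipschitz and differentiable with $K$-Lipschitz gradient. Let $\alpha>0$, $0<\xi\le 1/N$, $\mathcal Y=\{y\in\mathbb R^N: y_i\ge\xi,\ \sum_i y_i=1\}$ and $\mathcal H(y)=-\sum_i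 y_i\log y_i$. The score is $s(\pi,\lambda)=c_\lambda-J(\pi,\lambda)$ with $c_\lambda=0$ (negative return), or $c_\lambda=\sup_{\pi}J(\pi,\lambda)$ (regret, the supremum being over all policies that map observations to action distributions), or $c_\lambda=\max_\tau R(\tau,\lambda)$ (essential maximum over feasible trajectories; this equals regret when the two values of $c_\lambda$ agree). Put $$f(x,y)=\sum_i y_i\,s(\pi_x,\lambda_i)+\alpha\mathcal H(y),\qquad \Phi(x)=\max_{y\in\mathcal Y}f(x,y),\qquad \Delta=\Phi(x^0)-\inf_x\Phi(x),$$ $$\sigma^2=4R_*^2\Big(N+\frac{T^2L^2}{\zeta^2}\Big),\qquad \ell=\frac{TR_*}{\zeta}\Big(TL^2+K+\frac{L^2}{\zeta}+2TL\Big)+\frac{\alpha}{\xi}.$$ **Algorithm.** Start from $x^0\in\mathbb R^d$ and $y^0=\frac1N\mathbf 1$. At step $n$, given the past, draw independently $NM$ pairs $(\lambda_{ij},\tau_{ij})$, $i\le N$, $j\le M$, where $\lambda_{ij}$ is drawn from the distribution $y^n$ on $\Lambda$ and $\tau_{ij}\sim\pi_{x^n}(\lambda_{ij})$, and $M$ trajectories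 $\tilde\tau_{ij}\sim\pi_{x^n}(\lambda_i)$, $j\le M$, on each level $\lambda_i$. Put $$\hat F=-\frac1{NM}\sum_{i,j}\sum_{t<T}\Psi^t(\tau_{ij},\lambda_{ij})\,\nabla_x\log\pi_{x^n}(a^t_{ij}\mid o^t_{ij}),\qquad \hat G=\Big(c_{\lambda_i}-\frac1M\sum_jR(\tilde\tau_{ij},\lambda_i)\Big)_{i\le N}+\alpha\nabla\mathcal H(y^n),$$ where $\Psi^t(\tau,\lambda)$ is either $R^t(\tau,\lambda)$ or $\gamma^t$ times the advantage function of $\pi_{x^n}$ on level $\lambda$ at time $t$ and $(s^t,a^t)$; then set $x^{n+1}=x^n-\eta_x\hat F$ and $y^{n+1}=\mathcal P_{\mathcal Y}(y^n+\eta_y\hat G)$ (Euclidean projection). **Theorem (best-iterate convergence).** Let $\varepsilon>0$, $\eta_x=\Theta(\alpha^2/\ell^3)$, $\eta_y=\Theta(1/\ell)$ and $M=\Theta(\max\{1,\sigma^2\ell/(\alpha\varepsilon^2)\})$. Then $\Phi$ is differentiable, and after $$O\!\left(\frac{\Delta\,\ell^3}{\alpha^2\varepsilon^2}+\frac{\ell^3}{\alpha\min\{\varepsilon^2,\varepsilon^4\}}\right)$$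 iterations the best iterate $x^*$ (an iterate of smallest $\|\nabla\Phi\|$ among those computed so far) satisfies $\mathbb E\,\|\nabla\Phi(x^*)\|<\varepsilon$; in fact $\mathbb E\,\|\nabla\Phi(x^t)\|<\varepsilon$ for some fixed index $t$ in this range. For $\varepsilon\le1$ the second term is $\ell^3/(\alpha\varepsilon^4)$. The constants do not depend on the problem. Precisely: there is $c_y>0$ such that for each $c_y'\in(0,c_y]$ there is $c_x>0$ such that for each $c_x'\in(0,c_x]$ there are $c_M,C>0$ for which the following holds. For all data as above, all $\eta_x\in[c_x',c_x]\cdot\alpha^2/\ell^3$, all $\eta_y\in[c_y',c_y]\cdot 1/\ell$ and all $M\ge c_M\max\{1,\sigma^2\ell/(\alpha\varepsilon^2)\}$, the conclusion holds after any number $n\ge C\big(\Delta\ell^3/(\alpha^2\varepsilon^2)+\ell^3/(\alpha\min\{\varepsilon^2,\varepsilon^4\})\big)$ of iterations. -/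

import Mathlib

open MeasureTheory ProbabilityTheory

noncomputable section

namespace UED

/-- An underspecified POMDP with `N` levels, states `S`, observations `O`, actions `A`.
A policy acts on the observation `obs i s`; random observations, terminal (absorbing, reward-free)
states and observation histories are all accommodated by the choice of `S` and `O`. -/
structure UPOMDP (N : ℕ) (S O A : Type*) [MeasurableSpace S] [MeasurableSpace O]
    [MeasurableSpace A] where
  /-- initial state distribution of each level -/
  init : Fin N → Measure S
  init_prob : ∀ i, IsProbabilityMeasure (init i)
  /-- transition probabilities of each level -/
  trans : Fin N → Kernel (S × A) S
  trans_markov : ∀ i, IsMarkovKernel (trans i)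
  /-- observation of a state -/
  obs : Fin N → S → O
  obs_meas : ∀ i, Measurable (obs i)
  /-- reward function -/
  reward : Fin N → S → A → ℝ
  reward_meas : ∀ i a, Measurable fun s => reward i s a
  reward_bdd : ∃ b : ℝ, ∀ i s a, |reward i s a| ≤ b
  /-- discount factor -/
  γ : ℝ
  γ_nonneg : 0 ≤ γ
  γ_le_one : γ ≤ 1

/-- Trajectories: `T` consecutive state-action pairs. -/
abbrev Traj (T : ℕ) (S A : Type*) := Fin T → S × A

/-- Parameter space of the agent. -/
abbrev Params (d : ℕ) := EuclideanSpace ℝ (Fin d)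

/-- Vectors indexed by the levels. -/
abbrev LevelVec (N : ℕ) := EuclideanSpace ℝ (Fin N)

/-- The samples used in one iteration with batch size `M`: for the agent, `M` batches of `N` pairs
(sampled level, trajectory on it); for the adversary, `M` trajectories on each of the levels. -/
abbrev Batch (N T M : ℕ) (S A : Type*) :=
  (Fin M → Fin N → Fin N × Traj T S A) × (Fin M → Fin N → Traj T S A)

/-- A policy: action probabilities for each observation. -/
structure IsPolicy {O A : Type*} [MeasurableSpace O] [Fintype A] (p : O → A → ℝ) : Prop where
  nonneg : ∀ o a, 0 ≤ p o a
  sum_one : ∀ o, ∑ a, p o a = 1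
  meas : ∀ a, Measurable fun o => p o a

/-- A parameterised policy, every action of which has probability at least `ζ` and whose action
probabilities are `L`-Lipschitz and `K`-smooth functions of the parameter. -/
structure IsRegularPolicy {d : ℕ} {O A : Type*} [MeasurableSpace O] [Fintype A]
    (π : Params d → O → A → ℝ) (ζ : ℝ) (L K : NNReal) : Prop where
  policy : ∀ x, IsPolicy (π x)
  greedy : ∀ x o a, ζ ≤ π x o a
  lipschitz : ∀ o a, LipschitzWith L fun x => π x o a
  differentiable : ∀ o a, Differentiable ℝ fun x => π x o a
  smooth : ∀ o a, LipschitzWith K (gradient fun x => π x o a)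

/-- The score: negative return; regret with respect to the optimal expected return; or regret with
respect to the largest attainable return. -/
inductive ScoreKind
  | negReturn
  | regret
  | regretMax

/-- The weight `Ψ` in the policy gradient estimator. -/
inductive WeightKind
  | returnToGo
  | advantage

/-- The `ξ`-truncated probability simplex. -/
def truncSimplex (N : ℕ) (ξ : ℝ) : Set (LevelVec N) :=
  {y | (∀ i, ξ ≤ y i) ∧ ∑ i, y i = 1}

/-- Entropy `-∑ yᵢ log yᵢ`. -/
def entropy {N : ℕ} (y : LevelVec N) : ℝ := ∑ i, Real.negMulLog (y i)

/-- `y'` is a Euclidean projection of `v` onto `C`. -/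
def IsProj {N : ℕ} (C : Set (LevelVec N)) (v y' : LevelVec N) : Prop :=
  y' ∈ C ∧ ∀ z ∈ C, ‖v - y'‖ ≤ ‖v - z‖

/-- `σ² = 4 R² (N + T² L² / ζ²)`. -/
def varConst (N T : ℕ) (R ζ : ℝ) (L : NNReal) : ℝ :=
  4 * R ^ 2 * (N + (T : ℝ) ^ 2 * (L : ℝ) ^ 2 / ζ ^ 2)

/-- `ℓ = (T R / ζ) (T L² + K + L² / ζ + 2 T L) + α / ξ`. -/
def smoothConst (T : ℕ) (R ζ ξ α : ℝ) (L K : NNReal) : ℝ :=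
  T * R / ζ * (T * (L : ℝ) ^ 2 + K + (L : ℝ) ^ 2 / ζ + 2 * T * L) + α / ξ

namespace UPOMDP

variable {N T M d : ℕ} {S O A : Type*} [MeasurableSpace S] [MeasurableSpace O]
  [MeasurableSpace A] [Fintype A]

/-- Law of the next `n` state-action pairs on level `i` under the policy `p`, from state `s`. -/
def trajFrom (E : UPOMDP N S O A) (p : O → A → ℝ) (i : Fin N) :
    (n : ℕ) → S → Measure (Traj n S A)
  | 0, _ => Measure.dirac Fin.elim0
  | n + 1, s => ∑ a, ENNReal.ofReal (p (E.obs i s) a) •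
      ((E.trans i (s, a)).bind (trajFrom E p i n)).map
        (fun τ => (Fin.cons (s, a) τ : Traj (n + 1) S A))

/-- Law of an episode of length `T` on level `i` under the policy `p`. -/
def trajLaw (E : UPOMDP N S O A) (T : ℕ) (p : O → A → ℝ) (i : Fin N) : Measure (Traj T S A) :=
  (E.init i).bind (E.trajFrom p i T)

/-- The part from time `t` onwards of the discounted return, `∑_{k ≥ t} γᵏ rᵏ`. -/
def tailReturn (E : UPOMDP N S O A) (i : Fin N) (t : ℕ) (τ : Traj T S A) : ℝ :=
  ∑ k : Fin T, if t ≤ (k : ℕ) then E.γ ^ (k : ℕ) * E.reward i (τ k).1 (τ k).2 else 0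

/-- Discounted return `R(τ, i)` of a trajectory. -/
def ret (E : UPOMDP N S O A) (i : Fin N) (τ : Traj T S A) : ℝ := E.tailReturn i 0 τ

/-- Expected discounted return of the policy `p` on level `i`. -/
def expReturn (E : UPOMDP N S O A) (T : ℕ) (p : O → A → ℝ) (i : Fin N) : ℝ :=
  ∫ τ, E.ret i τ ∂(E.trajLaw T p i)

/-- Optimal expected return on level `i`. -/
def optReturn (E : UPOMDP N S O A) (T : ℕ) (i : Fin N) : ℝ :=
  sSup {v | ∃ p : O → A → ℝ, IsPolicy p ∧ v = E.expReturn T p i}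

/-- Largest attainable return on level `i`: the essential supremum over the trajectories generated
by the uniformly random policy, under which every feasible trajectory can occur. -/
def maxReturn (E : UPOMDP N S O A) (T : ℕ) (i : Fin N) : ℝ :=
  essSup (fun τ : Traj T S A => E.ret i τ)
    (E.trajLaw T (fun _ _ => (1 : ℝ) / Fintype.card A) i)

/-- `R` bounds the absolute discounted return, from any time onwards, on every level, for almost
every trajectory of the agent. -/
def IsReturnBound (E : UPOMDP N S O A) (T : ℕ) (π : Params d → O → A → ℝ) (R : ℝ) : Prop :=
  ∀ (x : Params d) (i : Fin N) (t : ℕ), ∀ᵐ τ ∂(E.trajLaw T (π x) i), |E.tailReturn i t τ| ≤ R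

/-- Value function with `n` steps to go. -/
def value (E : UPOMDP N S O A) (p : O → A → ℝ) (i : Fin N) (n : ℕ) (s : S) : ℝ :=
  ∫ τ, E.ret i τ ∂(E.trajFrom p i n s)

/-- Action-value function with `n` steps to go after the present one. -/
def qValue (E : UPOMDP N S O A) (p : O → A → ℝ) (i : Fin N) (n : ℕ) (s : S) (a : A) : ℝ :=
  E.reward i s a + E.γ * ∫ s', E.value p i n s' ∂(E.trans i (s, a))

/-- The weight `Ψᵗ(τ, i)`: the return from time `t` onwards, or the advantage function at time `t`,
both discounted back to time `0`. -/
def weight (E : UPOMDP N S O A) (w : WeightKind) (p : O → A → ℝ) (i : Fin N) (t : Fin T)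
    (τ : Traj T S A) : ℝ :=
  match w with
  | .returnToGo => E.tailReturn i t τ
  | .advantage => E.γ ^ (t : ℕ) * (E.qValue p i (T - 1 - t) (τ t).1 (τ t).2
      - E.value p i (T - t) (τ t).1)

/-- The term of the score that does not depend on the agent. -/
def offset (E : UPOMDP N S O A) (T : ℕ) (k : ScoreKind) (i : Fin N) : ℝ :=
  match k with
  | .negReturn => 0
  | .regret => E.optReturn T i
  | .regretMax => E.maxReturn T i

/-- Score of the policy `p` on level `i`. -/
def score (E : UPOMDP N S O A) (T : ℕ) (k : ScoreKind) (p : O → A → ℝ) (i : Fin N) : ℝ :=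
  E.offset T k i - E.expReturn T p i

/-- Entropy-regularised expected score `f(x, y) = yᵀ s(π_x, Λ) + α H(y)`. -/
def objective (E : UPOMDP N S O A) (T : ℕ) (k : ScoreKind) (π : Params d → O → A → ℝ) (α : ℝ)
    (x : Params d) (y : LevelVec N) : ℝ :=
  ∑ i, y i * E.score T k (π x) i + α * entropy y

/-- `Φ(x) = max_y f(x, y)`, over the `ξ`-truncated simplex. -/
def maxObjective (E : UPOMDP N S O A) (T : ℕ) (k : ScoreKind) (π : Params d → O → A → ℝ)
    (α ξ : ℝ) (x : Params d) : ℝ :=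
  sSup (E.objective T k π α x '' truncSimplex N ξ)

/-- `Δ = Φ(x⁰) - inf Φ`. -/
def initialGap (E : UPOMDP N S O A) (T : ℕ) (k : ScoreKind) (π : Params d → O → A → ℝ)
    (α ξ : ℝ) (x₀ : Params d) : ℝ :=
  E.maxObjective T k π α ξ x₀ - ⨅ x, E.maxObjective T k π α ξ x

/-- Law of a pair (level, trajectory): the level is drawn from `y`, the trajectory from the policy
`p` on this level. -/
def sampleLaw (E : UPOMDP N S O A) (T : ℕ) (p : O → A → ℝ) (y : LevelVec N) :
    Measure (Fin N × Traj T S A) :=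
  ∑ i, ENNReal.ofReal (y i) • (E.trajLaw T p i).map (fun τ => (i, τ))

/-- Law of the samples of one iteration: all draws are independent. -/
def batchLaw (E : UPOMDP N S O A) (T M : ℕ) (p : O → A → ℝ) (y : LevelVec N) :
    Measure (Batch N T M S A) :=
  (Measure.pi fun _ : Fin M => Measure.pi fun _ : Fin N => E.sampleLaw T p y).prod
    (Measure.pi fun _ : Fin M => Measure.pi fun i : Fin N => E.trajLaw T p i)

/-- The agent's (REINFORCE) gradient estimator. -/
def agentGrad (E : UPOMDP N S O A) (w : WeightKind) (π : Params d → O → A → ℝ)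
    (x : Params d) (b : Batch N T M S A) : Params d :=
  -((1 : ℝ) / (N * M)) • ∑ j : Fin M, ∑ l : Fin N, ∑ t : Fin T,
    E.weight w (π x) (b.1 j l).1 t (b.1 j l).2 •
      gradient (fun x' => Real.log
        (π x' (E.obs (b.1 j l).1 ((b.1 j l).2 t).1) ((b.1 j l).2 t).2)) x

/-- The adversary's gradient estimator: empirical score vector plus `α ∇H(y)`. -/
def advGrad (E : UPOMDP N S O A) (k : ScoreKind) (α : ℝ) (y : LevelVec N)
    (b : Batch N T M S A) : LevelVec N :=
  WithLp.toLp 2 (fun i => E.offset T k i - (1 : ℝ) / M * ∑ j : Fin M, E.ret i (b.2 j i))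
    + α • gradient entropy y

/-- A run of two-timescale stochastic gradient descent-ascent: iterates `X n`, `Y n`, and samples
`B n`, whose conditional law given the past `ℱ n` is the law `batchLaw` at the current iterates. -/
structure IsRun (E : UPOMDP N S O A) (k : ScoreKind) (w : WeightKind)
    (π : Params d → O → A → ℝ) (α ξ ηx ηy : ℝ) (x₀ : Params d)
    {Ω : Type*} {mΩ : MeasurableSpace Ω} (μ : Measure Ω) (ℱ : Filtration ℕ mΩ)
    (X : ℕ → Ω → Params d) (Y : ℕ → Ω → LevelVec N) (B : ℕ → Ω → Batch N T M S A) : Prop where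
  x_meas : ∀ n, Measurable[ℱ n] (X n)
  y_meas : ∀ n, Measurable[ℱ n] (Y n)
  batch_meas : ∀ n, Measurable (B n)
  batch_law : ∀ n (s : Set Ω), MeasurableSet[ℱ n] s →
    ∀ D : Set (Batch N T M S A), MeasurableSet D →
      μ (s ∩ B n ⁻¹' D) = ∫⁻ ω in s, E.batchLaw T M (π (X n ω)) (Y n ω) D ∂μ
  x_zero : ∀ ω, X 0 ω = x₀
  y_zero : ∀ ω i, Y 0 ω i = 1 / N
  x_succ : ∀ n ω, X (n + 1) ω = X n ω - ηx • E.agentGrad w π (X n ω) (B n ω)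
  y_succ : ∀ n ω, IsProj (truncSimplex N ξ) (Y n ω + ηy • E.advGrad k α (Y n ω) (B n ω))
    (Y (n + 1) ω)

end UPOMDP

end UED

end

/-! The proof follows the potential $\Phi(x)+\eta_x w\|y-y^*(x)\|^2$, where $y^*(x)$ is the
adversary's best response to the scores at $x$, and shows that its expectation drops by
$\frac{\eta_x}2\mathbb E\|\nabla\Phi(x)\|^2$ per iteration, up to the sampling variance
(`potential_step`, `IsRun.integral_potential_succ_le`).

Entropy is strongly concave in the ℓ¹ norm (`sq_l1_le`). Hence the best response is unique and
Lipschitz in $x$ (`l1_bestResponse_sub_le`), $\Phi$ is differentiable with gradient $\nabla_x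
f(x,y^*(x))$ and a quadratic Taylor remainder (`abs_maxPayoff_sub_le`), and a projected ascent step
contracts towards $y^*(x)$, with a gain measured in ℓ¹ (`norm_proj_sub_bestResponse_sq_le`). The
agent descends along $\nabla_x f(x,y)$ instead of $\nabla\Phi(x)$. This bias is at most a bound $G$
on the level gradients times $\|y-y^*(x)\|_1$, and $w$ is chosen so that the contraction pays for
it. The ℓ¹ norm keeps factors of $N$ out of this exchange. The drift of $y^*$ and the curvature of
$\Phi$ are of second order in the agent's step and are absorbed because $\eta_x$ is of order
$\alpha^2/\ell^3$ (`step_size_bounds`).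

Only a Taylor bound on the expected returns is required. A change of parameter multiplies the
trajectory law by a product of likelihood ratios, and the error of linearising this product has mean
at most three times $T$ times a bound on the one-step variance, by a martingale computation
(`integral_abs_pathProd_sub_le`). So the curvature is linear in $T$ (`abs_expReturn_sub_le`).

Both policy gradient weights are unbiased (`integral_weightedSum`), and given the past the noise of
either player is centred, with second moment at most $\sigma^2/M$. Summing the decrease over the
iterations yields an index with $\mathbb E\|\nabla\Phi\|^2<\varepsilon^2$
(`IsRun.exists_integral_norm_sq_lt`); Jensen's inequality and comparison with the best iterate
(`integral_best_le`) conclude. -/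

noncomputable section

namespace UED

/-! ### Bounded measurable functions and integration against kernels -/

/-- Bounded measurable real functions. -/
def BddMeas {X : Type*} [MeasurableSpace X] (f : X → ℝ) : Prop :=
  Measurable f ∧ ∃ C, ∀ x, |f x| ≤ C

namespace BddMeas

variable {X Y ι : Type*} [MeasurableSpace X] [MeasurableSpace Y] {f g : X → ℝ}

lemma const (c : ℝ) : BddMeas fun _ : X => c := ⟨measurable_const, |c|, fun _ => le_rfl⟩

lemma add (hf : BddMeas f) (hg : BddMeas g) : BddMeas fun x => f x + g x := by
  obtain ⟨hf, C, hC⟩ := hf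
  obtain ⟨hg, D, hD⟩ := hg
  exact ⟨hf.add hg, C + D, fun x => (abs_add_le _ _).trans (add_le_add (hC x) (hD x))⟩

lemma mul (hf : BddMeas f) (hg : BddMeas g) : BddMeas fun x => f x * g x := by
  obtain ⟨hf, C, hC⟩ := hf
  obtain ⟨hg, D, hD⟩ := hg
  refine ⟨hf.mul hg, C * D, fun x => ?_⟩
  rw [abs_mul]
  exact mul_le_mul (hC x) (hD x) (abs_nonneg _) ((abs_nonneg _).trans (hC x))

lemma neg (hf : BddMeas f) : BddMeas fun x => -f x := by
  simpa using (const (-1)).mul hf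

lemma sub (hf : BddMeas f) (hg : BddMeas g) : BddMeas fun x => f x - g x := by
  simpa [sub_eq_add_neg] using hf.add hg.neg

lemma sq (hf : BddMeas f) : BddMeas fun x => f x ^ 2 := by
  simpa [_root_.sq] using hf.mul hf

lemma abs (hf : BddMeas f) : BddMeas fun x => |f x| := by
  obtain ⟨hf, C, hC⟩ := hf
  exact ⟨measurable_norm.comp hf, C, fun x => by simpa using hC x⟩

lemma sum {s : Finset ι} {f : ι → X → ℝ} (hf : ∀ i ∈ s, BddMeas (f i)) :
    BddMeas fun x => ∑ i ∈ s, f i x := by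
  classical
  induction s using Finset.induction_on with
  | empty => simpa using const 0
  | insert i s hi ih =>
    simp only [Finset.sum_insert hi]
    exact (hf i (by simp)).add (ih fun j hj => hf j (by simp [hj]))

lemma prod {s : Finset ι} {f : ι → X → ℝ} (hf : ∀ i ∈ s, BddMeas (f i)) :
    BddMeas fun x => ∏ i ∈ s, f i x := by
  classical
  induction s using Finset.induction_on with
  | empty => simpa using const 1
  | insert i s hi ih =>
    simp only [Finset.prod_insert hi]
    exact (hf i (by simp)).mul (ih fun j hj => hf j (by simp [hj]))

lemma comp {h : Y → X} (hf : BddMeas f) (hh : Measurable h) : BddMeas fun y => f (h y) :=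
  ⟨hf.1.comp hh, hf.2.imp fun _ hC y => hC (h y)⟩

lemma integrable (hf : BddMeas f) (μ : Measure X) [IsFiniteMeasure μ] : Integrable f μ := by
  obtain ⟨hf, C, hC⟩ := hf
  exact Integrable.of_bound hf.aestronglyMeasurable C (Filter.Eventually.of_forall hC)

lemma integral_add (hf : BddMeas f) (hg : BddMeas g) (μ : Measure X) [IsFiniteMeasure μ] :
    ∫ x, (f x + g x) ∂μ = ∫ x, f x ∂μ + ∫ x, g x ∂μ :=
  MeasureTheory.integral_add (hf.integrable μ) (hg.integrable μ)

lemma integral_sub (hf : BddMeas f) (hg : BddMeas g) (μ : Measure X) [IsFiniteMeasure μ] :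
    ∫ x, (f x - g x) ∂μ = ∫ x, f x ∂μ - ∫ x, g x ∂μ :=
  MeasureTheory.integral_sub (hf.integrable μ) (hg.integrable μ)

lemma const_mul (c : ℝ) (hf : BddMeas f) : BddMeas fun x => c * f x := (const c).mul hf

/-- Closure under integrating out a kernel keeps value functions and expected returns in the class,
so that later integrability is a matter of boundedness. -/
lemma integral_kernel {f : X × Y → ℝ} (hf : BddMeas f) {κ : X → Measure Y} (hκ : Measurable κ)
    [∀ a, IsProbabilityMeasure (κ a)] : BddMeas fun a => ∫ y, f (a, y) ∂(κ a) := by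
  obtain ⟨hf, C, hC⟩ := hf
  let K : Kernel X Y := ⟨κ, hκ⟩
  have : IsMarkovKernel K := ⟨fun a => inferInstanceAs (IsProbabilityMeasure (κ a))⟩
  refine ⟨(hf.stronglyMeasurable.integral_kernel_prod_right' (κ := K)).measurable, C, fun a => ?_⟩
  have := norm_integral_le_of_norm_le_const (μ := κ a) (f := fun y => f (a, y))
    (Filter.Eventually.of_forall fun y => hC (a, y))
  simpa using this

end BddMeas

section Bind

variable {X Y : Type*} [MeasurableSpace X] [MeasurableSpace Y] {m : Measure X}
  [IsProbabilityMeasure m] {κ : X → Measure Y} [∀ a, IsProbabilityMeasure (κ a)] {f g : Y → ℝ}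

lemma isProbabilityMeasure_bind (m : Measure X) [IsProbabilityMeasure m] {κ : X → Measure Y}
    (hκ : Measurable κ) [∀ a, IsProbabilityMeasure (κ a)] : IsProbabilityMeasure (m.bind κ) :=
  ⟨by rw [Measure.bind_apply MeasurableSet.univ hκ.aemeasurable]; simp⟩

lemma integral_bind_of_bddMeas (hκ : Measurable κ) (hf : BddMeas f) :
    ∫ y, f y ∂(m.bind κ) = ∫ x, ∫ y, f y ∂(κ x) ∂m := by
  let K : Kernel X Y := ⟨κ, hκ⟩
  have hK : IsMarkovKernel K := ⟨fun a => inferInstanceAs (IsProbabilityMeasure (κ a))⟩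
  change ∫ y, f y ∂(m.bind K) = ∫ x, ∫ y, f y ∂(K x) ∂m
  rw [← Measure.snd_compProd, Measure.snd, integral_map measurable_snd.aemeasurable
    hf.1.aestronglyMeasurable, Measure.integral_compProd ((hf.comp measurable_snd).integrable _)]

lemma integral_bind_congr (hκ : Measurable κ) (hf : BddMeas f) (hg : BddMeas g)
    (h : ∀ x, ∫ y, f y ∂(κ x) = ∫ y, g y ∂(κ x)) :
    ∫ y, f y ∂(m.bind κ) = ∫ y, g y ∂(m.bind κ) := by
  rw [integral_bind_of_bddMeas hκ hf, integral_bind_of_bddMeas hκ hg]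
  exact integral_congr_ae (Filter.Eventually.of_forall h)

lemma integral_bind_le (hκ : Measurable κ) (hf : BddMeas f) {c : ℝ}
    (h : ∀ x, ∫ y, f y ∂(κ x) ≤ c) : ∫ y, f y ∂(m.bind κ) ≤ c := by
  rw [integral_bind_of_bddMeas hκ hf]
  calc ∫ x, ∫ y, f y ∂(κ x) ∂m ≤ ∫ _, c ∂m :=
        integral_mono (((hf.comp measurable_snd).integral_kernel hκ).integrable m)
          (integrable_const c) h
    _ = c := by simp

end Bind

/-! ### Laws of trajectories -/

namespace UPOMDP

variable {N T M d : ℕ} {S O A Θ : Type*} [MeasurableSpace S] [MeasurableSpace O]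
  [MeasurableSpace A] [MeasurableSpace Θ]

lemma measurable_cons (n : ℕ) :
    Measurable fun z : (S × A) × Traj n S A => (Fin.cons z.1 z.2 : Traj (n + 1) S A) := by
  refine measurable_pi_iff.2 fun t => ?_
  refine Fin.cases ?_ (fun t => ?_) t
  · simpa using measurable_fst
  · simpa [Function.comp_def] using (measurable_pi_apply (X := fun _ : Fin n => S × A) t).comp
      (measurable_snd (α := S × A))

lemma measurable_cons_right (n : ℕ) (z : S × A) :
    Measurable fun τ : Traj n S A => (Fin.cons z τ : Traj (n + 1) S A) :=
  (measurable_cons n).comp (measurable_const.prodMk measurable_id)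

variable [Fintype A]

instance (E : UPOMDP N S O A) (i : Fin N) : IsProbabilityMeasure (E.init i) := E.init_prob i

instance (E : UPOMDP N S O A) (i : Fin N) : IsMarkovKernel (E.trans i) := E.trans_markov i

lemma isProbabilityMeasure_sum {Y ι : Type*} [MeasurableSpace Y] [Fintype ι] {q : ι → ℝ}
    (hq : ∀ a, 0 ≤ q a) (hs : ∑ a, q a = 1) (ν : ι → Measure Y) [∀ a, IsProbabilityMeasure (ν a)] :
    IsProbabilityMeasure (∑ a, ENNReal.ofReal (q a) • ν a) :=
  ⟨by simp [← ENNReal.ofReal_sum_of_nonneg, hq, hs]⟩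

/-- Both properties are proved in one induction because composing with the tail law needs both. The
parameter `θ` makes the laws measurable functions of the iterates, as conditioning on the past
requires. -/
theorem measurable_trajFrom_aux (E : UPOMDP N S O A) {p : Θ → O → A → ℝ} (hp : ∀ θ, IsPolicy (p θ))
    (hm : ∀ a, Measurable fun z : Θ × O => p z.1 z.2 a) (i : Fin N) (n : ℕ) :
    (Measurable fun z : Θ × S => E.trajFrom (p z.1) i n z.2) ∧
      ∀ θ s, IsProbabilityMeasure (E.trajFrom (p θ) i n s) := by
  induction n with
  | zero => exact ⟨measurable_const, fun θ s => by simp only [trajFrom]; infer_instance⟩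
  | succ n ih =>
    obtain ⟨ihm, ihp⟩ := ih
    have hsec : ∀ θ, Measurable (E.trajFrom (p θ) i n) := fun θ =>
      ihm.comp (measurable_const.prodMk measurable_id)
    refine ⟨?_, fun θ s => ?_⟩
    · let κ : Kernel (Θ × S) (Traj n S A) := ⟨_, ihm⟩
      have hκ : IsMarkovKernel κ := ⟨fun z => ihp z.1 z.2⟩
      refine Measure.measurable_of_measurable_coe _ fun D hD => ?_
      simp only [trajFrom, Measure.finsetSum_apply, Measure.smul_apply, smul_eq_mul]
      refine Finset.measurable_sum _ fun a _ => ?_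
      have hobs : Measurable fun z : Θ × S => p z.1 (E.obs i z.2) a :=
        (hm a).comp (measurable_fst.prodMk ((E.obs_meas i).comp measurable_snd))
      refine hobs.ennreal_ofReal.mul ?_
      let τa : Kernel (Θ × S) S :=
        (E.trans i).comap (fun z => (z.2, a)) (measurable_snd.prodMk measurable_const)
      let κ' : Kernel ((Θ × S) × S) (Traj n S A) :=
        κ.comap (fun w => (w.1.1, w.2)) ((measurable_fst.fst).prodMk measurable_snd)
      have hD' : MeasurableSet {q : ((Θ × S) × S) × Traj n S A |
          (Fin.cons (q.1.1.2, a) q.2 : Traj (n + 1) S A) ∈ D} :=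
        ((measurable_cons n).comp
          ((measurable_fst.fst.snd.prodMk measurable_const).prodMk measurable_snd)) hD
      have h1 := Kernel.measurable_kernel_prodMk_left (κ := κ') hD'
      have h2 := Measurable.lintegral_kernel_prod_right' (κ := τa) h1
      convert! h2 using 2 with z
      rw [Measure.map_apply (measurable_cons_right n _) hD,
        Measure.bind_apply (measurable_cons_right n _ hD) (hsec z.1).aemeasurable]
      rfl
    · have := ihp θ
      have hb : ∀ a, IsProbabilityMeasure ((E.trans i (s, a)).bind (E.trajFrom (p θ) i n)) :=
        fun a => isProbabilityMeasure_bind _ (hsec θ)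
      have hb' : ∀ a, IsProbabilityMeasure (((E.trans i (s, a)).bind (E.trajFrom (p θ) i n)).map
          (fun τ => (Fin.cons (s, a) τ : Traj (n + 1) S A))) := fun a =>
        Measure.isProbabilityMeasure_map (measurable_cons_right n _).aemeasurable
      exact isProbabilityMeasure_sum ((hp θ).nonneg _) ((hp θ).sum_one _) _

theorem measurable_trajFrom_prod (E : UPOMDP N S O A) {p : Θ → O → A → ℝ}
    (hp : ∀ θ, IsPolicy (p θ)) (hm : ∀ a, Measurable fun z : Θ × O => p z.1 z.2 a) (i : Fin N)
    (n : ℕ) : Measurable fun z : Θ × S => E.trajFrom (p z.1) i n z.2 :=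
  (E.measurable_trajFrom_aux hp hm i n).1

variable {p : O → A → ℝ}

theorem measurable_trajFrom (E : UPOMDP N S O A) (hp : IsPolicy p) (i : Fin N) (n : ℕ) :
    Measurable (E.trajFrom p i n) :=
  (E.measurable_trajFrom_prod (Θ := Unit) (fun _ => hp) (fun a => (hp.meas a).comp measurable_snd)
    i n).comp (measurable_const (a := ()) |>.prodMk measurable_id)

theorem isProbabilityMeasure_trajFrom (E : UPOMDP N S O A) (hp : IsPolicy p) (i : Fin N) (n : ℕ)
    (s : S) : IsProbabilityMeasure (E.trajFrom p i n s) :=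
  (E.measurable_trajFrom_aux (Θ := Unit) (fun _ => hp)
    (fun a => (hp.meas a).comp measurable_snd) i n).2 () s

/-- Law of the `n` state-action pairs that follow the pair `(s, a)`. -/
def trajAfter (E : UPOMDP N S O A) (p : O → A → ℝ) (i : Fin N) (n : ℕ) (s : S) (a : A) :
    Measure (Traj n S A) :=
  (E.trans i (s, a)).bind (E.trajFrom p i n)

theorem isProbabilityMeasure_trajAfter (E : UPOMDP N S O A) (hp : IsPolicy p) (i : Fin N) (n : ℕ)
    (s : S) (a : A) : IsProbabilityMeasure (E.trajAfter p i n s a) :=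
  have := E.isProbabilityMeasure_trajFrom hp i n
  isProbabilityMeasure_bind _ (E.measurable_trajFrom hp i n)

theorem isProbabilityMeasure_trajLaw (E : UPOMDP N S O A) (hp : IsPolicy p) (i : Fin N) :
    IsProbabilityMeasure (E.trajLaw T p i) :=
  have := E.isProbabilityMeasure_trajFrom hp i T
  isProbabilityMeasure_bind _ (E.measurable_trajFrom hp i T)

theorem measurable_trajLaw_prod (E : UPOMDP N S O A) {p : Θ → O → A → ℝ}
    (hp : ∀ θ, IsPolicy (p θ)) (hm : ∀ a, Measurable fun z : Θ × O => p z.1 z.2 a) (i : Fin N) :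
    Measurable fun θ => E.trajLaw T (p θ) i := by
  have hκ := E.measurable_trajFrom_prod hp hm i T
  let κ : Kernel (Θ × S) (Traj T S A) := ⟨_, hκ⟩
  have : IsMarkovKernel κ := ⟨fun z => E.isProbabilityMeasure_trajFrom (hp z.1) i T z.2⟩
  refine Measure.measurable_of_measurable_coe _ fun D hD => ?_
  have h := Measurable.lintegral_kernel_prod_right' (κ := Kernel.const Θ (E.init i))
    (κ.measurable_coe hD)
  convert! h using 2 with θ
  rw [trajLaw, Measure.bind_apply hD (E.measurable_trajFrom (hp θ) i T).aemeasurable]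
  rfl

/-- The defining sum over the first action, in terms of integrals; inductions over the horizon peel
off the first pair through it. -/
theorem integral_trajFrom_succ (E : UPOMDP N S O A) (hp : IsPolicy p) (i : Fin N) (n : ℕ) (s : S)
    {f : Traj (n + 1) S A → ℝ} (hf : BddMeas f) :
    ∫ τ, f τ ∂(E.trajFrom p i (n + 1) s) =
      ∑ a, p (E.obs i s) a * ∫ τ, f (Fin.cons (s, a) τ) ∂(E.trajAfter p i n s a) := by
  have hP := E.isProbabilityMeasure_trajAfter hp i n s
  have hc := fun a => measurable_cons_right n ((s, a) : S × A)
  have hP' : ∀ a, IsProbabilityMeasure ((E.trajAfter p i n s a).map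
      (fun τ => (Fin.cons (s, a) τ : Traj (n + 1) S A))) := fun a =>
    Measure.isProbabilityMeasure_map (hc a).aemeasurable
  change ∫ τ, f τ ∂(∑ a, ENNReal.ofReal (p (E.obs i s) a) • (E.trajAfter p i n s a).map
    (fun τ => (Fin.cons (s, a) τ : Traj (n + 1) S A))) = _
  rw [integral_finsetSum_measure fun a _ => (hf.integrable _).smul_measure (by simp)]
  refine Finset.sum_congr rfl fun a _ => ?_
  rw [integral_smul_measure, integral_map (hc a).aemeasurable hf.1.aestronglyMeasurable,
    ENNReal.toReal_ofReal (hp.nonneg _ _), smul_eq_mul]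

/-- A weighted sum of measures vanishes on a set exactly when each term of non-zero weight does.
Almost sure bounds thus pass to the law after each action that is played. -/
theorem ae_trajFrom_succ (E : UPOMDP N S O A) (hp : IsPolicy p) (i : Fin N) (n : ℕ) (s : S)
    {q : Traj (n + 1) S A → Prop} (hq : MeasurableSet {τ | q τ}) :
    (∀ᵐ τ ∂(E.trajFrom p i (n + 1) s), q τ) ↔
      ∀ a, p (E.obs i s) a ≠ 0 → ∀ᵐ τ ∂(E.trajAfter p i n s a), q (Fin.cons (s, a) τ) := by
  have hc := fun a => measurable_cons_right n ((s, a) : S × A)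
  change (∀ᵐ τ ∂(∑ a, ENNReal.ofReal (p (E.obs i s) a) • (E.trajAfter p i n s a).map
    (fun τ => (Fin.cons (s, a) τ : Traj (n + 1) S A))), q τ) ↔ _
  have key : ∀ a, ((ENNReal.ofReal (p (E.obs i s) a) • (E.trajAfter p i n s a).map
      (fun τ => (Fin.cons (s, a) τ : Traj (n + 1) S A))) {τ | ¬ q τ} = 0 ↔
      (p (E.obs i s) a ≠ 0 → ∀ᵐ τ ∂(E.trajAfter p i n s a), q (Fin.cons (s, a) τ))) := by
    intro a
    have hq' : MeasurableSet {τ | ¬ q τ} := hq.compl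
    rw [Measure.smul_apply, Measure.map_apply (hc a) hq', smul_eq_mul, mul_eq_zero,
      ENNReal.ofReal_eq_zero, ae_iff]
    constructor
    · rintro (h | h) h'
      · exact absurd (le_antisymm h (hp.nonneg _ _)) h'
      · exact h
    · intro h
      by_cases h' : p (E.obs i s) a = 0
      · exact Or.inl h'.le
      · exact Or.inr (h h')
  rw [ae_iff, Measure.finsetSum_apply]
  rw [Finset.sum_eq_zero_iff]
  simp only [Finset.mem_univ, true_implies, key]

end UPOMDP

/-! ### Almost sure statements and moments -/

section Auxiliary

variable {X Y : Type*} [MeasurableSpace X] [MeasurableSpace Y]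

lemma ae_bind_of_ae_ae {m : Measure X} {κ : X → Measure Y} (hκ : Measurable κ) {q : Y → Prop}
    (hq : MeasurableSet {y | q y}) (h : ∀ᵐ x ∂m, ∀ᵐ y ∂(κ x), q y) : ∀ᵐ y ∂(m.bind κ), q y := by
  have hq' : MeasurableSet {y | ¬ q y} := hq.compl
  rw [ae_iff, Measure.bind_apply hq' hκ.aemeasurable]
  refine (lintegral_congr_ae ?_).trans lintegral_zero
  filter_upwards [h] with x hx using ae_iff.1 hx

/-- The variance about the mean `c` is nonnegative. -/
lemma sq_integral_le {m : Measure X} [IsProbabilityMeasure m] {f : X → ℝ} (hf : BddMeas f) :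
    (∫ x, f x ∂m) ^ 2 ≤ ∫ x, f x ^ 2 ∂m := by
  set c := ∫ x, f x ∂m with hc
  have h : 0 ≤ ∫ x, (f x - c) ^ 2 ∂m := integral_nonneg fun x => sq_nonneg _
  have h' : ∫ x, (f x - c) ^ 2 ∂m = ∫ x, f x ^ 2 ∂m - c ^ 2 := by
    have : ∀ x, (f x - c) ^ 2 = f x ^ 2 - 2 * c * f x + c ^ 2 := fun x => by ring
    simp only [this]
    rw [(hf.sq.sub (hf.const_mul _)).integral_add (BddMeas.const _),
      hf.sq.integral_sub (hf.const_mul _), integral_const_mul, ← hc]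
    simp
    ring
  linarith

lemma abs_integral_le_of_ae {m : Measure X} [IsProbabilityMeasure m] {f : X → ℝ} {C : ℝ}
    (h : ∀ᵐ x ∂m, |f x| ≤ C) : |∫ x, f x ∂m| ≤ C := by
  simpa using norm_integral_le_of_norm_le_const (μ := m) (f := f) h

/-- A countable discrete factor turns measurability of the sections into joint measurability;
rewards and policies are given action by action. -/
lemma bddMeas_prod {A : Type*} [MeasurableSpace A] [DiscreteMeasurableSpace A] [Finite A]
    {f : X × A → ℝ} (hf : ∀ a, Measurable fun x => f (x, a)) {C : ℝ} (hC : ∀ z, |f z| ≤ C) :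
    BddMeas f := by
  refine ⟨?_, C, hC⟩
  have : Countable A := Finite.to_countable
  exact measurable_from_prod_countable_left hf

end Auxiliary

/-! ### Likelihood ratios and martingales along a trajectory -/

namespace UPOMDP

variable {n : ℕ} {S A : Type*}

/-- The sum of `φ` along a trajectory. -/
def pathSum (φ : S × A → ℝ) (τ : Traj n S A) : ℝ := ∑ t, φ (τ t)

/-- The product of `1 + φ` along a trajectory. -/
def pathProd (φ : S × A → ℝ) (τ : Traj n S A) : ℝ := ∏ t, (1 + φ (τ t))

@[simp] lemma pathSum_cons (φ : S × A → ℝ) (z : S × A) (τ : Traj n S A) :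
    pathSum φ (Fin.cons z τ : Traj (n + 1) S A) = φ z + pathSum φ τ := by
  simp [pathSum, Fin.sum_univ_succ]

@[simp] lemma pathProd_cons (φ : S × A → ℝ) (z : S × A) (τ : Traj n S A) :
    pathProd φ (Fin.cons z τ : Traj (n + 1) S A) = (1 + φ z) * pathProd φ τ := by
  simp [pathProd, Fin.prod_univ_succ]

section Trajectories

variable {N T M d : ℕ} {O Θ : Type*} [MeasurableSpace S] [MeasurableSpace O]
  [MeasurableSpace A] [MeasurableSpace Θ]

lemma bddMeas_pathSum {φ : S × A → ℝ} (hφ : BddMeas φ) :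
    BddMeas (pathSum φ : Traj n S A → ℝ) :=
  BddMeas.sum fun t _ => hφ.comp (measurable_pi_apply t)

lemma bddMeas_pathProd {φ : S × A → ℝ} (hφ : BddMeas φ) :
    BddMeas (pathProd φ : Traj n S A → ℝ) :=
  BddMeas.prod fun t _ => (BddMeas.const 1).add (hφ.comp (measurable_pi_apply t))

variable [Fintype A] {p p' : O → A → ℝ} {φ ψ : S × A → ℝ}

/-- The law after a pair is a mixture of the laws from the next state, so an identity valid from
every state survives. -/
theorem integral_trajAfter_congr (E : UPOMDP N S O A) (hp : IsPolicy p) (i : Fin N) {s : S} {a : A}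
    {f g : Traj n S A → ℝ} (hf : BddMeas f) (hg : BddMeas g)
    (h : ∀ s, ∫ τ, f τ ∂(E.trajFrom p i n s) = ∫ τ, g τ ∂(E.trajFrom p i n s)) :
    ∫ τ, f τ ∂(E.trajAfter p i n s a) = ∫ τ, g τ ∂(E.trajAfter p i n s a) :=
  have := E.isProbabilityMeasure_trajFrom hp i n
  integral_bind_congr (E.measurable_trajFrom hp i n) hf hg h

theorem integral_trajAfter_eq_const (E : UPOMDP N S O A) (hp : IsPolicy p) (i : Fin N) {s : S}
    {a : A} {f : Traj n S A → ℝ} (hf : BddMeas f) {c : ℝ}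
    (h : ∀ s, ∫ τ, f τ ∂(E.trajFrom p i n s) = c) : ∫ τ, f τ ∂(E.trajAfter p i n s a) = c := by
  have := E.isProbabilityMeasure_trajFrom hp i n
  have := E.isProbabilityMeasure_trajAfter hp i n s a
  rw [E.integral_trajAfter_congr hp i hf (BddMeas.const c) fun s => by rw [h s]; simp]
  simp

theorem integral_trajAfter_le (E : UPOMDP N S O A) (hp : IsPolicy p) (i : Fin N) {s : S}
    {a : A} {f : Traj n S A → ℝ} (hf : BddMeas f) {c : ℝ}
    (h : ∀ s, ∫ τ, f τ ∂(E.trajFrom p i n s) ≤ c) : ∫ τ, f τ ∂(E.trajAfter p i n s a) ≤ c :=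
  have := E.isProbabilityMeasure_trajFrom hp i n
  integral_bind_le (E.measurable_trajFrom hp i n) hf h

/-- `φ` has conditional mean zero given the present state. -/
def IsCentred (E : UPOMDP N S O A) (p : O → A → ℝ) (i : Fin N) (φ : S × A → ℝ) : Prop :=
  ∀ s, ∑ a, p (E.obs i s) a * φ (s, a) = 0

/-- A sum of martingale differences: each increment has conditional mean zero. -/
theorem integral_pathSum (E : UPOMDP N S O A) (hp : IsPolicy p) (i : Fin N) (hφ : BddMeas φ)
    (h0 : E.IsCentred p i φ) (n : ℕ) (s : S) :
    ∫ τ, pathSum φ τ ∂(E.trajFrom p i n s) = 0 := by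
  induction n generalizing s with
  | zero => simp [pathSum]
  | succ n ih =>
    rw [E.integral_trajFrom_succ hp i n s (bddMeas_pathSum hφ), ← h0 s]
    refine Finset.sum_congr rfl fun a _ => ?_
    have := E.isProbabilityMeasure_trajAfter hp i n s a
    simp only [pathSum_cons]
    rw [integral_add (integrable_const _) ((bddMeas_pathSum hφ).integrable _),
      E.integral_trajAfter_eq_const hp i (bddMeas_pathSum hφ) ih]
    simp

/-- Change of measure: each step contributes the ratio `1 + φ` of the action probabilities, while
the transitions are common to both policies and cancel. -/
theorem integral_mul_pathProd (E : UPOMDP N S O A) (hp : IsPolicy p) (hp' : IsPolicy p') (i : Fin N)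
    (hφ : BddMeas φ) (h : ∀ s a, p' (E.obs i s) a = p (E.obs i s) a * (1 + φ (s, a)))
    (n : ℕ) (s : S) {f : Traj n S A → ℝ} (hf : BddMeas f) :
    ∫ τ, f τ ∂(E.trajFrom p' i n s) = ∫ τ, f τ * pathProd φ τ ∂(E.trajFrom p i n s) := by
  induction n generalizing s with
  | zero => simp [trajFrom, pathProd]
  | succ n ih =>
    rw [E.integral_trajFrom_succ hp i n s (hf.mul (bddMeas_pathProd hφ)),
      E.integral_trajFrom_succ hp' i n s hf]
    refine Finset.sum_congr rfl fun a _ => ?_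
    have hf' := hf.comp (measurable_cons_right n (s, a))
    simp only [pathProd_cons]
    rw [h, mul_assoc, ← integral_const_mul]
    congr 1
    -- The ratio of the first step is constant on the tail, so it joins the test function before the
    -- induction hypothesis is applied.
    have h1 : ∫ τ, (1 + φ (s, a)) * f (Fin.cons (s, a) τ) ∂(E.trajAfter p' i n s a) =
        ∫ τ, (1 + φ (s, a)) * f (Fin.cons (s, a) τ) * pathProd φ τ ∂(E.trajAfter p i n s a) := by
      have := E.isProbabilityMeasure_trajFrom hp i n
      have := E.isProbabilityMeasure_trajFrom hp' i n
      have hb := (BddMeas.const (1 + φ (s, a))).mul hf'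
      rw [trajAfter, trajAfter, integral_bind_of_bddMeas (E.measurable_trajFrom hp' i n) hb,
        integral_bind_of_bddMeas (E.measurable_trajFrom hp i n) (hb.mul (bddMeas_pathProd hφ))]
      exact integral_congr_ae (Filter.Eventually.of_forall fun s' => ih s' hb)
    rw [h1]
    exact integral_congr_ae (Filter.Eventually.of_forall fun τ => by ring)

/-- Given the present state each factor `1 + φ` has mean one, so the product is a martingale. -/
theorem integral_pathProd (E : UPOMDP N S O A) (hp : IsPolicy p) (i : Fin N) (hφ : BddMeas φ)
    (h0 : E.IsCentred p i φ) (n : ℕ) (s : S) :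
    ∫ τ, pathProd φ τ ∂(E.trajFrom p i n s) = 1 := by
  induction n generalizing s with
  | zero => simp [trajFrom, pathProd]
  | succ n ih =>
    rw [E.integral_trajFrom_succ hp i n s (bddMeas_pathProd hφ)]
    have : ∀ a, ∫ τ, pathProd φ (Fin.cons (s, a) τ : Traj (n + 1) S A)
        ∂(E.trajAfter p i n s a) = 1 + φ (s, a) := fun a => by
      simp only [pathProd_cons]
      rw [integral_const_mul, E.integral_trajAfter_eq_const hp i (bddMeas_pathProd hφ) ih, mul_one]
    simp only [this, mul_add, mul_one, Finset.sum_add_distrib, hp.sum_one, h0 s, add_zero]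

/-- Second moment of a combination of the product martingale and its linearisation. -/
theorem integral_sq_pathProd_sub_pathSum_le (E : UPOMDP N S O A) (hp : IsPolicy p) (i : Fin N)
    (hφ : BddMeas φ) (h0 : E.IsCentred p i φ) {v : ℝ} (hv : 0 ≤ v)
    (h2 : ∀ s, ∑ a, p (E.obs i s) a * φ (s, a) ^ 2 ≤ v) (n : ℕ) (s : S) (m : ℝ) :
    ∫ τ, (m * (pathProd φ τ - 1) - pathSum φ τ) ^ 2 ∂(E.trajFrom p i n s) ≤
      m ^ 2 * ((1 + v) ^ n - 1) - 2 * m * (n * v) + n * v := by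
  have hb : ∀ (k : ℕ) (c : ℝ),
      BddMeas fun τ : Traj k S A => c * (pathProd φ τ - 1) - pathSum φ τ := fun k c =>
    ((BddMeas.const c).mul ((bddMeas_pathProd hφ).sub (BddMeas.const 1))).sub (bddMeas_pathSum hφ)
  -- Peeling off the first pair, with `z = φ (s, a)`, changes the multiplier `m` into `m * (1 + z)`,
  -- so all multipliers are treated at once. The bound is the exact second moment when every
  -- conditional variance equals `v`.
  induction n generalizing s m with
  | zero => simp [trajFrom, pathProd, pathSum]
  | succ n ih =>
    rw [E.integral_trajFrom_succ hp i n s (hb _ _).sq]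
    set an : ℝ := (1 + v) ^ n - 1 with han
    have han0 : 0 ≤ an := by
      have := one_le_pow₀ (n := n) (show 1 ≤ 1 + v by linarith)
      linarith
    have step : ∀ a, ∫ τ, (m * (pathProd φ (Fin.cons (s, a) τ : Traj (n + 1) S A) - 1)
        - pathSum φ (Fin.cons (s, a) τ : Traj (n + 1) S A)) ^ 2 ∂(E.trajAfter p i n s a) ≤
        (m - 1) ^ 2 * φ (s, a) ^ 2 + ((m * (1 + φ (s, a))) ^ 2 * an
          - 2 * (m * (1 + φ (s, a))) * (n * v) + n * v) := fun a => by
      have := E.isProbabilityMeasure_trajAfter hp i n s a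
      set z := φ (s, a)
      -- The tail has mean zero, so the cross term of the expanded square drops out.
      have hU : ∫ τ, (m * (1 + z) * (pathProd φ τ - 1) - pathSum φ τ)
          ∂(E.trajAfter p i n s a) = 0 := by
        refine E.integral_trajAfter_eq_const hp i (hb _ _) fun s' => ?_
        have := E.isProbabilityMeasure_trajFrom hp i n s'
        rw [integral_sub (((BddMeas.const _).mul
          ((bddMeas_pathProd hφ).sub (BddMeas.const 1))).integrable _)
          ((bddMeas_pathSum hφ).integrable _), integral_const_mul,
          integral_sub ((bddMeas_pathProd hφ).integrable _) (integrable_const _),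
          E.integral_pathProd hp i hφ h0, E.integral_pathSum hp i hφ h0]
        simp
      have hQ := E.integral_trajAfter_le hp i (s := s) (a := a) (hb n (m * (1 + z))).sq
        fun s' => ih s' (m * (1 + z))
      have hexp : ∀ τ : Traj n S A, (m * (pathProd φ (Fin.cons (s, a) τ : Traj (n + 1) S A) - 1)
          - pathSum φ (Fin.cons (s, a) τ : Traj (n + 1) S A)) ^ 2 =
          (m - 1) ^ 2 * z ^ 2 + 2 * (m - 1) * z *
            (m * (1 + z) * (pathProd φ τ - 1) - pathSum φ τ) +
          (m * (1 + z) * (pathProd φ τ - 1) - pathSum φ τ) ^ 2 := fun τ => by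
        rw [pathProd_cons, pathSum_cons]; ring
      simp only [hexp]
      rw [((BddMeas.const _).add ((hb n _).const_mul _)).integral_add (hb n _).sq,
        (BddMeas.const _).integral_add ((hb n _).const_mul _),
        integral_const_mul (2 * (m - 1) * z), hU]
      simp only [integral_const, probReal_univ, one_smul, mul_zero, add_zero]
      linarith
    set w := ∑ a, p (E.obs i s) a * φ (s, a) ^ 2 with hw
    have hwv : w ≤ v := h2 s
    calc _ ≤ ∑ a, p (E.obs i s) a * ((m - 1) ^ 2 * φ (s, a) ^ 2 + ((m * (1 + φ (s, a))) ^ 2 * an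
          - 2 * (m * (1 + φ (s, a))) * (n * v) + n * v)) :=
          Finset.sum_le_sum fun a _ => mul_le_mul_of_nonneg_left (step a) (hp.nonneg _ _)
      _ = (m - 1) ^ 2 * w + (m ^ 2 * (1 + w) * an - 2 * m * (n * v) + n * v) := by
          have e : ∀ a, p (E.obs i s) a * ((m - 1) ^ 2 * φ (s, a) ^ 2
              + ((m * (1 + φ (s, a))) ^ 2 * an - 2 * (m * (1 + φ (s, a))) * (n * v) + n * v)) =
              ((m - 1) ^ 2 + m ^ 2 * an) * (p (E.obs i s) a * φ (s, a) ^ 2)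
              + (2 * m ^ 2 * an - 2 * m * (n * v)) * (p (E.obs i s) a * φ (s, a))
              + (m ^ 2 * an - 2 * m * (n * v) + n * v) * p (E.obs i s) a := fun a => by ring
          simp only [e, Finset.sum_add_distrib, ← Finset.mul_sum, hp.sum_one, h0 s, ← hw]
          ring
      _ ≤ _ := by
          have e : m ^ 2 * ((1 + v) ^ (n + 1) - 1) - 2 * m * ((n + 1 : ℕ) * v) + (n + 1 : ℕ) * v =
              (m - 1) ^ 2 * v + (m ^ 2 * (1 + v) * an - 2 * m * (n * v) + n * v) := by
            rw [han]; push_cast; ring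
          rw [e]
          -- The conditional variance `w` enters with a nonnegative coefficient and may be replaced
          -- by its bound `v`.
          have h3 : 0 ≤ (v - w) * ((m - 1) ^ 2 + m ^ 2 * an) :=
            mul_nonneg (by linarith) (by positivity)
          nlinarith [h3]

/-- Compare with `exp (n * v)` and use `|exp x - 1 - x| ≤ x ^ 2` for `|x| ≤ 1`. -/
lemma one_add_pow_sub_le {v : ℝ} (hv : 0 ≤ v) (n : ℕ) (h : n * v ≤ 1) :
    (1 + v) ^ n - 1 - n * v ≤ (n * v) ^ 2 := by
  have h1 : (1 + v) ^ n ≤ Real.exp (n * v) := by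
    rw [Real.exp_nat_mul]
    exact pow_le_pow_left₀ (by linarith) (by linarith [Real.add_one_le_exp v]) n
  have h2 := Real.abs_exp_sub_one_sub_id_le (x := n * v) (by rwa [abs_of_nonneg (by positivity)])
  linarith [(abs_le.1 h2).2]

/-- The error of the linearisation of the likelihood ratio is of second order, with a constant
that is linear in the length of the trajectory. -/
theorem integral_abs_pathProd_sub_le (E : UPOMDP N S O A) (hp : IsPolicy p) (i : Fin N)
    (hφ : BddMeas φ) (h0 : E.IsCentred p i φ) (h1 : ∀ z, 0 ≤ 1 + φ z) {v : ℝ} (hv : 0 ≤ v)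
    (h2 : ∀ s, ∑ a, p (E.obs i s) a * φ (s, a) ^ 2 ≤ v) (n : ℕ) (s : S) :
    ∫ τ, |pathProd φ τ - 1 - pathSum φ τ| ∂(E.trajFrom p i n s) ≤ 3 * (n * v) := by
  have := E.isProbabilityMeasure_trajFrom hp i n s
  have hP := bddMeas_pathProd (n := n) hφ
  have hS := bddMeas_pathSum (n := n) hφ
  have hZ := (hP.sub (BddMeas.const 1)).sub hS
  have hnv : 0 ≤ n * v := by positivity
  -- For `n * v ≤ 1` the multiplier `m = 1` bounds the second moment of the error by `(n * v) ^ 2`.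
  -- For `n * v > 1` that bound may be exponential in `n * v`; instead the product is nonnegative
  -- with mean one, and `m = 0` controls the sum, for a total of `2 + n * v ≤ 3 * (n * v)`.
  rcases le_or_gt (n * v) 1 with h | h
  · have e := E.integral_sq_pathProd_sub_pathSum_le hp i hφ h0 hv h2 n s 1
    have e1 := sq_integral_le (m := E.trajFrom p i n s) hZ.abs
    simp only [sq_abs] at e1
    simp only [one_mul] at e
    have e2 := one_add_pow_sub_le hv n h
    have : ∫ τ, |pathProd φ τ - 1 - pathSum φ τ| ∂(E.trajFrom p i n s) ≤ n * v :=
      (le_abs_self _).trans (abs_le_of_sq_le_sq (by nlinarith) hnv)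
    linarith
  · have e := E.integral_sq_pathProd_sub_pathSum_le hp i hφ h0 hv h2 n s 0
    have e1 := sq_integral_le (m := E.trajFrom p i n s) hS.abs
    simp only [sq_abs] at e1
    simp at e
    have e3 : ∫ τ, |pathSum φ τ| ∂(E.trajFrom p i n s) ≤ n * v :=
      (le_abs_self _).trans (abs_le_of_sq_le_sq (by nlinarith) hnv)
    calc ∫ τ, |pathProd φ τ - 1 - pathSum φ τ| ∂(E.trajFrom p i n s)
        ≤ ∫ τ, (pathProd φ τ + 1 + |pathSum φ τ|) ∂(E.trajFrom p i n s) := by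
          refine integral_mono (hZ.abs.integrable _)
            (((hP.add (BddMeas.const 1)).add hS.abs).integrable _) fun τ => ?_
          have : 0 ≤ pathProd φ τ := Finset.prod_nonneg fun t _ => h1 _
          have e5 := abs_sub (pathProd φ τ - 1) (pathSum φ τ)
          have e6 := abs_sub (pathProd φ τ) 1
          rw [abs_one, abs_of_nonneg this] at e6
          linarith
      _ = 1 + 1 + ∫ τ, |pathSum φ τ| ∂(E.trajFrom p i n s) := by
          rw [integral_add ((hP.add (BddMeas.const 1)).integrable _) (hS.abs.integrable _),
            integral_add (hP.integrable _) (integrable_const _), E.integral_pathProd hp i hφ h0]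
          simp
      _ ≤ _ := by linarith

end Trajectories

end UPOMDP

/-! ### Returns, value functions and the policy gradient theorem -/

namespace UPOMDP

variable {N T M d n : ℕ} {S O A Θ : Type*} [MeasurableSpace S] [MeasurableSpace O]
  [MeasurableSpace A] [MeasurableSpace Θ]

lemma ret_cons (E : UPOMDP N S O A) (i : Fin N) (z : S × A) (τ : Traj n S A) :
    E.ret i (Fin.cons z τ : Traj (n + 1) S A) = E.reward i z.1 z.2 + E.γ * E.ret i τ := by
  simp only [ret, tailReturn, Fin.sum_univ_succ, Finset.mul_sum]
  simp [pow_succ']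
  exact Finset.sum_congr rfl fun t _ => by ring

lemma tailReturn_succ_cons (E : UPOMDP N S O A) (i : Fin N) (t : ℕ) (z : S × A)
    (τ : Traj n S A) :
    E.tailReturn i (t + 1) (Fin.cons z τ : Traj (n + 1) S A) = E.γ * E.tailReturn i t τ := by
  simp only [tailReturn, Fin.sum_univ_succ, Finset.mul_sum]
  simp [pow_succ', mul_assoc]

variable [Fintype A]

/-- Deleting the first pair lowers time and horizon together, so the number of steps to go is
unchanged and one factor `γ` comes out. This drives the induction for the policy gradient theorem.
-/
lemma weight_succ_cons (E : UPOMDP N S O A) {p : O → A → ℝ} (w : WeightKind) (i : Fin N) (t : Fin n)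
    (z : S × A) (τ : Traj n S A) :
    E.weight w p i t.succ (Fin.cons z τ : Traj (n + 1) S A) = E.γ * E.weight w p i t τ := by
  cases w with
  | returnToGo => exact E.tailReturn_succ_cons i t z τ
  | advantage =>
    have h1 : n + 1 - 1 - ((t : ℕ) + 1) = n - 1 - t := by omega
    have h2 : n + 1 - ((t : ℕ) + 1) = n - t := by omega
    simp only [weight, Fin.val_succ, Fin.cons_succ, h1, h2]
    ring

variable {p : O → A → ℝ} {ψ : S × A → ℝ}

/-- The sum in the policy gradient estimator, in the direction in which the score function is `ψ`. -/
def weightedSum (E : UPOMDP N S O A) (w : WeightKind) (p : O → A → ℝ) (i : Fin N) (ψ : S × A → ℝ)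
    (τ : Traj n S A) : ℝ :=
  ∑ t, E.weight w p i t τ * ψ (τ t)

lemma weightedSum_cons (E : UPOMDP N S O A) (w : WeightKind) (i : Fin N) (z : S × A)
    (τ : Traj n S A) :
    E.weightedSum w p i ψ (Fin.cons z τ : Traj (n + 1) S A) =
      E.weight w p i 0 (Fin.cons z τ : Traj (n + 1) S A) * ψ z + E.γ * E.weightedSum w p i ψ τ := by
  rw [weightedSum, Fin.sum_univ_succ]
  simp only [weight_succ_cons, Fin.cons_succ, Fin.cons_zero, weightedSum, Finset.mul_sum, mul_assoc]

variable [DiscreteMeasurableSpace A]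

lemma bddMeas_reward (E : UPOMDP N S O A) (i : Fin N) :
    BddMeas fun z : S × A => E.reward i z.1 z.2 := by
  obtain ⟨b, hb⟩ := E.reward_bdd
  exact bddMeas_prod (E.reward_meas i) fun z => hb i z.1 z.2

lemma bddMeas_tailReturn (E : UPOMDP N S O A) (i : Fin N) (t : ℕ) :
    BddMeas (E.tailReturn i t : Traj n S A → ℝ) := by
  refine BddMeas.sum fun k _ => ?_
  by_cases h : t ≤ (k : ℕ)
  · simpa [h] using ((E.bddMeas_reward i).comp (measurable_pi_apply k)).const_mul (E.γ ^ (k : ℕ))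
  · simpa [h] using BddMeas.const 0

lemma bddMeas_ret (E : UPOMDP N S O A) (i : Fin N) : BddMeas (E.ret i : Traj n S A → ℝ) :=
  E.bddMeas_tailReturn i 0

theorem bddMeas_value_prod (E : UPOMDP N S O A) {p : Θ → O → A → ℝ} (hp : ∀ θ, IsPolicy (p θ))
    (hm : ∀ a, Measurable fun z : Θ × O => p z.1 z.2 a) (i : Fin N) (n : ℕ) :
    BddMeas fun z : Θ × S => E.value (p z.1) i n z.2 := by
  have : ∀ z : Θ × S, IsProbabilityMeasure (E.trajFrom (p z.1) i n z.2) := fun z =>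
    E.isProbabilityMeasure_trajFrom (hp z.1) i n z.2
  exact ((E.bddMeas_ret i).comp measurable_snd).integral_kernel
    (E.measurable_trajFrom_prod hp hm i n)

theorem bddMeas_qValue_prod (E : UPOMDP N S O A) {p : Θ → O → A → ℝ} (hp : ∀ θ, IsPolicy (p θ))
    (hm : ∀ a, Measurable fun z : Θ × O => p z.1 z.2 a) (i : Fin N) (n : ℕ) :
    BddMeas fun z : Θ × (S × A) => E.qValue (p z.1) i n z.2.1 z.2.2 := by
  have h := ((E.bddMeas_value_prod hp hm i n).comp (Y := (Θ × (S × A)) × S)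
    (h := fun w => (w.1.1, w.2)) ((measurable_fst.fst).prodMk measurable_snd)).integral_kernel
    (κ := fun z : Θ × (S × A) => E.trans i z.2) ((E.trans i).measurable.comp measurable_snd)
  exact ((E.bddMeas_reward i).comp measurable_snd).add (h.const_mul E.γ)

theorem bddMeas_weight_prod (E : UPOMDP N S O A) (w : WeightKind) {p : Θ → O → A → ℝ}
    (hp : ∀ θ, IsPolicy (p θ)) (hm : ∀ a, Measurable fun z : Θ × O => p z.1 z.2 a) (i : Fin N)
    (t : Fin T) : BddMeas fun z : Θ × Traj T S A => E.weight w (p z.1) i t z.2 := by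
  cases w with
  | returnToGo => exact (E.bddMeas_tailReturn i t).comp measurable_snd
  | advantage =>
    have ht : Measurable fun z : Θ × Traj T S A => z.2 t :=
      (measurable_pi_apply t).comp measurable_snd
    exact (((E.bddMeas_qValue_prod hp hm i (T - 1 - t)).comp
      (h := fun z : Θ × Traj T S A => (z.1, z.2 t)) (measurable_fst.prodMk ht)).sub
      ((E.bddMeas_value_prod hp hm i (T - t)).comp
      (h := fun z : Θ × Traj T S A => (z.1, (z.2 t).1)) (measurable_fst.prodMk ht.fst))).const_mul _

theorem bddMeas_value (E : UPOMDP N S O A) (hp : IsPolicy p) (i : Fin N) (n : ℕ) :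
    BddMeas (E.value p i n) :=
  (E.bddMeas_value_prod (Θ := Unit) (fun _ => hp) (fun a => (hp.meas a).comp measurable_snd) i
    n).comp ((measurable_const (a := ())).prodMk measurable_id)

theorem bddMeas_qValue (E : UPOMDP N S O A) (hp : IsPolicy p) (i : Fin N) (n : ℕ) :
    BddMeas fun z : S × A => E.qValue p i n z.1 z.2 :=
  (E.bddMeas_qValue_prod (Θ := Unit) (fun _ => hp) (fun a => (hp.meas a).comp measurable_snd) i
    n).comp ((measurable_const (a := ())).prodMk measurable_id)

theorem bddMeas_weight (E : UPOMDP N S O A) (w : WeightKind) (hp : IsPolicy p) (i : Fin N)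
    (t : Fin T) : BddMeas (E.weight w p i t : Traj T S A → ℝ) :=
  (E.bddMeas_weight_prod (Θ := Unit) w (fun _ => hp) (fun a => (hp.meas a).comp measurable_snd) i
    t).comp ((measurable_const (a := ())).prodMk measurable_id)

/-- Identifies the action value as the conditional mean of the return given the first pair. -/
theorem integral_ret_cons_trajAfter (E : UPOMDP N S O A) (hp : IsPolicy p) (i : Fin N) (n : ℕ)
    (s : S) (a : A) :
    ∫ τ, E.ret i (Fin.cons (s, a) τ : Traj (n + 1) S A) ∂(E.trajAfter p i n s a) =
      E.qValue p i n s a := by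
  have := E.isProbabilityMeasure_trajAfter hp i n s a
  have := E.isProbabilityMeasure_trajFrom hp i n
  simp only [ret_cons]
  rw [(BddMeas.const _).integral_add ((E.bddMeas_ret i).const_mul _), integral_const_mul,
    integral_const, probReal_univ, trajAfter, integral_bind_of_bddMeas (E.measurable_trajFrom hp i n) (E.bddMeas_ret i)]
  simp [qValue, value]

theorem bddMeas_weightedSum (E : UPOMDP N S O A) (w : WeightKind) (hp : IsPolicy p) (i : Fin N)
    (hψ : BddMeas ψ) : BddMeas (E.weightedSum w p i ψ : Traj n S A → ℝ) :=
  BddMeas.sum fun t _ => (E.bddMeas_weight w hp i t).mul (hψ.comp (measurable_pi_apply t))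

/-- Policy gradient theorem: both weights give an unbiased estimator of `E[R ∑ ψ]`. -/
theorem integral_weightedSum (E : UPOMDP N S O A) (w : WeightKind) (hp : IsPolicy p) (i : Fin N)
    (hψ : BddMeas ψ) (h0 : E.IsCentred p i ψ) (n : ℕ) (s : S) :
    ∫ τ, E.weightedSum w p i ψ τ ∂(E.trajFrom p i n s) =
      ∫ τ, E.ret i τ * pathSum ψ τ ∂(E.trajFrom p i n s) := by
  induction n generalizing s with
  | zero => simp [trajFrom, weightedSum, pathSum]
  | succ n ih =>
    have hW := E.bddMeas_weightedSum (n := n) w hp i hψ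
    have hW' := E.bddMeas_weightedSum (n := n + 1) w hp i hψ
    have hR := E.bddMeas_ret (n := n) i
    have hR' := E.bddMeas_ret (n := n + 1) i
    have hS := bddMeas_pathSum (n := n) hψ
    rw [E.integral_trajFrom_succ hp i n s hW',
      E.integral_trajFrom_succ hp i n s (hR'.mul (bddMeas_pathSum hψ))]
    -- Both sides share the tail contribution `γ * I a`. The first reward meets the tail sum of `ψ`
    -- only through its mean, which is zero; what remains is to compare the weight at time zero with
    -- the return, in conditional mean given the first pair.
    set I : A → ℝ := fun a => ∫ τ, E.ret i τ * pathSum ψ τ ∂(E.trajAfter p i n s a) with hI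
    have right : ∀ a, ∫ τ, E.ret i (Fin.cons (s, a) τ : Traj (n + 1) S A) *
        pathSum ψ (Fin.cons (s, a) τ : Traj (n + 1) S A) ∂(E.trajAfter p i n s a) =
        E.qValue p i n s a * ψ (s, a) + E.γ * I a := fun a => by
      have := E.isProbabilityMeasure_trajAfter hp i n s a
      have e : ∀ τ : Traj n S A, E.ret i (Fin.cons (s, a) τ : Traj (n + 1) S A) *
          pathSum ψ (Fin.cons (s, a) τ : Traj (n + 1) S A) =
          ψ (s, a) * E.ret i (Fin.cons (s, a) τ : Traj (n + 1) S A) +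
          (E.reward i s a * pathSum ψ τ + E.γ * (E.ret i τ * pathSum ψ τ)) := fun τ => by
        rw [pathSum_cons, ret_cons]; ring
      simp only [e]
      rw [((hR'.comp (measurable_cons_right n (s, a))).const_mul _).integral_add
        ((hS.const_mul _).add ((hR.mul hS).const_mul _)),
        (hS.const_mul _).integral_add ((hR.mul hS).const_mul _), integral_const_mul,
        integral_const_mul, integral_const_mul, E.integral_ret_cons_trajAfter hp,
        E.integral_trajAfter_eq_const hp i hS (E.integral_pathSum hp i hψ h0 n)]
      ring
    have left : ∀ a, ∫ τ, E.weightedSum w p i ψ (Fin.cons (s, a) τ : Traj (n + 1) S A)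
        ∂(E.trajAfter p i n s a) =
        (∫ τ, E.weight w p i 0 (Fin.cons (s, a) τ : Traj (n + 1) S A)
          ∂(E.trajAfter p i n s a)) * ψ (s, a) + E.γ * I a := fun a => by
      have := E.isProbabilityMeasure_trajAfter hp i n s a
      simp only [weightedSum_cons]
      rw [(((E.bddMeas_weight w hp i 0).comp (measurable_cons_right n (s, a))).mul
        (BddMeas.const _)).integral_add (hW.const_mul _), integral_mul_const, integral_const_mul,
        E.integral_trajAfter_congr hp i hW (hR.mul hS) ih]
    simp only [left, right]
    cases w with
    | returnToGo =>
      refine Finset.sum_congr rfl fun a _ => ?_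
      rw [← E.integral_ret_cons_trajAfter hp]
      rfl
    | advantage =>
      have e : ∀ a, ∫ τ, E.weight .advantage p i 0 (Fin.cons (s, a) τ : Traj (n + 1) S A)
          ∂(E.trajAfter p i n s a) = E.qValue p i n s a - E.value p i (n + 1) s := fun a => by
        have := E.isProbabilityMeasure_trajAfter hp i n s a
        simp [weight]
      simp only [e]
      rw [← sub_eq_zero, ← Finset.sum_sub_distrib]
      -- The value is a baseline: it does not depend on the action, so centredness of `ψ` removes
      -- it.
      calc _ = -E.value p i (n + 1) s * ∑ a, p (E.obs i s) a * ψ (s, a) := by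
            rw [Finset.mul_sum]
            exact Finset.sum_congr rfl fun a _ => by ring
        _ = 0 := by rw [h0 s, mul_zero]

/-- Conditional expectations of the return inherit its almost sure bounds. -/
theorem ae_abs_values_le (E : UPOMDP N S O A) (hp : IsPolicy p)
    (hpos : ∀ o a, p o a ≠ 0) (i : Fin N) {C : ℝ} (n : ℕ) (s : S) (c : ℝ)
    (h : ∀ t : ℕ, ∀ᵐ τ ∂(E.trajFrom p i n s), |c * E.tailReturn i t τ| ≤ C) (t : Fin n) :
    ∀ᵐ τ ∂(E.trajFrom p i n s),
      |c * (E.γ ^ (t : ℕ) * E.qValue p i (n - 1 - t) (τ t).1 (τ t).2)| ≤ C ∧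
      |c * (E.γ ^ (t : ℕ) * E.value p i (n - t) (τ t).1)| ≤ C := by
  -- The factor `c` collects the powers of `γ` as the induction moves along the trajectory; at its
  -- first time both values are means of a bounded return.
  induction n generalizing s c with
  | zero => exact t.elim0
  | succ n ih =>
    have meas : ∀ (c : ℝ) (m : ℕ) (t : Fin m), MeasurableSet {τ : Traj m S A |
        |c * (E.γ ^ (t : ℕ) * E.qValue p i (m - 1 - t) (τ t).1 (τ t).2)| ≤ C ∧
        |c * (E.γ ^ (t : ℕ) * E.value p i (m - t) (τ t).1)| ≤ C} := fun c m t => by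
      have hq := (((E.bddMeas_qValue hp i (m - 1 - t)).comp
        (measurable_pi_apply (X := fun _ : Fin m => S × A) t)).const_mul
          (E.γ ^ (t : ℕ))).const_mul c
      have hv := (((E.bddMeas_value hp i (m - t)).comp
        (measurable_pi_apply (X := fun _ : Fin m => S × A) t).fst).const_mul
          (E.γ ^ (t : ℕ))).const_mul c
      exact (measurableSet_le hq.abs.1 measurable_const).inter
        (measurableSet_le hv.abs.1 measurable_const)
    have hT : ∀ (c : ℝ) (m t : ℕ), MeasurableSet {τ : Traj m S A | |c * E.tailReturn i t τ| ≤ C} :=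
      fun c m t => measurableSet_le ((E.bddMeas_tailReturn i t).const_mul c).abs.1 measurable_const
    rw [E.ae_trajFrom_succ hp i n s (meas _ _ _)]
    intro a ha
    have hP := E.isProbabilityMeasure_trajAfter hp i n s a
    have hP' := E.isProbabilityMeasure_trajFrom hp i (n + 1) s
    have hstep : ∀ t, ∀ᵐ τ ∂(E.trajAfter p i n s a),
        |c * E.tailReturn i t (Fin.cons (s, a) τ : Traj (n + 1) S A)| ≤ C := fun t =>
      (E.ae_trajFrom_succ hp i n s (hT _ _ _)).1 (h t) a (hpos _ _)
    refine Fin.cases ?_ (fun t => ?_) t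
    · refine Filter.Eventually.of_forall fun τ => ?_
      simp only [Fin.cons_zero, Fin.val_zero, pow_zero, one_mul, Nat.sub_zero, Nat.add_sub_cancel]
      constructor
      · rw [← E.integral_ret_cons_trajAfter hp, ← integral_const_mul]
        exact abs_integral_le_of_ae (hstep 0)
      · rw [value, ← integral_const_mul]
        exact abs_integral_le_of_ae (h 0)
    · have h1 : ∀ᵐ s' ∂(E.trans i (s, a)), ∀ t : ℕ, ∀ᵐ τ ∂(E.trajFrom p i n s'),
          |c * E.γ * E.tailReturn i t τ| ≤ C := by
        refine ae_all_iff.2 fun t => ?_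
        refine Measure.ae_ae_of_ae_bind (E.measurable_trajFrom hp i n).aemeasurable ?_
        filter_upwards [hstep (t + 1)] with τ hτ
        rwa [tailReturn_succ_cons, ← mul_assoc] at hτ
      have h2 : ∀ᵐ τ ∂(E.trajAfter p i n s a),
          |c * E.γ * (E.γ ^ (t : ℕ) * E.qValue p i (n - 1 - t) (τ t).1 (τ t).2)| ≤ C ∧
          |c * E.γ * (E.γ ^ (t : ℕ) * E.value p i (n - t) (τ t).1)| ≤ C := by
        refine ae_bind_of_ae_ae (E.measurable_trajFrom hp i n) (meas _ _ _) ?_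
        filter_upwards [h1] with s' hs' using ih s' (c * E.γ) hs' t
      filter_upwards [h2] with τ hτ
      have h3 : n + 1 - 1 - ((t : ℕ) + 1) = n - 1 - t := by omega
      have h4 : n + 1 - ((t : ℕ) + 1) = n - t := by omega
      simp only [Fin.cons_succ, Fin.val_succ, h3, h4]
      convert! hτ using 3 <;> ring_nf

/-- The advantage is a difference of two conditional means of the return, each bounded by `C`. This
doubling is the source of the factor 4 in `varConst`. -/
theorem ae_abs_weight_le (E : UPOMDP N S O A) (w : WeightKind) (hp : IsPolicy p)
    (hpos : ∀ o a, p o a ≠ 0) (i : Fin N) {C : ℝ}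
    (h : ∀ t : ℕ, ∀ᵐ τ ∂(E.trajLaw T p i), |E.tailReturn i t τ| ≤ C) (t : Fin T) :
    ∀ᵐ τ ∂(E.trajLaw T p i), |E.weight w p i t τ| ≤ 2 * C := by
  have h1 : ∀ᵐ s ∂(E.init i), ∀ t : ℕ, ∀ᵐ τ ∂(E.trajFrom p i T s), |E.tailReturn i t τ| ≤ C :=
    ae_all_iff.2 fun t =>
      Measure.ae_ae_of_ae_bind (E.measurable_trajFrom hp i T).aemeasurable (h t)
  refine ae_bind_of_ae_ae (E.measurable_trajFrom hp i T)
    (measurableSet_le (E.bddMeas_weight w hp i t).abs.1 measurable_const) ?_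
  filter_upwards [h1] with s hs
  cases w with
  | returnToGo =>
    filter_upwards [hs t] with τ hτ
    have : 0 ≤ C := (abs_nonneg _).trans hτ
    simp only [weight]
    linarith
  | advantage =>
    filter_upwards [E.ae_abs_values_le hp hpos i T s 1 (by simpa using hs) t] with τ hτ
    simp only [one_mul] at hτ
    simp only [weight, mul_sub]
    exact (abs_sub _ _).trans (by linarith [hτ.1, hτ.2])

end UPOMDP

/-! ### Gradients, Taylor remainders and the score function of the policy -/

section Gradients

variable {F : Type*} [NormedAddCommGroup F] [InnerProductSpace ℝ F] [CompleteSpace F]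

open InnerProductSpace Topology

lemma norm_gradient (f : F → ℝ) (x : F) : ‖gradient f x‖ = ‖fderiv ℝ f x‖ := by
  simp [gradient]

lemma inner_gradient (f : F → ℝ) (x u : F) : inner ℝ (gradient f x) u = fderiv ℝ f x u := by
  simp [gradient]

lemma norm_gradient_le_of_lipschitz {f : F → ℝ} {L : NNReal} (hf : LipschitzWith L f) (x : F) :
    ‖gradient f x‖ ≤ L := by
  rw [norm_gradient]
  exact norm_fderiv_le_of_lipschitz ℝ hf

/-- First order Taylor expansion of a function with Lipschitz gradient. -/
lemma abs_sub_sub_inner_gradient_le {f : F → ℝ} {K : NNReal} (hf : Differentiable ℝ f)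
    (hK : LipschitzWith K (gradient f)) (x y : F) :
    |f y - f x - inner ℝ (gradient f x) (y - x)| ≤ K * ‖y - x‖ ^ 2 := by
  -- On the ball about `x` of radius `‖y - x‖` the derivative stays within `K * ‖y - x‖` of its
  -- value at `x`; the mean value inequality gives the constant `K`, not the sharp `K / 2`.
  have h := Convex.norm_image_sub_le_of_norm_fderiv_le' (𝕜 := ℝ) (f := f)
    (s := Metric.closedBall x ‖y - x‖) (x := x) (y := y) (φ := fderiv ℝ f x) (C := K * ‖y - x‖)
    (fun z _ => hf z) (fun z hz => ?_) (convex_closedBall _ _) (by simp)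
    (by simp [dist_eq_norm])
  · rw [inner_gradient, ← Real.norm_eq_abs]
    exact h.trans_eq (by ring)
  · have e : fderiv ℝ f z - fderiv ℝ f x = toDual ℝ F (gradient f z - gradient f x) := by
      simp [gradient]
    rw [e, LinearIsometryEquiv.norm_map, ← dist_eq_norm]
    exact (hK.dist_le_mul _ _).trans
      (mul_le_mul_of_nonneg_left (Metric.mem_closedBall.1 hz) K.2)

/-- A quadratic remainder is little-o. Global Taylor bounds thus become differentiability, without
differentiating under an integral. -/
lemma hasGradientAt_of_abs_le {f : F → ℝ} {g x : F} {C : ℝ}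
    (h : ∀ y, |f y - f x - inner ℝ g (y - x)| ≤ C * ‖y - x‖ ^ 2) : HasGradientAt f g x := by
  rw [hasGradientAt_iff_isLittleO]
  have h1 : (fun y => f y - f x - inner ℝ g (y - x)) =O[𝓝 x] fun y => ‖y - x‖ ^ 2 :=
    Asymptotics.IsBigO.of_bound C (Filter.Eventually.of_forall fun y => by simpa using h y)
  refine h1.trans_isLittleO ?_
  have h2 : (fun v : F => ‖v‖ ^ 2) =o[𝓝 0] fun v => v :=
    Asymptotics.isLittleO_norm_pow_id one_lt_two
  have h3 : Filter.Tendsto (fun y => y - x) (𝓝 x) (𝓝 0) := by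
    have : ContinuousAt (fun y => y - x) x := by fun_prop
    simpa [ContinuousAt] using this
  exact h2.comp_tendsto h3

end Gradients

lemma measurable_euclidean {X ι : Type*} [MeasurableSpace X] [Fintype ι]
    {f : X → EuclideanSpace ℝ ι} (h : ∀ j, Measurable fun x => f x j) : Measurable f :=
  (WithLp.measurable_toLp 2 _).comp (measurable_pi_iff.2 h)

/-- Each partial derivative is the limit of difference quotients with steps `1 / n`, which are
measurable in the second variable. -/
lemma measurable_gradient_apply {X : Type*} [MeasurableSpace X] {d : ℕ} {f : Params d → X → ℝ}
    (hf : ∀ x, Measurable (f x)) (hd : ∀ o, Differentiable ℝ fun x => f x o) (x : Params d) :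
    Measurable fun o => gradient (fun x => f x o) x := by
  refine measurable_euclidean fun j => ?_
  have hc : ∀ o, gradient (fun x => f x o) x j =
      fderiv ℝ (fun x => f x o) x (EuclideanSpace.single j 1) := fun o => by
    rw [← inner_gradient, EuclideanSpace.inner_single_right]; simp
  simp only [hc]
  have hn : Filter.Tendsto (fun n : ℕ => ‖(n : ℝ)‖) Filter.atTop Filter.atTop := by
    simpa using tendsto_natCast_atTop_atTop
  refine measurable_of_tendsto_metrizable (f := fun (n : ℕ) o =>
    (n : ℝ) • (f (x + (n : ℝ)⁻¹ • EuclideanSpace.single j 1) o - f x o))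
    (fun n => ((hf _).sub (hf x)).const_mul _) ?_
  exact tendsto_pi_nhds.2 fun o => (hd o x).hasFDerivAt.lim _ hn

/-- Gradient of the logarithm of the policy. -/
def logGrad {d : ℕ} {O A : Type*} (π : Params d → O → A → ℝ) (x : Params d) (o : O) (a : A) :
    Params d :=
  gradient (fun x' => Real.log (π x' o a)) x

namespace IsRegularPolicy

variable {d : ℕ} {O A : Type*} [MeasurableSpace O] [Fintype A] {π : Params d → O → A → ℝ} {ζ : ℝ}
  {L K : NNReal}

lemma pos (hπ : IsRegularPolicy π ζ L K) (hζ : 0 < ζ) (x : Params d) (o : O) (a : A) :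
    0 < π x o a :=
  hζ.trans_le (hπ.greedy x o a)

lemma logGrad_eq (hπ : IsRegularPolicy π ζ L K) (hζ : 0 < ζ) (x : Params d) (o : O) (a : A) :
    logGrad π x o a = (π x o a)⁻¹ • gradient (fun x => π x o a) x := by
  rw [logGrad, gradient, fderiv.log (hπ.differentiable o a x) (hπ.pos hζ x o a).ne', map_smul]
  rfl

lemma norm_logGrad_le (hπ : IsRegularPolicy π ζ L K) (hζ : 0 < ζ) (x : Params d) (o : O) (a : A) :
    ‖logGrad π x o a‖ ≤ L / ζ := by
  have h := hπ.pos hζ x o a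
  rw [hπ.logGrad_eq hζ, norm_smul, norm_inv, Real.norm_of_nonneg h.le, div_eq_inv_mul]
  exact mul_le_mul (inv_anti₀ hζ (hπ.greedy x o a))
    (norm_gradient_le_of_lipschitz (hπ.lipschitz o a) x) (norm_nonneg _) (inv_nonneg.2 hζ.le)

/-- Each term is the derivative of an action probability, and these probabilities sum to a constant.
-/
lemma sum_inner_logGrad (hπ : IsRegularPolicy π ζ L K) (hζ : 0 < ζ) (x u : Params d) (o : O) :
    ∑ a, π x o a * inner ℝ (logGrad π x o a) u = 0 := by
  have h1 : ∀ a, π x o a * inner ℝ (logGrad π x o a) u = fderiv ℝ (fun x => π x o a) x u :=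
    fun a => by
      rw [hπ.logGrad_eq hζ, real_inner_smul_left, inner_gradient, ← mul_assoc,
        mul_inv_cancel₀ (hπ.pos hζ x o a).ne', one_mul]
  have h2 : fderiv ℝ (fun x => ∑ a, π x o a) x = ∑ a, fderiv ℝ (fun x => π x o a) x :=
    fderiv_fun_sum fun a _ => hπ.differentiable o a x
  have h3 : fderiv ℝ (fun x => ∑ a, π x o a) x = 0 := by
    simp [fun x => (hπ.policy x).sum_one o]
  simp only [h1]
  rw [← sum_apply, ← h2, h3]
  rfl

/-- Continuity in the parameter and measurability in the observation give joint measurability. -/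
lemma measurable_prod (hπ : IsRegularPolicy π ζ L K) (a : A) :
    Measurable fun z : Params d × O => π z.1 z.2 a :=
  measurable_uncurry_of_continuous_of_measurable (u := fun x o => π x o a)
    (fun o => (hπ.lipschitz o a).continuous) fun x => (hπ.policy x).meas a

lemma measurable_logGrad (hπ : IsRegularPolicy π ζ L K) (hζ : 0 < ζ) (a : A) :
    Measurable fun z : Params d × O => logGrad π z.1 z.2 a := by
  have h : Measurable fun z : Params d × O => gradient (fun x => π x z.2 a) z.1 :=
    measurable_uncurry_of_continuous_of_measurable (u := fun x o => gradient (fun x => π x o a) x)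
      (fun o => (hπ.smooth o a).continuous) fun x =>
        measurable_gradient_apply (fun x => (hπ.policy x).meas a)
          (fun o => hπ.differentiable o a) x
  simp only [hπ.logGrad_eq hζ]
  exact (hπ.measurable_prod a).inv.smul h

end IsRegularPolicy

/-! ### Smoothness of the expected return -/

namespace UPOMDP

variable {N T M d n : ℕ} {S O A : Type*} [MeasurableSpace S] [MeasurableSpace O]
  [MeasurableSpace A] [Fintype A]
  {π : Params d → O → A → ℝ} {ζ R : ℝ} {L K : NNReal}

/-- Directional derivative of the logarithm of the policy. -/
def dirLogGrad (E : UPOMDP N S O A) (π : Params d → O → A → ℝ) (i : Fin N) (x u : Params d)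
    (z : S × A) : ℝ :=
  inner ℝ (logGrad π x (E.obs i z.1) z.2) u

theorem abs_dirLogGrad_le (E : UPOMDP N S O A) (hπ : IsRegularPolicy π ζ L K) (hζ : 0 < ζ)
    (i : Fin N) (x u : Params d) (z : S × A) : |E.dirLogGrad π i x u z| ≤ L / ζ * ‖u‖ :=
  (abs_real_inner_le_norm _ _).trans
    (mul_le_mul_of_nonneg_right (hπ.norm_logGrad_le hζ _ _ _) (norm_nonneg _))

theorem isCentred_dirLogGrad (E : UPOMDP N S O A) (hπ : IsRegularPolicy π ζ L K) (hζ : 0 < ζ)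
    (i : Fin N) (x u : Params d) : E.IsCentred (π x) i (E.dirLogGrad π i x u) := fun s =>
  hπ.sum_inner_logGrad hζ x u (E.obs i s)

theorem integral_trajLaw_congr (E : UPOMDP N S O A) {p : O → A → ℝ} (hp : IsPolicy p) (i : Fin N)
    {f g : Traj T S A → ℝ} (hf : BddMeas f) (hg : BddMeas g)
    (h : ∀ s, ∫ τ, f τ ∂(E.trajFrom p i T s) = ∫ τ, g τ ∂(E.trajFrom p i T s)) :
    ∫ τ, f τ ∂(E.trajLaw T p i) = ∫ τ, g τ ∂(E.trajLaw T p i) :=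
  have := E.isProbabilityMeasure_trajFrom hp i T
  integral_bind_congr (E.measurable_trajFrom hp i T) hf hg h

theorem return_bound_nonneg (E : UPOMDP N S O A) (hN : 0 < N) (hπ : IsRegularPolicy π ζ L K)
    (hR : E.IsReturnBound T π R) : 0 ≤ R := by
  have := E.isProbabilityMeasure_trajLaw (T := T) (hπ.policy 0) ⟨0, hN⟩
  obtain ⟨τ, hτ⟩ := (hR 0 ⟨0, hN⟩ 0).exists
  exact (abs_nonneg _).trans hτ

variable [DiscreteMeasurableSpace A]

theorem measurable_logGrad_obs (E : UPOMDP N S O A) (hπ : IsRegularPolicy π ζ L K) (hζ : 0 < ζ)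
    (i : Fin N) :
    Measurable fun w : Params d × (S × A) => logGrad π w.1 (E.obs i w.2.1) w.2.2 := by
  have : Measurable fun w : (Params d × S) × A => logGrad π w.1.1 (E.obs i w.1.2) w.2 :=
    measurable_from_prod_countable_left fun a => (hπ.measurable_logGrad hζ a).comp
      (measurable_fst.prodMk ((E.obs_meas i).comp measurable_snd))
  exact this.comp ((measurable_fst.prodMk measurable_snd.fst).prodMk measurable_snd.snd)

theorem bddMeas_dirLogGrad (E : UPOMDP N S O A) (hπ : IsRegularPolicy π ζ L K) (hζ : 0 < ζ)
    (i : Fin N) (x u : Params d) : BddMeas (E.dirLogGrad π i x u) :=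
  ⟨((E.measurable_logGrad_obs hπ hζ i).comp
    (measurable_const.prodMk measurable_id)).inner measurable_const,
    _, E.abs_dirLogGrad_le hπ hζ i x u⟩

/-- First order expansion of the expected return. -/
theorem abs_expReturn_sub_le (E : UPOMDP N S O A) (hπ : IsRegularPolicy π ζ L K) (hζ : 0 < ζ)
    (hR : E.IsReturnBound T π R) (i : Fin N) (x y : Params d) :
    |E.expReturn T (π y) i - E.expReturn T (π x) i -
      ∫ τ, E.ret i τ * pathSum (E.dirLogGrad π i x (y - x)) τ ∂(E.trajLaw T (π x) i)| ≤
    R * (T * (3 * (L ^ 2 / ζ ^ 2) + K / ζ)) * ‖y - x‖ ^ 2 := by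
  have hp := hπ.policy x
  have hP := E.isProbabilityMeasure_trajLaw (T := T) hp i
  have hR0 : 0 ≤ R := E.return_bound_nonneg i.pos hπ hR
  set h := y - x with hh
  set ψ := E.dirLogGrad π i x h with hψdef
  have hψ : BddMeas ψ := E.bddMeas_dirLogGrad hπ hζ i x h
  -- The relative change of the action probabilities: `1 + φ` is the one-step likelihood ratio, and
  -- `ψ` linearises `φ` in `h`.
  let φ : S × A → ℝ := fun z => π y (E.obs i z.1) z.2 / π x (E.obs i z.1) z.2 - 1
  have hφabs : ∀ z, |φ z| ≤ L / ζ * ‖h‖ := fun z => by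
    have hpos := hπ.pos hζ x (E.obs i z.1) z.2
    have e : φ z = (π y (E.obs i z.1) z.2 - π x (E.obs i z.1) z.2) / π x (E.obs i z.1) z.2 := by
      simp only [φ]; field_simp
    have h1 := (hπ.lipschitz (E.obs i z.1) z.2).dist_le_mul y x
    rw [Real.dist_eq, dist_eq_norm] at h1
    rw [e, abs_div, abs_of_pos hpos, div_mul_eq_mul_div]
    exact div_le_div₀ (by positivity) h1 hζ (hπ.greedy _ _ _)
  have hφ : BddMeas φ := bddMeas_prod (fun a =>
    ((((hπ.policy y).meas a).comp (E.obs_meas i)).div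
      (((hπ.policy x).meas a).comp (E.obs_meas i))).sub_const 1) hφabs
  have hmul : ∀ s a, π y (E.obs i s) a = π x (E.obs i s) a * (1 + φ (s, a)) := fun s a => by
    have hpos := hπ.pos hζ x (E.obs i s) a
    simp only [φ]; field_simp; ring
  have hφ0 : E.IsCentred (π x) i φ := fun s => by
    have e : ∀ a, π x (E.obs i s) a * φ (s, a) = π y (E.obs i s) a - π x (E.obs i s) a :=
      fun a => by rw [hmul]; ring
    simp only [e, Finset.sum_sub_distrib, (hπ.policy _).sum_one, sub_self]
  have hφ1 : ∀ z, 0 ≤ 1 + φ z := fun z => by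
    simp only [φ, add_sub_cancel]
    exact div_nonneg (hπ.pos hζ _ _ _).le (hπ.pos hζ _ _ _).le
  set v : ℝ := (L / ζ * ‖h‖) ^ 2 with hv
  have hφ2 : ∀ s, ∑ a, π x (E.obs i s) a * φ (s, a) ^ 2 ≤ v := fun s => by
    calc ∑ a, π x (E.obs i s) a * φ (s, a) ^ 2 ≤ ∑ a, π x (E.obs i s) a * v :=
          Finset.sum_le_sum fun a _ => mul_le_mul_of_nonneg_left
            (sq_le_sq' (by linarith [(abs_le.1 (hφabs (s, a))).1]) (abs_le.1 (hφabs (s, a))).2)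
            (hp.nonneg _ _)
      _ = v := by rw [← Finset.sum_mul, hp.sum_one, one_mul]
  have hφψ : ∀ z, |φ z - ψ z| ≤ K / ζ * ‖h‖ ^ 2 := fun z => by
    have hpos := hπ.pos hζ x (E.obs i z.1) z.2
    have e : φ z - ψ z = (π y (E.obs i z.1) z.2 - π x (E.obs i z.1) z.2 -
        inner ℝ (gradient (fun x => π x (E.obs i z.1) z.2) x) h) / π x (E.obs i z.1) z.2 := by
      simp only [φ, hψdef, dirLogGrad]
      rw [hπ.logGrad_eq hζ, real_inner_smul_left]
      field_simp
    have h1 := abs_sub_sub_inner_gradient_le (hπ.differentiable (E.obs i z.1) z.2)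
      (hπ.smooth (E.obs i z.1) z.2) x y
    rw [e, abs_div, abs_of_pos hpos, div_mul_eq_mul_div]
    exact div_le_div₀ (by positivity) h1 hζ (hπ.greedy _ _ _)
  have hret := E.bddMeas_ret (n := T) i
  have hPr := bddMeas_pathProd (n := T) hφ
  have hSφ := bddMeas_pathSum (n := T) hφ
  have hSψ := bddMeas_pathSum (n := T) hψ
  have hchange : E.expReturn T (π y) i =
      ∫ τ, E.ret i τ * pathProd φ τ ∂(E.trajLaw T (π x) i) := by
    have := E.isProbabilityMeasure_trajFrom (hπ.policy x) i T
    have := E.isProbabilityMeasure_trajFrom (hπ.policy y) i T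
    rw [expReturn, trajLaw, trajLaw, integral_bind_of_bddMeas (E.measurable_trajFrom (hπ.policy y)
      i T) hret, integral_bind_of_bddMeas (E.measurable_trajFrom hp i T) (hret.mul hPr)]
    exact integral_congr_ae (Filter.Eventually.of_forall fun s =>
      E.integral_mul_pathProd hp (hπ.policy y) i hφ hmul T s hret)
  have hZ := (hPr.sub (BddMeas.const 1)).sub hSφ
  -- Two errors occur: linearising the product, and replacing `φ` by `ψ` in the sum. After the
  -- change of measure everything lives under the law at `x`, where the return is almost surely
  -- bounded.
  have hbound : ∀ᵐ τ ∂(E.trajLaw T (π x) i), |E.ret i τ * pathProd φ τ - E.ret i τ -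
      E.ret i τ * pathSum ψ τ| ≤
      R * |pathProd φ τ - 1 - pathSum φ τ| + R * (T * (K / ζ * ‖h‖ ^ 2)) := by
    filter_upwards [hR x i 0] with τ hτ
    have e : E.ret i τ * pathProd φ τ - E.ret i τ - E.ret i τ * pathSum ψ τ =
        E.ret i τ * (pathProd φ τ - 1 - pathSum φ τ) +
        E.ret i τ * (pathSum φ τ - pathSum ψ τ) := by ring
    have h2 : |pathSum φ τ - pathSum ψ τ| ≤ T * (K / ζ * ‖h‖ ^ 2) := by
      rw [pathSum, pathSum, ← Finset.sum_sub_distrib]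
      exact (Finset.abs_sum_le_sum_abs _ _).trans
        ((Finset.sum_le_sum fun t _ => hφψ (τ t)).trans_eq (by simp))
    rw [e]
    refine (abs_add_le _ _).trans (add_le_add ?_ ?_)
    · rw [abs_mul]
      exact mul_le_mul_of_nonneg_right hτ (abs_nonneg _)
    · rw [abs_mul]
      exact mul_le_mul hτ h2 (abs_nonneg _) hR0
  have hlin : ∫ τ, |pathProd φ τ - 1 - pathSum φ τ| ∂(E.trajLaw T (π x) i) ≤ 3 * (T * v) := by
    have := E.isProbabilityMeasure_trajFrom hp i T
    exact integral_bind_le (E.measurable_trajFrom hp i T) hZ.abs fun s =>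
      E.integral_abs_pathProd_sub_le hp i hφ hφ0 hφ1 (sq_nonneg _) hφ2 T s
  rw [hchange, expReturn, ← (hret.mul hPr).integral_sub hret,
    ← ((hret.mul hPr).sub hret).integral_sub (hret.mul hSψ)]
  calc _ ≤ ∫ τ, |E.ret i τ * pathProd φ τ - E.ret i τ - E.ret i τ * pathSum ψ τ|
        ∂(E.trajLaw T (π x) i) := abs_integral_le_integral_abs
    _ ≤ ∫ τ, (R * |pathProd φ τ - 1 - pathSum φ τ| + R * (T * (K / ζ * ‖h‖ ^ 2)))
        ∂(E.trajLaw T (π x) i) :=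
        integral_mono_ae ((((hret.mul hPr).sub hret).sub (hret.mul hSψ)).abs.integrable _)
          (((hZ.abs.const_mul R).add (BddMeas.const _)).integrable _) hbound
    _ = R * ∫ τ, |pathProd φ τ - 1 - pathSum φ τ| ∂(E.trajLaw T (π x) i)
        + R * (T * (K / ζ * ‖h‖ ^ 2)) := by
        rw [(hZ.abs.const_mul R).integral_add (BddMeas.const _), integral_const_mul]; simp
    _ ≤ R * (3 * (T * v)) + R * (T * (K / ζ * ‖h‖ ^ 2)) := by gcongr
    _ = _ := by rw [hv]; ring

/-- The vector `R ∑ ∇ log π` of a trajectory. -/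
def reinforce (E : UPOMDP N S O A) (π : Params d → O → A → ℝ) (i : Fin N) (x : Params d)
    (τ : Traj T S A) : Params d :=
  E.ret i τ • ∑ t, logGrad π x (E.obs i (τ t).1) (τ t).2

/-- The mean of the `reinforce` vector represents the linear term of the Taylor bound; its
integrability is what lets the inner product pass through the mean. -/
theorem hasGradientAt_expReturn (E : UPOMDP N S O A) (hπ : IsRegularPolicy π ζ L K) (hζ : 0 < ζ)
    (hR : E.IsReturnBound T π R) (i : Fin N) (x : Params d) :
    HasGradientAt (fun x => E.expReturn T (π x) i)
      (∫ τ, E.reinforce π i x τ ∂(E.trajLaw T (π x) i)) x ∧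
    ∀ u, inner ℝ (∫ τ, E.reinforce π i x τ ∂(E.trajLaw T (π x) i)) u =
      ∫ τ, E.ret i τ * pathSum (E.dirLogGrad π i x u) τ ∂(E.trajLaw T (π x) i) := by
  have hP := E.isProbabilityMeasure_trajLaw (T := T) (hπ.policy x) i
  have hmeas : Measurable fun τ : Traj T S A =>
      ∑ t, logGrad π x (E.obs i (τ t).1) (τ t).2 :=
    Finset.measurable_sum _ fun t _ => (E.measurable_logGrad_obs hπ hζ i).comp
      (measurable_const.prodMk (measurable_pi_apply t))
  obtain ⟨hr, C, hC⟩ := E.bddMeas_ret (n := T) i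
  have hint : Integrable (fun τ => E.reinforce π i x τ) (E.trajLaw T (π x) i) := by
    refine Integrable.of_bound (hr.smul hmeas).aestronglyMeasurable (C * (T * (L / ζ)))
      (Filter.Eventually.of_forall fun τ => ?_)
    rw [reinforce, norm_smul]
    refine mul_le_mul (hC τ) ?_ (norm_nonneg _) ((abs_nonneg _).trans (hC τ))
    exact (norm_sum_le _ _).trans ((Finset.sum_le_sum fun t _ =>
      hπ.norm_logGrad_le hζ x _ _).trans_eq (by simp))
  have hinner : ∀ u, inner ℝ (∫ τ, E.reinforce π i x τ ∂(E.trajLaw T (π x) i)) u =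
      ∫ τ, E.ret i τ * pathSum (E.dirLogGrad π i x u) τ ∂(E.trajLaw T (π x) i) := fun u => by
    rw [real_inner_comm, ← integral_inner hint]
    refine integral_congr_ae (Filter.Eventually.of_forall fun τ => ?_)
    simp only [reinforce, pathSum, dirLogGrad]
    rw [real_inner_smul_right, inner_sum]
    simp only [real_inner_comm]
  refine ⟨hasGradientAt_of_abs_le (C := R * (T * (3 * (L ^ 2 / ζ ^ 2) + K / ζ))) fun y => ?_, hinner⟩
  rw [hinner]
  exact E.abs_expReturn_sub_le hπ hζ hR i x y

theorem differentiable_expReturn (E : UPOMDP N S O A) (hπ : IsRegularPolicy π ζ L K) (hζ : 0 < ζ)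
    (hR : E.IsReturnBound T π R) (i : Fin N) : Differentiable ℝ fun x => E.expReturn T (π x) i :=
  fun x => (E.hasGradientAt_expReturn hπ hζ hR i x).1.differentiableAt

theorem inner_gradient_expReturn (E : UPOMDP N S O A) (hπ : IsRegularPolicy π ζ L K) (hζ : 0 < ζ)
    (hR : E.IsReturnBound T π R) (i : Fin N) (x u : Params d) :
    inner ℝ (gradient (fun x => E.expReturn T (π x) i) x) u =
      ∫ τ, E.ret i τ * pathSum (E.dirLogGrad π i x u) τ ∂(E.trajLaw T (π x) i) := by
  have h := E.hasGradientAt_expReturn hπ hζ hR i x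
  rw [h.1.gradient, h.2]

theorem inner_gradient_expReturn_eq_weightedSum (E : UPOMDP N S O A) (w : WeightKind)
    (hπ : IsRegularPolicy π ζ L K) (hζ : 0 < ζ) (hR : E.IsReturnBound T π R) (i : Fin N)
    (x u : Params d) :
    inner ℝ (gradient (fun x => E.expReturn T (π x) i) x) u =
      ∫ τ, E.weightedSum w (π x) i (E.dirLogGrad π i x u) τ ∂(E.trajLaw T (π x) i) := by
  have hψ := E.bddMeas_dirLogGrad hπ hζ i x u
  rw [E.inner_gradient_expReturn hπ hζ hR]
  exact (E.integral_trajLaw_congr (hπ.policy x) i (E.bddMeas_weightedSum w (hπ.policy x) i hψ)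
    ((E.bddMeas_ret i).mul (bddMeas_pathSum hψ)) fun s =>
      E.integral_weightedSum w (hπ.policy x) i hψ (E.isCentred_dirLogGrad hπ hζ i x u) T s).symm

theorem norm_gradient_expReturn_le (E : UPOMDP N S O A) (hπ : IsRegularPolicy π ζ L K) (hζ : 0 < ζ)
    (hR : E.IsReturnBound T π R) (i : Fin N) (x : Params d) :
    ‖gradient (fun x => E.expReturn T (π x) i) x‖ ≤ R * (T * (L / ζ)) := by
  have hP := E.isProbabilityMeasure_trajLaw (T := T) (hπ.policy x) i
  have hR0 : 0 ≤ R := E.return_bound_nonneg i.pos hπ hR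
  set g := gradient (fun x => E.expReturn T (π x) i) x with hg
  -- Test the directional derivative in the direction of the gradient itself, then divide by its
  -- norm.
  have h : ‖g‖ * ‖g‖ ≤ R * (T * (L / ζ)) * ‖g‖ := by
    rw [← real_inner_self_eq_norm_mul_norm]
    nth_rw 1 [hg]
    rw [E.inner_gradient_expReturn hπ hζ hR]
    refine (le_abs_self _).trans (abs_integral_le_of_ae ?_)
    filter_upwards [hR x i 0] with τ hτ
    rw [abs_mul, mul_assoc]
    refine mul_le_mul hτ ?_ (abs_nonneg _) hR0
    exact (Finset.abs_sum_le_sum_abs _ _).trans ((Finset.sum_le_sum fun t _ =>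
      E.abs_dirLogGrad_le hπ hζ i x g (τ t)).trans_eq (by simp; ring))
  rcases (norm_nonneg g).eq_or_lt with h0 | h0
  · rw [← h0]; positivity
  · exact le_of_mul_le_mul_right h h0

/-- First order Taylor expansion of the expected return. -/
theorem abs_expReturn_sub_sub_inner_le (E : UPOMDP N S O A) (hπ : IsRegularPolicy π ζ L K)
    (hζ : 0 < ζ) (hR : E.IsReturnBound T π R) (i : Fin N) (x y : Params d) :
    |E.expReturn T (π y) i - E.expReturn T (π x) i -
      inner ℝ (gradient (fun x => E.expReturn T (π x) i) x) (y - x)| ≤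
    R * (T * (3 * (L ^ 2 / ζ ^ 2) + K / ζ)) * ‖y - x‖ ^ 2 := by
  rw [E.inner_gradient_expReturn hπ hζ hR]
  exact E.abs_expReturn_sub_le hπ hζ hR i x y

end UPOMDP

/-! ### The truncated simplex, projections and entropy -/

section Simplex

variable {N : ℕ} {ξ α η : ℝ} {y z : LevelVec N}

/-- The `ℓ¹` norm. -/
def l1 (v : LevelVec N) : ℝ := ∑ i, |v i|

lemma l1_nonneg (v : LevelVec N) : 0 ≤ l1 v := Finset.sum_nonneg fun _ _ => abs_nonneg _

lemma norm_le_l1 (v : LevelVec N) : ‖v‖ ≤ l1 v := by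
  refine (sq_le_sq₀ (norm_nonneg _) (l1_nonneg v)).1 ?_
  rw [EuclideanSpace.real_norm_sq_eq]
  simpa [l1] using Finset.sum_sq_le_sq_sum_of_nonneg (s := Finset.univ) (f := fun i => |v i|)
    fun i _ => abs_nonneg _

/-- Pairing ℓ¹ with a uniform bound over the levels keeps factors of `N` out of the estimates. -/
lemma abs_sum_mul_le_l1 (v : LevelVec N) {c : Fin N → ℝ} {D : ℝ} (hc : ∀ i, |c i| ≤ D) :
    |∑ i, v i * c i| ≤ l1 v * D := by
  rw [l1, Finset.sum_mul]
  refine (Finset.abs_sum_le_sum_abs _ _).trans (Finset.sum_le_sum fun i _ => ?_)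
  rw [abs_mul]
  exact mul_le_mul_of_nonneg_left (hc i) (abs_nonneg _)

lemma norm_sum_smul_le_l1 {F : Type*} [NormedAddCommGroup F] [NormedSpace ℝ F] (v : LevelVec N)
    {g : Fin N → F} {D : ℝ} (hg : ∀ i, ‖g i‖ ≤ D) : ‖∑ i, v i • g i‖ ≤ l1 v * D := by
  rw [l1, Finset.sum_mul]
  refine (norm_sum_le _ _).trans (Finset.sum_le_sum fun i _ => ?_)
  rw [norm_smul]
  exact mul_le_mul_of_nonneg_left (hg i) (abs_nonneg _)

lemma convex_truncSimplex : Convex ℝ (truncSimplex N ξ) := by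
  intro y hy z hz a b ha hb hab
  refine ⟨fun i => ?_, ?_⟩
  · have h1 := mul_le_mul_of_nonneg_left (hy.1 i) ha
    have h2 := mul_le_mul_of_nonneg_left (hz.1 i) hb
    simp only [PiLp.add_apply, PiLp.smul_apply, smul_eq_mul]
    calc ξ = a * ξ + b * ξ := by rw [← add_mul, hab, one_mul]
      _ ≤ _ := add_le_add h1 h2
  · simp only [PiLp.add_apply, PiLp.smul_apply, smul_eq_mul, Finset.sum_add_distrib,
      ← Finset.mul_sum, hy.2, hz.2, mul_one, hab]

lemma le_one_of_mem (hξ : 0 < ξ) (hy : y ∈ truncSimplex N ξ) (i : Fin N) : y i ≤ 1 := by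
  rw [← hy.2]
  exact Finset.single_le_sum (f := fun i => y i) (fun j _ => hξ.le.trans (hy.1 j))
    (Finset.mem_univ i)

lemma pos_of_mem (hξ : 0 < ξ) (hy : y ∈ truncSimplex N ξ) (i : Fin N) : 0 < y i :=
  hξ.trans_le (hy.1 i)

lemma l1_of_mem (hξ : 0 < ξ) (hy : y ∈ truncSimplex N ξ) : l1 y = 1 := by
  rw [l1, ← hy.2]
  exact Finset.sum_congr rfl fun i _ => abs_of_pos (pos_of_mem hξ hy i)

lemma norm_sub_le_two (hξ : 0 < ξ) (hy : y ∈ truncSimplex N ξ) (hz : z ∈ truncSimplex N ξ) :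
    ‖y - z‖ ≤ 2 := by
  have h := norm_sub_le y z
  linarith [norm_le_l1 y, norm_le_l1 z, l1_of_mem hξ hy, l1_of_mem hξ hz]

lemma isCompact_truncSimplex (hξ : 0 < ξ) : IsCompact (truncSimplex N ξ) := by
  refine Metric.isCompact_of_isClosed_isBounded ?_ ?_
  · have : truncSimplex N ξ = (⋂ i, {y | ξ ≤ y i}) ∩ {y | ∑ i, y i = 1} := by
      ext y; simp [truncSimplex]
    rw [this]
    refine (isClosed_iInter fun i => isClosed_le continuous_const (by fun_prop)).inter
      (isClosed_eq (by fun_prop) continuous_const)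
  · refine (Metric.isBounded_closedBall (x := (0 : LevelVec N)) (r := 1)).subset fun y hy => ?_
    rw [mem_closedBall_zero_iff, ← l1_of_mem hξ hy]
    exact norm_le_l1 y

lemma const_mem_truncSimplex (hN : 0 < N) (hξN : ξ * N ≤ 1) (hy : ∀ i, y i = 1 / N) :
    y ∈ truncSimplex N ξ := by
  have hN' : (0 : ℝ) < N := Nat.cast_pos.2 hN
  refine ⟨fun i => ?_, ?_⟩
  · rw [hy, le_div_iff₀ hN']; exact hξN
  · simp [hy, hN'.ne']

lemma truncSimplex_nonempty (hN : 0 < N) (hξN : ξ * N ≤ 1) : (truncSimplex N ξ).Nonempty :=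
  ⟨WithLp.toLp 2 fun _ => 1 / N, const_mem_truncSimplex hN hξN fun _ => rfl⟩

lemma IsProj.inner_le_zero {v y' : LevelVec N} (h : IsProj (truncSimplex N ξ) v y')
    (hz : z ∈ truncSimplex N ξ) : inner ℝ (v - y') (z - y') ≤ 0 := by
  refine (norm_eq_iInf_iff_real_inner_le_zero convex_truncSimplex h.1).1 ?_ z hz
  have : Nonempty (truncSimplex N ξ) := ⟨⟨y', h.1⟩⟩
  refine le_antisymm (le_ciInf fun w => h.2 w w.2) ?_
  exact ciInf_le (f := fun w : truncSimplex N ξ => ‖v - w‖)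
    ⟨0, by rintro _ ⟨w, rfl⟩; exact norm_nonneg _⟩ ⟨y', h.1⟩

/-- Comparison of a projected point with a point satisfying a variational inequality. -/
lemma IsProj.norm_sub_le {v y' g : LevelVec N} (h : IsProj (truncSimplex N ξ) v y')
    (hz : z ∈ truncSimplex N ξ) (hg : ∀ w ∈ truncSimplex N ξ, inner ℝ g (w - z) ≤ 0) :
    ‖y' - z‖ ≤ ‖v - (z + g)‖ := by
  have h1 := h.inner_le_zero hz
  have h2 := hg y' h.1
  have h3 : ‖y' - z‖ * ‖y' - z‖ ≤ ‖v - (z + g)‖ * ‖y' - z‖ := by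
    refine le_trans ?_ (real_inner_le_norm (v - (z + g)) (y' - z))
    rw [← real_inner_self_eq_norm_mul_norm]
    -- The hypothesis on `g` says that `z` is the projection of `z + g`. Adding the two obtuse angle
    -- conditions gives nonexpansiveness of the projection.
    have e : inner ℝ (v - (z + g)) (y' - z) =
        inner ℝ (y' - z) (y' - z) - inner ℝ (v - y') (z - y') - inner ℝ g (y' - z) := by
      simp only [inner_sub_left, inner_sub_right, inner_add_left]
      rw [real_inner_comm z y']
      ring
    rw [e]; linarith
  rcases (norm_nonneg (y' - z)).eq_or_lt with h0 | h0
  · rw [← h0]; exact norm_nonneg _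
  · exact le_of_mul_le_mul_right h3 h0

lemma hasFDerivAt_entropy (hy : ∀ i, 0 < y i) :
    HasFDerivAt (entropy : LevelVec N → ℝ)
      (∑ i, (-Real.log (y i) - 1) • (EuclideanSpace.proj i : LevelVec N →L[ℝ] ℝ)) y :=
  HasFDerivAt.fun_sum fun i _ => by
    have h : HasFDerivAt (fun w : LevelVec N => w i) (EuclideanSpace.proj i : LevelVec N →L[ℝ] ℝ)
        y := (EuclideanSpace.proj i : LevelVec N →L[ℝ] ℝ).hasFDerivAt
    exact (Real.hasDerivAt_negMulLog (hy i).ne').comp_hasFDerivAt y h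

lemma gradient_entropy (hy : ∀ i, 0 < y i) (i : Fin N) :
    gradient (entropy : LevelVec N → ℝ) y i = -Real.log (y i) - 1 := by
  have h : gradient (entropy : LevelVec N → ℝ) y i =
      fderiv ℝ (entropy : LevelVec N → ℝ) y (EuclideanSpace.single i 1) := by
    rw [← inner_gradient, EuclideanSpace.inner_single_right]; simp
  rw [h, (hasFDerivAt_entropy hy).fderiv]
  simp [sum_apply]

/-- For `b ≤ a` use `log (a / b) ≥ 1 - b / a`. The denominator `a + b` is symmetric, and over the
simplex such denominators sum to 2. -/
lemma log_sub_mul_sub_ge {a b : ℝ} (ha : 0 < a) (hb : 0 < b) :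
    (a - b) ^ 2 / (a + b) ≤ (Real.log a - Real.log b) * (a - b) := by
  wlog h : b ≤ a generalizing a b
  · have := this hb ha (le_of_not_ge h)
    rw [add_comm a b, show (a - b) ^ 2 = (b - a) ^ 2 by ring]
    linarith
  have h1 := Real.one_sub_inv_le_log_of_pos (div_pos ha hb)
  rw [Real.log_div ha.ne' hb.ne', inv_div] at h1
  have h2 : (a - b) ^ 2 / (a + b) ≤ (1 - b / a) * (a - b) := by
    have e : (1 - b / a) * (a - b) = (a - b) ^ 2 / a := by field_simp
    rw [e]
    exact div_le_div_of_nonneg_left (sq_nonneg _) ha (by linarith)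
  exact h2.trans (mul_le_mul_of_nonneg_right h1 (by linarith))

/-- Cocoercivity of the logarithm on `[ξ, ∞)`, from `log (a / b) ≤ a / b - 1` and `ξ ≤ b`. This is
how the truncation level limits the adversary's step size. -/
lemma sq_log_sub_le {a b : ℝ} (hξ : 0 < ξ) (ha : ξ ≤ a) (hb : ξ ≤ b) :
    ξ * (Real.log a - Real.log b) ^ 2 ≤ (Real.log a - Real.log b) * (a - b) := by
  wlog h : b ≤ a generalizing a b
  · have := this hb ha (le_of_not_ge h)
    linarith [show (Real.log a - Real.log b) ^ 2 = (Real.log b - Real.log a) ^ 2 by ring]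
  have ha' := hξ.trans_le ha
  have hb' := hξ.trans_le hb
  have h1 := Real.log_le_sub_one_of_pos (div_pos ha' hb')
  rw [Real.log_div ha'.ne' hb'.ne'] at h1
  have h0 : 0 ≤ Real.log a - Real.log b := sub_nonneg.2 (Real.log_le_log hb' h)
  have h2 : ξ * (Real.log a - Real.log b) ≤ a - b := by
    calc ξ * (Real.log a - Real.log b) ≤ b * (a / b - 1) := by gcongr
      _ = a - b := by field_simp
  nlinarith

/-- Strong monotonicity of the gradient of the negative entropy, with respect to the `ℓ¹` norm. -/
lemma sq_l1_le (hξ : 0 < ξ) (hy : y ∈ truncSimplex N ξ) (hz : z ∈ truncSimplex N ξ) :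
    l1 (y - z) ^ 2 ≤ 2 * ∑ i, (Real.log (y i) - Real.log (z i)) * (y i - z i) := by
  -- Cauchy–Schwarz with the weights `y i + z i`, whose total is 2.
  have h := Finset.sq_sum_div_le_sum_sq_div Finset.univ (fun i => |(y - z) i|)
    (g := fun i => y i + z i) fun i _ => add_pos (pos_of_mem hξ hy i) (pos_of_mem hξ hz i)
  have h2 : ∑ i, |(y - z) i| ^ 2 / (y i + z i) ≤
      ∑ i, (Real.log (y i) - Real.log (z i)) * (y i - z i) :=
    Finset.sum_le_sum fun i _ => by
      rw [sq_abs]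
      exact log_sub_mul_sub_ge (pos_of_mem hξ hy i) (pos_of_mem hξ hz i)
  rw [Finset.sum_add_distrib, hy.2, hz.2] at h
  rw [l1]
  linarith

/-- Contraction property of gradient ascent on the entropy. -/
lemma norm_sub_add_entropy_sq_le (hξ : 0 < ξ) (hη : 0 ≤ η) (hα : 0 ≤ α) (h : η * α ≤ ξ)
    (hy : y ∈ truncSimplex N ξ) (hz : z ∈ truncSimplex N ξ) :
    ‖y - z + (η * α) • (gradient (entropy : LevelVec N → ℝ) y - gradient entropy z)‖ ^ 2 ≤
      ‖y - z‖ ^ 2 - η * α / 2 * l1 (y - z) ^ 2 := by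
  have hηα : 0 ≤ η * α := mul_nonneg hη hα
  have h1 := sq_l1_le hξ hy hz
  have h2 : ‖y - z + (η * α) • (gradient (entropy : LevelVec N → ℝ) y - gradient entropy z)‖ ^ 2 ≤
      ‖y - z‖ ^ 2 - η * α * ∑ i, (Real.log (y i) - Real.log (z i)) * (y i - z i) := by
    rw [EuclideanSpace.real_norm_sq_eq, EuclideanSpace.real_norm_sq_eq, Finset.mul_sum,
      ← Finset.sum_sub_distrib]
    refine Finset.sum_le_sum fun i _ => ?_
    simp only [PiLp.add_apply, PiLp.sub_apply, PiLp.smul_apply, smul_eq_mul,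
      gradient_entropy (pos_of_mem hξ hy), gradient_entropy (pos_of_mem hξ hz)]
    -- By cocoercivity and `η * α ≤ ξ`, half of the linear term `-2 * (η * α) * l * (y i - z i)`
    -- absorbs the quadratic one.
    have h3 := sq_log_sub_le hξ (hy.1 i) (hz.1 i)
    set l := Real.log (y i) - Real.log (z i)
    have h4 : η * α * l ^ 2 ≤ l * (y i - z i) :=
      (mul_le_mul_of_nonneg_right h (sq_nonneg l)).trans h3
    have e : -Real.log (y i) - 1 - (-Real.log (z i) - 1) = -l := by simp only [l]; ring
    rw [e]
    nlinarith [mul_le_mul_of_nonneg_left h4 hηα]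
  nlinarith [mul_le_mul_of_nonneg_left h1 hηα]

end Simplex

/-! ### The adversary's best response -/

section BestResponse

variable {N : ℕ} {ξ α : ℝ} {c c' y z : LevelVec N}

/-- The entropy-regularised payoff of the adversary for given scores. -/
def payoff (α : ℝ) (c y : LevelVec N) : ℝ := ∑ i, y i * c i + α * entropy y

lemma continuous_payoff (c : LevelVec N) : Continuous (payoff α c) := by
  have : Continuous (entropy : LevelVec N → ℝ) :=
    continuous_finsetSum _ fun i _ => Real.continuous_negMulLog.comp (by fun_prop)
  unfold payoff
  fun_prop

lemma exists_bestResponse (hN : 0 < N) (hξ : 0 < ξ) (hξN : ξ * N ≤ 1) (c : LevelVec N) :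
    ∃ y ∈ truncSimplex N ξ, IsMaxOn (payoff α c) (truncSimplex N ξ) y :=
  (isCompact_truncSimplex hξ).exists_isMaxOn (truncSimplex_nonempty hN hξN)
    (continuous_payoff c).continuousOn

open Classical in
/-- The best response of the adversary to given scores. -/
def bestResponse (α ξ : ℝ) (c : LevelVec N) : LevelVec N :=
  if h : ∃ y ∈ truncSimplex N ξ, IsMaxOn (payoff α c) (truncSimplex N ξ) y then h.choose else 0

/-- The largest payoff of the adversary for given scores. -/
def maxPayoff (α ξ : ℝ) (c : LevelVec N) : ℝ := sSup (payoff α c '' truncSimplex N ξ)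

lemma bestResponse_spec (hN : 0 < N) (hξ : 0 < ξ) (hξN : ξ * N ≤ 1) (c : LevelVec N) :
    bestResponse α ξ c ∈ truncSimplex N ξ ∧
      IsMaxOn (payoff α c) (truncSimplex N ξ) (bestResponse α ξ c) := by
  have h := exists_bestResponse (α := α) hN hξ hξN c
  rw [bestResponse, dif_pos h]
  exact h.choose_spec

lemma maxPayoff_eq (hN : 0 < N) (hξ : 0 < ξ) (hξN : ξ * N ≤ 1) (c : LevelVec N) :
    maxPayoff α ξ c = payoff α c (bestResponse α ξ c) := by
  obtain ⟨h1, h2⟩ := bestResponse_spec (α := α) hN hξ hξN c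
  refine IsGreatest.csSup_eq ⟨⟨_, h1, rfl⟩, ?_⟩
  rintro _ ⟨y, hy, rfl⟩
  exact h2 hy

lemma payoff_le_maxPayoff (hN : 0 < N) (hξ : 0 < ξ) (hξN : ξ * N ≤ 1) (c : LevelVec N)
    (hy : y ∈ truncSimplex N ξ) : payoff α c y ≤ maxPayoff α ξ c := by
  rw [maxPayoff_eq hN hξ hξN]
  exact (bestResponse_spec hN hξ hξN c).2 hy

/-- First order optimality of the best response. -/
lemma inner_bestResponse_le_zero (hN : 0 < N) (hξ : 0 < ξ) (hξN : ξ * N ≤ 1) (c : LevelVec N)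
    (hz : z ∈ truncSimplex N ξ) :
    inner ℝ (c + α • gradient entropy (bestResponse α ξ c)) (z - bestResponse α ξ c) ≤ 0 := by
  obtain ⟨h1, h2⟩ := bestResponse_spec (α := α) hN hξ hξN c
  set y := bestResponse α ξ c
  have hd : HasFDerivAt (payoff α c) (innerSL ℝ (c + α • gradient entropy y)) y := by
    have e1 : HasFDerivAt (fun y : LevelVec N => inner ℝ c y) (innerSL ℝ c) y :=
      (innerSL ℝ c).hasFDerivAt
    have e2 : HasFDerivAt (entropy : LevelVec N → ℝ) (innerSL ℝ (gradient entropy y)) y :=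
      (hasFDerivAt_entropy (pos_of_mem hξ h1)).differentiableAt.hasGradientAt.hasFDerivAt
    have e3 := e1.add (e2.const_mul α)
    rw [map_add, map_smul]
    refine e3.congr_of_eventuallyEq (Filter.Eventually.of_forall fun w => ?_)
    simp [payoff, PiLp.inner_apply]
  exact h2.localize.hasFDerivWithinAt_nonpos hd.hasFDerivWithinAt
    (sub_mem_posTangentConeAt_of_segment_subset (convex_truncSimplex.segment_subset h1 hz))

/-- The best response is a Lipschitz function of the scores, from `ℓ^∞` to `ℓ¹`. -/
lemma l1_bestResponse_sub_le (hN : 0 < N) (hξ : 0 < ξ) (hξN : ξ * N ≤ 1) (hα : 0 < α)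
    {D : ℝ} (hD : ∀ i, |c i - c' i| ≤ D) :
    l1 (bestResponse α ξ c - bestResponse α ξ c') ≤ 2 * D / α := by
  have hy := (bestResponse_spec (α := α) hN hξ hξN c).1
  have hz := (bestResponse_spec (α := α) hN hξ hξN c').1
  have h1 := inner_bestResponse_le_zero (α := α) hN hξ hξN c hz
  have h2 := inner_bestResponse_le_zero (α := α) hN hξ hξN c' hy
  have h3 := sq_l1_le hξ hy hz
  set y := bestResponse α ξ c
  set z := bestResponse α ξ c'
  -- The sum of the two first order optimality conditions, each tested against the other best
  -- response.
  have h4 : α * ∑ i, (Real.log (y i) - Real.log (z i)) * (y i - z i) ≤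
      ∑ i, (y - z) i * (c i - c' i) := by
    have e : ∑ i, (y - z) i * (c i - c' i) -
        α * ∑ i, (Real.log (y i) - Real.log (z i)) * (y i - z i) =
        -(inner ℝ (c + α • gradient entropy y) (z - y) +
          inner ℝ (c' + α • gradient entropy z) (y - z)) := by
      simp only [PiLp.inner_apply, Finset.mul_sum, ← Finset.sum_sub_distrib,
        ← Finset.sum_add_distrib, ← Finset.sum_neg_distrib]
      refine Finset.sum_congr rfl fun i _ => ?_
      simp [gradient_entropy (pos_of_mem hξ hy), gradient_entropy (pos_of_mem hξ hz)]
      ring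
    linarith
  have h5 := (le_abs_self _).trans (abs_sum_mul_le_l1 (y - z) hD)
  have h6 : α * l1 (y - z) ^ 2 ≤ 2 * (l1 (y - z) * D) := by
    nlinarith [mul_le_mul_of_nonneg_left h3 hα.le]
  have hD0 : 0 ≤ D := (abs_nonneg _).trans (hD ⟨0, hN⟩)
  rcases (l1_nonneg (y - z)).eq_or_lt with h0 | h0
  · rw [← h0]; positivity
  · rw [le_div_iff₀ hα]
    have : l1 (y - z) * (l1 (y - z) * α) ≤ l1 (y - z) * (2 * D) := by nlinarith
    exact le_of_mul_le_mul_left this h0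

end BestResponse

/-! ### Differentiability of the largest payoff -/

/-- Scores with gradients bounded by `G` and quadratic Taylor remainders bounded by `H`. -/
structure SmoothScores {N d : ℕ} (s : Params d → LevelVec N) (G H : ℝ) : Prop where
  differentiable : ∀ i, Differentiable ℝ fun x => s x i
  norm_gradient_le : ∀ i x, ‖gradient (fun x => s x i) x‖ ≤ G
  taylor : ∀ i x y, |s y i - s x i - inner ℝ (gradient (fun x => s x i) x) (y - x)| ≤
    H * ‖y - x‖ ^ 2

namespace SmoothScores

variable {N d : ℕ} {s : Params d → LevelVec N} {G H ξ α : ℝ}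

/-- Gradient of `∑ yᵢ sᵢ` with respect to the parameter. -/
def mixGrad (s : Params d → LevelVec N) (x : Params d) (y : LevelVec N) : Params d :=
  ∑ i, y i • gradient (fun x => s x i) x

lemma inner_mixGrad (x u : Params d) (y : LevelVec N) :
    inner ℝ (mixGrad s x y) u = ∑ i, y i * inner ℝ (gradient (fun x => s x i) x) u := by
  simp [mixGrad, sum_inner, real_inner_smul_left]

lemma norm_mixGrad_sub_le (hs : SmoothScores s G H) (x : Params d) (y z : LevelVec N) :
    ‖mixGrad s x y - mixGrad s x z‖ ≤ l1 (y - z) * G := by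
  have e : mixGrad s x y - mixGrad s x z = ∑ i, (y - z) i • gradient (fun x => s x i) x := by
    simp [mixGrad, sub_smul, Finset.sum_sub_distrib]
  rw [e]
  exact norm_sum_smul_le_l1 _ fun i => hs.norm_gradient_le i x

lemma norm_mixGrad_le (hs : SmoothScores s G H) (hξ : 0 < ξ) (x : Params d) {y : LevelVec N}
    (hy : y ∈ truncSimplex N ξ) : ‖mixGrad s x y‖ ≤ G :=
  (norm_sum_smul_le_l1 y fun i => hs.norm_gradient_le i x).trans_eq (by rw [l1_of_mem hξ hy, one_mul])

lemma abs_sub_le (hs : SmoothScores s G H) (x y : Params d) (i : Fin N) :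
    |s y i - s x i| ≤ G * ‖y - x‖ := by
  refine Convex.norm_image_sub_le_of_norm_fderiv_le (𝕜 := ℝ) (s := Set.univ)
    (f := fun x => s x i) (fun z _ => hs.differentiable i z) (fun z _ => ?_) convex_univ
    trivial trivial
  rw [← norm_gradient]
  exact hs.norm_gradient_le i z

lemma l1_bestResponse_sub_le (hs : SmoothScores s G H) (hN : 0 < N) (hξ : 0 < ξ) (hξN : ξ * N ≤ 1)
    (hα : 0 < α) (x y : Params d) :
    l1 (bestResponse α ξ (s y) - bestResponse α ξ (s x)) ≤ 2 * G / α * ‖y - x‖ :=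
  (UED.l1_bestResponse_sub_le hN hξ hξN hα (hs.abs_sub_le x y)).trans_eq (by ring)

/-- The largest payoff is differentiable, with a quadratic Taylor remainder. -/
lemma abs_maxPayoff_sub_le (hs : SmoothScores s G H) (hN : 0 < N) (hξ : 0 < ξ) (hξN : ξ * N ≤ 1)
    (hα : 0 < α) (x y : Params d) :
    |maxPayoff α ξ (s y) - maxPayoff α ξ (s x) -
      inner ℝ (mixGrad s x (bestResponse α ξ (s x))) (y - x)| ≤
      (2 * G ^ 2 / α + H) * ‖y - x‖ ^ 2 := by
  have hG : 0 ≤ G := (norm_nonneg _).trans (hs.norm_gradient_le ⟨0, hN⟩ 0)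
  have hp := (bestResponse_spec (α := α) hN hξ hξN (s x)).1
  have hq := (bestResponse_spec (α := α) hN hξ hξN (s y)).1
  have h1 := payoff_le_maxPayoff (α := α) hN hξ hξN (s y) hp
  have h2 := payoff_le_maxPayoff (α := α) hN hξ hξN (s x) hq
  have e1 := maxPayoff_eq (α := α) hN hξ hξN (s x)
  have e2 := maxPayoff_eq (α := α) hN hξ hξN (s y)
  have hl := hs.l1_bestResponse_sub_le hN hξ hξN hα x y
  set p := bestResponse α ξ (s x)
  set q := bestResponse α ξ (s y)
  -- At a fixed mixture the entropy cancels, and the remainder is a convex combination of those of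
  -- the scores. Testing maximality at `y` with `p` gives the lower bound, at `x` with `q` the upper
  -- one.
  have rem : ∀ w ∈ truncSimplex N ξ,
      |payoff α (s y) w - payoff α (s x) w - inner ℝ (mixGrad s x w) (y - x)| ≤
      H * ‖y - x‖ ^ 2 := fun w hw => by
    have e : payoff α (s y) w - payoff α (s x) w - inner ℝ (mixGrad s x w) (y - x) =
        ∑ i, w i * (s y i - s x i - inner ℝ (gradient (fun x => s x i) x) (y - x)) := by
      simp only [inner_mixGrad, payoff, mul_sub, Finset.sum_sub_distrib]; ring
    rw [e]
    exact (abs_sum_mul_le_l1 w fun i => hs.taylor i x y).trans_eq (by rw [l1_of_mem hξ hw, one_mul])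
  have r1 := (abs_le.1 (rem p hp)).1
  have r2 := (abs_le.1 (rem q hq)).2
  -- Trading the gradient at `q` for that at `p` costs `G` times the ℓ¹ movement of the best
  -- response.
  have hc : inner ℝ (mixGrad s x q) (y - x) - inner ℝ (mixGrad s x p) (y - x) ≤
      2 * G ^ 2 / α * ‖y - x‖ ^ 2 := by
    rw [← inner_sub_left]
    calc _ ≤ ‖mixGrad s x q - mixGrad s x p‖ * ‖y - x‖ := real_inner_le_norm _ _
      _ ≤ (2 * G / α * ‖y - x‖ * G) * ‖y - x‖ := by
          refine mul_le_mul_of_nonneg_right ?_ (norm_nonneg _)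
          exact (hs.norm_mixGrad_sub_le x q p).trans (mul_le_mul_of_nonneg_right hl hG)
      _ = _ := by ring
  have hpos : 0 ≤ 2 * G ^ 2 / α * ‖y - x‖ ^ 2 := by positivity
  rw [add_mul, abs_le]
  constructor <;> linarith

lemma hasGradientAt_maxPayoff (hs : SmoothScores s G H) (hN : 0 < N) (hξ : 0 < ξ)
    (hξN : ξ * N ≤ 1) (hα : 0 < α) (x : Params d) :
    HasGradientAt (fun x => maxPayoff α ξ (s x)) (mixGrad s x (bestResponse α ξ (s x))) x :=
  hasGradientAt_of_abs_le (hs.abs_maxPayoff_sub_le hN hξ hξN hα x)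

end SmoothScores

/-! ### The potential and its one-step decrease -/

namespace SmoothScores

variable {N d : ℕ} {s : Params d → LevelVec N} {G H ξ α ηx ηy : ℝ}

/-- The gradient of the largest payoff. -/
def maxGrad (α ξ : ℝ) (s : Params d → LevelVec N) (x : Params d) : Params d :=
  mixGrad s x (bestResponse α ξ (s x))

/-- Deviation of a gradient ascent step from the best response. -/
def ascentGap (α ξ ηy : ℝ) (s : Params d → LevelVec N) (x : Params d) (y : LevelVec N) :
    LevelVec N :=
  y - bestResponse α ξ (s x) +
    (ηy * α) • (gradient entropy y - gradient entropy (bestResponse α ξ (s x)))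

/-- The largest payoff plus `w` times the squared distance to the best response. -/
def potential (α ξ w : ℝ) (s : Params d → LevelVec N) (x : Params d) (y : LevelVec N) : ℝ :=
  maxPayoff α ξ (s x) + w * ‖y - bestResponse α ξ (s x)‖ ^ 2

/-- One step of stochastic projected gradient ascent contracts towards the best response. -/
lemma norm_proj_sub_bestResponse_sq_le (hN : 0 < N) (hξ : 0 < ξ) (hξN : ξ * N ≤ 1)
    (hα : 0 < α) (hηy : 0 < ηy) (hηξ : ηy * α ≤ ξ) (x : Params d) {y y' ey : LevelVec N}
    (hy : y ∈ truncSimplex N ξ)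
    (hy' : IsProj (truncSimplex N ξ) (y + ηy • (s x + α • gradient entropy y + ey)) y') :
    ‖y' - bestResponse α ξ (s x)‖ ^ 2 ≤ ‖y - bestResponse α ξ (s x)‖ ^ 2
      - ηy * α / 2 * l1 (y - bestResponse α ξ (s x)) ^ 2
      + 2 * ηy * inner ℝ (ascentGap α ξ ηy s x y) ey + ηy ^ 2 * ‖ey‖ ^ 2 := by
  have hz := (bestResponse_spec (α := α) hN hξ hξN (s x)).1
  set z := bestResponse α ξ (s x) with hzdef
  -- The best response is a fixed point of the exact ascent step. In the comparison the score
  -- vectors cancel, leaving entropy gradients and noise.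
  have h1 := hy'.norm_sub_le hz (g := ηy • (s x + α • gradient entropy z)) fun w hw => by
    rw [real_inner_smul_left]
    exact mul_nonpos_of_nonneg_of_nonpos hηy.le (inner_bestResponse_le_zero hN hξ hξN (s x) hw)
  have e : y + ηy • (s x + α • gradient entropy y + ey) - (z + ηy • (s x + α • gradient entropy z))
      = ascentGap α ξ ηy s x y + ηy • ey := by
    rw [ascentGap, ← hzdef]; module
  rw [e] at h1
  have h2 := norm_sub_add_entropy_sq_le hξ hηy.le hα.le hηξ hy hz
  have h3 : ‖ascentGap α ξ ηy s x y + ηy • ey‖ ^ 2 = ‖ascentGap α ξ ηy s x y‖ ^ 2 +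
      2 * ηy * inner ℝ (ascentGap α ξ ηy s x y) ey + ηy ^ 2 * ‖ey‖ ^ 2 := by
    rw [norm_add_sq_real, real_inner_smul_right, norm_smul, mul_pow, Real.norm_eq_abs, sq_abs]
    ring
  have h4 := pow_le_pow_left₀ (norm_nonneg _) h1 2
  rw [h3] at h4
  have h5 : ‖ascentGap α ξ ηy s x y‖ ^ 2 ≤ ‖y - z‖ ^ 2 - ηy * α / 2 * l1 (y - z) ^ 2 := h2
  linarith

/-- Growth of the squared distance when the reference point moves. -/
lemma norm_sub_sq_le {F : Type*} [NormedAddCommGroup F] (u v w : F) {β : ℝ} (hβ : 0 < β) :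
    ‖u - w‖ ^ 2 ≤ (1 + β) * ‖u - v‖ ^ 2 + (1 + 1 / β) * ‖v - w‖ ^ 2 := by
  have h := pow_le_pow_left₀ (norm_nonneg _) (norm_sub_le_norm_sub_add_norm_sub u v w) 2
  have h2 : 2 * ‖u - v‖ * ‖v - w‖ ≤ β * ‖u - v‖ ^ 2 + 1 / β * ‖v - w‖ ^ 2 := by
    have e : β * ‖u - v‖ ^ 2 + 1 / β * ‖v - w‖ ^ 2 - 2 * ‖u - v‖ * ‖v - w‖ =
        (β * ‖u - v‖ - ‖v - w‖) ^ 2 / β := by field_simp; ring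
    have : 0 ≤ (β * ‖u - v‖ - ‖v - w‖) ^ 2 / β := by positivity
    linarith
  nlinarith

/-- Decrease of the potential in one step of stochastic gradient descent-ascent, up to terms
that are linear in the noise and terms that are quadratic in the noise. -/
theorem potential_step (hs : SmoothScores s G H) (hN : 0 < N) (hξ : 0 < ξ) (hξN : ξ * N ≤ 1)
    (hα : 0 < α) (hηx : 0 < ηx) (hηy : 0 < ηy) (hηξ : ηy * α ≤ ξ) {β w κ : ℝ}
    (hβ : β = ηy * α / 4) (hw : w = 2 * G ^ 2 / (ηy * α))
    (hκ : κ = (2 * G ^ 2 / α + H) * ηx ^ 2 + ηx * w * (1 + 1 / β) * (2 * G / α) ^ 2 * ηx ^ 2)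
    (hκ2 : κ ≤ ηx / 2) {x ex : Params d} {y y' ey : LevelVec N}
    (hy : y ∈ truncSimplex N ξ)
    (hy' : IsProj (truncSimplex N ξ) (y + ηy • (s x + α • gradient entropy y + ey)) y') :
    potential α ξ (ηx * w) s (x - ηx • (mixGrad s x y + ex)) y' ≤
      potential α ξ (ηx * w) s x y - ηx / 2 * ‖maxGrad α ξ s x‖ ^ 2
      + inner ℝ ((2 * κ) • mixGrad s x y - ηx • maxGrad α ξ s x) ex
      + inner ℝ ((ηx * w * (1 + β) * (2 * ηy)) • ascentGap α ξ ηy s x y) ey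
      + κ * ‖ex‖ ^ 2 + ηx * w * (1 + β) * ηy ^ 2 * ‖ey‖ ^ 2 := by
  have hG : 0 ≤ G := (norm_nonneg _).trans (hs.norm_gradient_le ⟨0, hN⟩ 0)
  have hβ0 : 0 < β := by rw [hβ]; positivity
  have hw0 : 0 ≤ w := by rw [hw]; positivity
  set x' := x - ηx • (mixGrad s x y + ex) with hx'
  set f := mixGrad s x y with hf
  set g := maxGrad α ξ s x with hg
  set z := bestResponse α ξ (s x) with hz
  set z' := bestResponse α ξ (s x') with hz'
  set P := l1 (y - z) with hP
  have hxx : x' - x = -(ηx • (f + ex)) := by rw [hx']; abel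
  have hnxx : ‖x' - x‖ ^ 2 = ηx ^ 2 * ‖f + ex‖ ^ 2 := by
    rw [hxx, norm_neg, norm_smul, mul_pow, Real.norm_eq_abs, sq_abs]
  have hfe : ‖f + ex‖ ^ 2 = ‖f‖ ^ 2 + 2 * inner ℝ f ex + ‖ex‖ ^ 2 := norm_add_sq_real _ _
  have a1 := (abs_le.1 (hs.abs_maxPayoff_sub_le hN hξ hξN hα x x')).2
  have a2 : inner ℝ (mixGrad s x (bestResponse α ξ (s x))) (x' - x) =
      -(ηx * (inner ℝ g f + inner ℝ g ex)) := by
    change inner ℝ g (x' - x) = _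
    rw [hxx, inner_neg_right, real_inner_smul_right, inner_add_right]
  rw [a2, hnxx] at a1
  -- Expanding this square turns `-⟪g, f⟫` into `(‖g - f‖² - ‖g‖² - ‖f‖²) / 2`: the descent along
  -- `g`, with a bias controlled by the ℓ¹ distance `P`.
  have a3 : ‖g - f‖ ^ 2 ≤ G ^ 2 * P ^ 2 := by
    have h := hs.norm_mixGrad_sub_le x y z
    rw [norm_sub_rev] at h
    calc ‖g - f‖ ^ 2 ≤ (P * G) ^ 2 := pow_le_pow_left₀ (norm_nonneg _) h 2
      _ = _ := by ring
  rw [norm_sub_sq_real] at a3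
  have b1 := norm_proj_sub_bestResponse_sq_le hN hξ hξN hα hηy hηξ x hy hy'
  have b2 := norm_sub_sq_le y' z z' hβ0
  have b3 : ‖z - z'‖ ^ 2 ≤ (2 * G / α) ^ 2 * (ηx ^ 2 * ‖f + ex‖ ^ 2) := by
    rw [← hnxx, ← mul_pow]
    refine pow_le_pow_left₀ (norm_nonneg _) ?_ 2
    rw [norm_sub_rev]
    exact (norm_le_l1 _).trans (hs.l1_bestResponse_sub_le hN hξ hξN hα x x')
  have b4 : ‖y - z‖ ^ 2 ≤ P ^ 2 := pow_le_pow_left₀ (norm_nonneg _) (norm_le_l1 _) 2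
  set I := inner ℝ (ascentGap α ξ ηy s x y) ey with hI
  -- The ascent step gains `2 * β * P ^ 2`; half of it is spent on the factor `1 + β`, since `‖y -
  -- z‖ ≤ P`.
  have b5 : (1 + β) * ‖y' - z‖ ^ 2 ≤ ‖y - z‖ ^ 2 - β * P ^ 2 +
      (1 + β) * (2 * ηy * I + ηy ^ 2 * ‖ey‖ ^ 2) := by
    have h := mul_le_mul_of_nonneg_left b1 (show 0 ≤ 1 + β by linarith)
    have h1 := mul_le_mul_of_nonneg_left b4 hβ0.le
    have h2 : 0 ≤ β * (β * P ^ 2) := by positivity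
    have h3 : ηy * α / 2 = 2 * β := by rw [hβ]; ring
    rw [h3] at h
    nlinarith
  have b6 : ‖y' - z'‖ ^ 2 ≤ ‖y - z‖ ^ 2 - β * P ^ 2 +
      (1 + β) * (2 * ηy * I + ηy ^ 2 * ‖ey‖ ^ 2) +
      (1 + 1 / β) * ((2 * G / α) ^ 2 * (ηx ^ 2 * ‖f + ex‖ ^ 2)) := by
    have h := mul_le_mul_of_nonneg_left b3 (show 0 ≤ 1 + 1 / β by positivity)
    linarith
  have b7 := mul_le_mul_of_nonneg_left b6 (mul_nonneg hηx.le hw0)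
  -- This dictates the choice of `w`: the remaining gain pays exactly for the bias `ηx / 2 * (G ^ 2
  -- * P ^ 2)`.
  have hwβ : w * β = G ^ 2 / 2 := by
    rw [hw, hβ]; field_simp; ring
  have b8 : ηx * w * (β * P ^ 2) = ηx / 2 * (G ^ 2 * P ^ 2) := by
    calc ηx * w * (β * P ^ 2) = ηx * (w * β) * P ^ 2 := by ring
      _ = _ := by rw [hwβ]; ring
  have c1 : (2 * G ^ 2 / α + H) * (ηx ^ 2 * ‖f + ex‖ ^ 2) +
      ηx * w * ((1 + 1 / β) * ((2 * G / α) ^ 2 * (ηx ^ 2 * ‖f + ex‖ ^ 2))) =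
      κ * (‖f‖ ^ 2 + 2 * inner ℝ f ex + ‖ex‖ ^ 2) := by
    rw [← hfe, hκ]; ring
  -- The curvature of the largest payoff and the drift of the best response cost `κ * ‖f‖ ^ 2`,
  -- which the term `-ηx / 2 * ‖f‖ ^ 2` of the descent covers.
  have c2 : κ * ‖f‖ ^ 2 ≤ ηx / 2 * ‖f‖ ^ 2 := mul_le_mul_of_nonneg_right hκ2 (sq_nonneg _)
  have c3 := mul_le_mul_of_nonneg_left a3 (show 0 ≤ ηx / 2 by positivity)
  simp only [potential]
  rw [inner_sub_left, real_inner_smul_left, real_inner_smul_left, real_inner_smul_left, ← hI]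
  rw [mul_add, mul_add, mul_sub, b8] at b7
  change maxPayoff α ξ (s x') + ηx * w * ‖y' - z'‖ ^ 2 ≤ _
  linarith

end SmoothScores

/-! ### Bounded vector functions and empirical means -/

section Vectors

variable {X Y ι : Type*} [MeasurableSpace X] [MeasurableSpace Y]

/-- Bounded measurable functions with values in a Euclidean space. -/
def BddVec (f : X → EuclideanSpace ℝ ι) : Prop := ∀ c, BddMeas fun x => f x c

namespace BddVec

variable {f g : X → EuclideanSpace ℝ ι}

lemma add (hf : BddVec f) (hg : BddVec g) : BddVec fun x => f x + g x := fun c => by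
  simpa using (hf c).add (hg c)

lemma sub (hf : BddVec f) (hg : BddVec g) : BddVec fun x => f x - g x := fun c => by
  simpa using (hf c).sub (hg c)

lemma smul {a : X → ℝ} (ha : BddMeas a) (hf : BddVec f) : BddVec fun x => a x • f x := fun c => by
  simpa using ha.mul (hf c)

lemma sum {κ : Type*} {s : Finset κ} {f : κ → X → EuclideanSpace ℝ ι}
    (hf : ∀ i ∈ s, BddVec (f i)) : BddVec fun x => ∑ i ∈ s, f i x := fun c => by
  simpa using BddMeas.sum fun i hi => hf i hi c

lemma comp {h : Y → X} (hf : BddVec f) (hh : Measurable h) : BddVec fun y => f (h y) :=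
  fun c => (hf c).comp hh

variable [Fintype ι]

lemma inner (hf : BddVec f) (hg : BddVec g) : BddMeas fun x => inner ℝ (f x) (g x) := by
  simp only [PiLp.inner_apply]
  exact BddMeas.sum fun c _ => by simpa using (hg c).mul (hf c)

lemma norm_sq (hf : BddVec f) : BddMeas fun x => ‖f x‖ ^ 2 := by
  simp only [EuclideanSpace.real_norm_sq_eq]
  exact BddMeas.sum fun c _ => (hf c).sq

lemma measurable (hf : BddVec f) : Measurable f := measurable_euclidean fun c => (hf c).1

lemma of_norm_le (hf : ∀ c, Measurable fun x => f x c) {C : ℝ} (hC : ∀ x, ‖f x‖ ≤ C) : BddVec f :=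
  fun c => ⟨hf c, C, fun x => (PiLp.norm_apply_le (f x) c).trans (hC x)⟩

end BddVec

end Vectors

section EmpiricalMean

variable {X ι : Type*} [MeasurableSpace X] {M : ℕ} {ν : Measure X}
  [IsProbabilityMeasure ν]

/-- The empirical mean of `V` over a sample. -/
def empMean (V : X → EuclideanSpace ℝ ι) (b : Fin M → X) : EuclideanSpace ℝ ι :=
  ((1 : ℝ) / M) • ∑ j, V (b j)

lemma bddVec_empMean {V : X → EuclideanSpace ℝ ι} (hV : BddVec V) :
    BddVec (empMean V : (Fin M → X) → EuclideanSpace ℝ ι) :=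
  (BddVec.sum fun j _ => hV.comp (measurable_pi_apply j)).smul (BddMeas.const _)

lemma integral_eval_pi {κ : Type*} [Fintype κ] {X : κ → Type*} [∀ k, MeasurableSpace (X k)]
    (ν : ∀ k, Measure (X k)) [∀ k, IsProbabilityMeasure (ν k)] (k : κ) {f : X k → ℝ}
    (hf : BddMeas f) : ∫ b, f (b k) ∂(Measure.pi ν) = ∫ x, f x ∂(ν k) := by
  rw [← (measurePreserving_eval ν k).map_eq, integral_map (measurable_pi_apply k).aemeasurable
    hf.1.aestronglyMeasurable]

lemma integral_empMean (hM : 0 < M) {V : X → EuclideanSpace ℝ ι} (hV : BddVec V) (c : ι) :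
    ∫ b, empMean V b c ∂(Measure.pi fun _ : Fin M => ν) = ∫ x, V x c ∂ν := by
  have hM' : (M : ℝ) ≠ 0 := by positivity
  have e : ∀ b : Fin M → X, empMean V b c = 1 / M * ∑ j, V (b j) c := fun b => by simp [empMean]
  simp only [e]
  rw [integral_const_mul, integral_finsetSum _ fun j _ =>
    ((hV c).comp (measurable_pi_apply j)).integrable _]
  simp only [integral_eval_pi (fun _ : Fin M => ν) _ (hV c)]
  simp [hM']

variable [Fintype ι]

lemma integral_inner_empMean_sub (hM : 0 < M) {V : X → EuclideanSpace ℝ ι} (hV : BddVec V)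
    (u m : EuclideanSpace ℝ ι) (hm : ∀ c, ∫ x, V x c ∂ν = m c) :
    ∫ b, inner ℝ u (empMean V b - m) ∂(Measure.pi fun _ : Fin M => ν) = 0 := by
  have hE := bddVec_empMean (M := M) hV
  simp only [PiLp.inner_apply, PiLp.sub_apply, RCLike.inner_apply, conj_trivial]
  rw [integral_finsetSum _ fun c _ => (((hE c).sub (BddMeas.const _)).mul
    (BddMeas.const _)).integrable _]
  refine Finset.sum_eq_zero fun c _ => ?_
  rw [integral_mul_const, (hE c).integral_sub (BddMeas.const _), integral_empMean hM hV, hm]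
  simp

/-- The variance of an empirical mean. -/
lemma integral_norm_empMean_sub_sq_le (hM : 0 < M) {V : X → EuclideanSpace ℝ ι} (hV : BddVec V)
    (m : EuclideanSpace ℝ ι) (hm : ∀ c, ∫ x, V x c ∂ν = m c) {B : ℝ}
    (hB : ∀ᵐ x ∂ν, ‖V x‖ ^ 2 ≤ B) :
    ∫ b, ‖empMean V b - m‖ ^ 2 ∂(Measure.pi fun _ : Fin M => ν) ≤ B / M := by
  have hM' : (0 : ℝ) < M := Nat.cast_pos.2 hM
  have hE := bddVec_empMean (M := M) hV
  simp only [EuclideanSpace.real_norm_sq_eq, PiLp.sub_apply]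
  rw [integral_finsetSum _ fun c _ => (((hE c).sub (BddMeas.const _)).sq).integrable _]
  -- In each coordinate the variances of independent terms add up, which gives the factor `1 / M`; a
  -- variance is at most the second moment.
  have key : ∀ c, ∫ b, (empMean V b c - m c) ^ 2 ∂(Measure.pi fun _ : Fin M => ν) ≤
      1 / M * ∫ x, V x c ^ 2 ∂ν := fun c => by
    have hmem : MemLp (fun x => V x c) 2 ν := by
      obtain ⟨h, C, hC⟩ := hV c
      exact MemLp.of_bound h.aestronglyMeasurable C (Filter.Eventually.of_forall hC)
    have h1 : ∫ b, (empMean V b c - m c) ^ 2 ∂(Measure.pi fun _ : Fin M => ν) =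
        Var[fun b => empMean V b c; Measure.pi fun _ : Fin M => ν] := by
      rw [variance_eq_integral (hE c).1.aemeasurable, integral_empMean hM hV, hm]
    have e : (fun b : Fin M → X => empMean V b c) =
        fun b => 1 / M * (∑ j, fun b : Fin M → X => V (b j) c) b := by
      ext b; simp [empMean]
    have h2 := variance_sum_pi (μ := fun _ : Fin M => ν) (X := fun _ x => V x c) fun _ => hmem
    have h3 : Var[fun x => V x c; ν] ≤ ∫ x, V x c ^ 2 ∂ν :=
      variance_le_expectation_sq (hV c).1.aestronglyMeasurable
    rw [h1, e, variance_const_mul, h2]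
    simp only [Finset.sum_const, Finset.card_univ, Fintype.card_fin, nsmul_eq_mul]
    calc (1 / (M : ℝ)) ^ 2 * (M * Var[fun x => V x c; ν]) = 1 / M * Var[fun x => V x c; ν] := by
          field_simp
      _ ≤ _ := mul_le_mul_of_nonneg_left h3 (by positivity)
  calc _ ≤ ∑ c, 1 / M * ∫ x, V x c ^ 2 ∂ν := Finset.sum_le_sum fun c _ => key c
    _ = 1 / M * ∫ x, ‖V x‖ ^ 2 ∂ν := by
        simp only [EuclideanSpace.real_norm_sq_eq]
        rw [integral_finsetSum _ fun c _ => (hV c).sq.integrable _, Finset.mul_sum]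
    _ ≤ 1 / M * B := by
        refine mul_le_mul_of_nonneg_left ?_ (by positivity)
        calc ∫ x, ‖V x‖ ^ 2 ∂ν ≤ ∫ _, B ∂ν :=
              integral_mono_ae (hV.norm_sq.integrable _) (integrable_const _) hB
          _ = B := by simp
    _ = B / M := by ring

end EmpiricalMean

/-- Boxes form a generating π-system, and the mass of a box is a product of measurable functions. -/
lemma measurable_measure_pi {Θ κ : Type*} [MeasurableSpace Θ] [Fintype κ] {X : κ → Type*}
    [∀ k, MeasurableSpace (X k)] {ν : ∀ k, Θ → Measure (X k)}
    [∀ k θ, IsProbabilityMeasure (ν k θ)] (h : ∀ k, Measurable (ν k)) :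
    Measurable fun θ => Measure.pi fun k => ν k θ := by
  refine Measurable.measure_of_isPiSystem_of_isProbabilityMeasure generateFrom_pi.symm
    isPiSystem_pi ?_
  rintro _ ⟨s, hs, rfl⟩
  simp only [Measure.pi_pi]
  exact Finset.measurable_prod _ fun k _ => (Measure.measurable_coe (hs k trivial)).comp (h k)

lemma measurable_measure_prod {Θ X Y : Type*} [MeasurableSpace Θ] [MeasurableSpace X]
    [MeasurableSpace Y] {μ : Θ → Measure X} {ν : Θ → Measure Y}
    [∀ θ, IsProbabilityMeasure (μ θ)] [∀ θ, IsProbabilityMeasure (ν θ)] (hμ : Measurable μ)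
    (hν : Measurable ν) : Measurable fun θ => (μ θ).prod (ν θ) := by
  refine Measurable.measure_of_isPiSystem_of_isProbabilityMeasure generateFrom_prod.symm
    isPiSystem_prod ?_
  rintro _ ⟨s, hs, t, ht, rfl⟩
  simp only [Measure.prod_prod]
  exact ((Measure.measurable_coe hs).comp hμ).mul ((Measure.measurable_coe ht).comp hν)

lemma bddMeas_fin_prod {N : ℕ} {Y : Type*} [MeasurableSpace Y] {f : Fin N → Y → ℝ}
    (hf : ∀ i, BddMeas (f i)) : BddMeas fun z : Fin N × Y => f z.1 z.2 := by
  have h : BddMeas fun z : Fin N × Y => ∑ i, (if z.1 = i then 1 else 0) * f i z.2 :=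
    BddMeas.sum fun i _ => BddMeas.mul
      ⟨Measurable.ite (measurable_fst (measurableSet_singleton i)) measurable_const
        measurable_const, 1, fun z => by dsimp only; split_ifs <;> simp⟩ ((hf i).comp measurable_snd)
  simpa using h

/-! ### Sampling laws, bias and variance of the estimators -/

namespace UPOMDP

variable {N T M d n : ℕ} {S O A : Type*} [MeasurableSpace S] [MeasurableSpace O]
  [MeasurableSpace A] [Fintype A] {p : O → A → ℝ} {y : LevelVec N} {ξ : ℝ}

theorem isProbabilityMeasure_map_trajLaw (E : UPOMDP N S O A) (hp : IsPolicy p) (i : Fin N) :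
    IsProbabilityMeasure ((E.trajLaw T p i).map fun τ => (i, τ)) :=
  have := E.isProbabilityMeasure_trajLaw (T := T) hp i
  Measure.isProbabilityMeasure_map (measurable_const.prodMk measurable_id).aemeasurable

theorem isProbabilityMeasure_sampleLaw (E : UPOMDP N S O A) (hp : IsPolicy p) (hξ : 0 < ξ)
    (hy : y ∈ truncSimplex N ξ) : IsProbabilityMeasure (E.sampleLaw T p y) :=
  have := E.isProbabilityMeasure_map_trajLaw (T := T) hp
  isProbabilityMeasure_sum (fun i => (pos_of_mem hξ hy i).le) hy.2 _

theorem integral_sampleLaw (E : UPOMDP N S O A) (hp : IsPolicy p) (hξ : 0 < ξ)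
    (hy : y ∈ truncSimplex N ξ) {f : Fin N × Traj T S A → ℝ} (hf : BddMeas f) :
    ∫ z, f z ∂(E.sampleLaw T p y) = ∑ i, y i * ∫ τ, f (i, τ) ∂(E.trajLaw T p i) := by
  have := E.isProbabilityMeasure_map_trajLaw (T := T) hp
  rw [sampleLaw, integral_finsetSum_measure fun i _ => (hf.integrable _).smul_measure (by simp)]
  refine Finset.sum_congr rfl fun i _ => ?_
  have hm : Measurable fun τ : Traj T S A => (i, τ) := measurable_const.prodMk measurable_id
  rw [integral_smul_measure, integral_map hm.aemeasurable
    hf.1.aestronglyMeasurable, ENNReal.toReal_ofReal (pos_of_mem hξ hy i).le, smul_eq_mul]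

theorem ae_sampleLaw (E : UPOMDP N S O A) {q : Fin N × Traj T S A → Prop}
    (hq : MeasurableSet {z | q z}) (h : ∀ i, ∀ᵐ τ ∂(E.trajLaw T p i), q (i, τ)) :
    ∀ᵐ z ∂(E.sampleLaw T p y), q z := by
  have hq' : MeasurableSet {z | ¬ q z} := hq.compl
  rw [ae_iff, sampleLaw, Measure.finsetSum_apply]
  refine Finset.sum_eq_zero fun i _ => ?_
  have hm : Measurable fun τ : Traj T S A => (i, τ) := measurable_const.prodMk measurable_id
  rw [Measure.smul_apply, Measure.map_apply hm hq']
  simp only [smul_eq_mul, mul_eq_zero]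
  exact Or.inr (ae_iff.1 (h i))

variable {π : Params d → O → A → ℝ} {ζ R : ℝ} {L K : NNReal}

theorem measurable_sampleLaw (E : UPOMDP N S O A) (hπ : IsRegularPolicy π ζ L K) :
    Measurable fun z : Params d × truncSimplex N ξ => E.sampleLaw T (π z.1) z.2 := by
  refine Measure.measurable_of_measurable_coe _ fun D hD => ?_
  simp only [sampleLaw, Measure.finsetSum_apply, Measure.smul_apply, smul_eq_mul]
  refine Finset.measurable_sum _ fun i _ => Measurable.mul ?_ ?_
  · have : Measurable fun z : Params d × truncSimplex N ξ => (z.2 : LevelVec N) i := by fun_prop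
    exact this.ennreal_ofReal
  · have hm : Measurable fun τ : Traj T S A => (i, τ) := measurable_const.prodMk measurable_id
    simp only [Measure.map_apply hm hD]
    exact (Measure.measurable_coe (hm hD)).comp
      ((E.measurable_trajLaw_prod hπ.policy hπ.measurable_prod i).comp measurable_fst)

theorem isProbabilityMeasure_batchLaw (E : UPOMDP N S O A) (hp : IsPolicy p) (hξ : 0 < ξ)
    (hy : y ∈ truncSimplex N ξ) : IsProbabilityMeasure (E.batchLaw T M p y) := by
  have := E.isProbabilityMeasure_sampleLaw (T := T) hp hξ hy
  have := E.isProbabilityMeasure_trajLaw (T := T) hp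
  unfold batchLaw
  infer_instance

/-- The weights range over the truncated simplex as a type, where the sampling law has mass one, so
that batch laws form a Markov kernel in the iterates. -/
theorem measurable_batchLaw (E : UPOMDP N S O A) (hπ : IsRegularPolicy π ζ L K) (hξ : 0 < ξ) :
    Measurable fun z : Params d × truncSimplex N ξ => E.batchLaw T M (π z.1) z.2 := by
  have h1 : ∀ z : Params d × truncSimplex N ξ,
      IsProbabilityMeasure (E.sampleLaw T (π z.1) z.2) := fun z =>
    E.isProbabilityMeasure_sampleLaw (T := T) (hπ.policy _) hξ z.2.2
  have h2 : ∀ (i : Fin N) (z : Params d × truncSimplex N ξ),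
      IsProbabilityMeasure (E.trajLaw T (π z.1) i) := fun i z =>
    E.isProbabilityMeasure_trajLaw (T := T) (hπ.policy _) i
  unfold batchLaw
  refine measurable_measure_prod ?_ ?_
  · exact measurable_measure_pi fun _ => measurable_measure_pi fun _ => E.measurable_sampleLaw hπ
  · exact measurable_measure_pi fun _ => measurable_measure_pi fun i =>
      (E.measurable_trajLaw_prod hπ.policy hπ.measurable_prod i).comp measurable_fst

/-- Score vector of the agent with parameter `x`. -/
def scoreVec (E : UPOMDP N S O A) (T : ℕ) (k : ScoreKind) (π : Params d → O → A → ℝ)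
    (x : Params d) : LevelVec N :=
  WithLp.toLp 2 fun i => E.score T k (π x) i

/-- The contribution of one sampled trajectory to the policy gradient estimator. -/
def sampleGrad (E : UPOMDP N S O A) (w : WeightKind) (π : Params d → O → A → ℝ) (x : Params d)
    (z : Fin N × Traj T S A) : Params d :=
  ∑ t, E.weight w (π x) z.1 t z.2 • logGrad π x (E.obs z.1 (z.2 t).1) (z.2 t).2

/-- The contribution of one batch to the policy gradient estimator. -/
def batchGrad (E : UPOMDP N S O A) (w : WeightKind) (π : Params d → O → A → ℝ) (x : Params d)
    (β : Fin N → Fin N × Traj T S A) : Params d :=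
  (-(1 : ℝ) / N) • ∑ l, E.sampleGrad w π x (β l)

/-- Grouping the `N * M` pairs into `M` independent batches of `N` makes both players' estimators
empirical means over `M` terms. -/
lemma agentGrad_eq (E : UPOMDP N S O A) (w : WeightKind) (π : Params d → O → A → ℝ)
    (x : Params d) (b : Batch N T M S A) :
    E.agentGrad w π x b = empMean (E.batchGrad w π x) b.1 := by
  rw [empMean]
  simp only [batchGrad, ← Finset.smul_sum, smul_smul]
  rw [agentGrad]
  congr 1
  rw [div_mul_div_comm, one_mul, mul_comm (N : ℝ)]
  ring

/-- The offset does not depend on the parameter, so one analysis serves all kinds of score. -/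
theorem gradient_scoreVec (E : UPOMDP N S O A) (k : ScoreKind) (i : Fin N) (x : Params d) :
    gradient (fun x => E.scoreVec T k π x i) x =
      -gradient (fun x => E.expReturn T (π x) i) x := by
  have e : (fun x => E.scoreVec T k π x i) =
      fun x => E.offset T k i - E.expReturn T (π x) i := rfl
  rw [e, gradient, fderiv_const_sub, map_neg]
  rfl

/-- The vector of returns of one trajectory on each level. -/
def retVec (E : UPOMDP N S O A) (β : Fin N → Traj T S A) : LevelVec N :=
  WithLp.toLp 2 fun i => E.ret i (β i)

theorem ae_norm_retVec_le (E : UPOMDP N S O A) (hπ : IsRegularPolicy π ζ L K)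
    (hR : E.IsReturnBound T π R) (x : Params d) :
    ∀ᵐ β ∂(Measure.pi fun i : Fin N => E.trajLaw T (π x) i), ‖E.retVec β‖ ^ 2 ≤ N * R ^ 2 := by
  have := E.isProbabilityMeasure_trajLaw (T := T) (hπ.policy x)
  have h : ∀ᵐ β ∂(Measure.pi fun i : Fin N => E.trajLaw T (π x) i), ∀ i, |E.ret i (β i)| ≤ R :=
    ae_all_iff.2 fun i =>
      (Measure.quasiMeasurePreserving_eval (fun i : Fin N => E.trajLaw T (π x) i) i).ae (hR x i 0)
  filter_upwards [h] with β hβ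
  rw [EuclideanSpace.real_norm_sq_eq]
  calc ∑ i, E.retVec β i ^ 2 ≤ ∑ _i : Fin N, R ^ 2 := Finset.sum_le_sum fun i _ =>
        sq_le_sq' (abs_le.1 (hβ i)).1 (abs_le.1 (hβ i)).2
    _ = N * R ^ 2 := by simp

/-- Noise of the agent's gradient estimator. -/
def agentNoise (E : UPOMDP N S O A) (k : ScoreKind) (w : WeightKind) (π : Params d → O → A → ℝ)
    (x : Params d) (y : LevelVec N) (b : Batch N T M S A) : Params d :=
  E.agentGrad w π x b - SmoothScores.mixGrad (E.scoreVec T k π) x y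

/-- Noise of the adversary's gradient estimator. -/
def advNoise (E : UPOMDP N S O A) (π : Params d → O → A → ℝ) (x : Params d)
    (b : Batch N T M S A) : LevelVec N :=
  (WithLp.toLp 2 fun i => E.expReturn T (π x) i) - empMean E.retVec b.2

/-- The offset and the entropy gradient are exact; the noise comes only from the estimated returns.
-/
lemma advGrad_eq (E : UPOMDP N S O A) (k : ScoreKind) (α : ℝ) (π : Params d → O → A → ℝ)
    (x : Params d) (y : LevelVec N) (b : Batch N T M S A) :
    E.advGrad k α y b = E.scoreVec T k π x + α • gradient entropy y + E.advNoise π x b := by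
  ext i
  simp [advGrad, scoreVec, advNoise, empMean, score, retVec]
  ring

theorem integral_batchLaw_fst (E : UPOMDP N S O A) (hp : IsPolicy p) (hξ : 0 < ξ)
    (hy : y ∈ truncSimplex N ξ) (f : (Fin M → Fin N → Fin N × Traj T S A) → ℝ) :
    ∫ b, f b.1 ∂(E.batchLaw T M p y) =
      ∫ b, f b ∂(Measure.pi fun _ : Fin M => Measure.pi fun _ : Fin N => E.sampleLaw T p y) := by
  have := E.isProbabilityMeasure_sampleLaw (T := T) hp hξ hy
  have := E.isProbabilityMeasure_trajLaw (T := T) hp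
  rw [batchLaw, integral_fun_fst]
  simp

theorem integral_batchLaw_snd (E : UPOMDP N S O A) (hp : IsPolicy p) (hξ : 0 < ξ)
    (hy : y ∈ truncSimplex N ξ) (f : (Fin M → Fin N → Traj T S A) → ℝ) :
    ∫ b, f b.2 ∂(E.batchLaw T M p y) =
      ∫ b, f b ∂(Measure.pi fun _ : Fin M => Measure.pi fun i : Fin N => E.trajLaw T p i) := by
  have := E.isProbabilityMeasure_sampleLaw (T := T) hp hξ hy
  have := E.isProbabilityMeasure_trajLaw (T := T) hp
  rw [batchLaw, integral_fun_snd]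
  simp

variable [DiscreteMeasurableSpace A]

theorem bddVec_sampleGrad_prod (E : UPOMDP N S O A) (w : WeightKind)
    (hπ : IsRegularPolicy π ζ L K) (hζ : 0 < ζ) :
    BddVec fun v : Params d × (Fin N × Traj T S A) => E.sampleGrad w π v.1 v.2 := by
  have h : ∀ i, BddVec fun v : Params d × Traj T S A => E.sampleGrad w π v.1 (i, v.2) := fun i => by
    refine BddVec.sum fun t _ => BddVec.smul
      (E.bddMeas_weight_prod w hπ.policy hπ.measurable_prod i t) ?_
    refine BddVec.of_norm_le (fun c => ?_) fun v => hπ.norm_logGrad_le hζ _ _ _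
    have hm := (E.measurable_logGrad_obs hπ hζ i).comp
      (measurable_fst.prodMk ((measurable_pi_apply t).comp measurable_snd) :
        Measurable fun v : Params d × Traj T S A => (v.1, v.2 t))
    exact (by fun_prop : Measurable fun u : Params d => u c).comp hm
  intro c
  exact (bddMeas_fin_prod fun i => h i c).comp
    (h := fun v : Params d × (Fin N × Traj T S A) => (v.2.1, (v.1, v.2.2)))
    (measurable_snd.fst.prodMk (measurable_fst.prodMk measurable_snd.snd))

theorem bddVec_sampleGrad (E : UPOMDP N S O A) (w : WeightKind) (hπ : IsRegularPolicy π ζ L K)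
    (hζ : 0 < ζ) (x : Params d) : BddVec (E.sampleGrad (T := T) w π x) :=
  (E.bddVec_sampleGrad_prod w hπ hζ).comp (h := fun z => (x, z)) measurable_prodMk_left

theorem bddVec_batchGrad (E : UPOMDP N S O A) (w : WeightKind) (hπ : IsRegularPolicy π ζ L K)
    (hζ : 0 < ζ) (x : Params d) : BddVec (E.batchGrad (T := T) w π x) :=
  (BddVec.sum fun l _ =>
    (E.bddVec_sampleGrad w hπ hζ x).comp (measurable_pi_apply l)).smul (BddMeas.const _)

theorem bddVec_agentGrad (E : UPOMDP N S O A) (w : WeightKind) (hπ : IsRegularPolicy π ζ L K)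
    (hζ : 0 < ζ) :
    BddVec fun v : Params d × Batch N T M S A => E.agentGrad w π v.1 v.2 := by
  simp only [agentGrad_eq, empMean, batchGrad]
  refine (BddVec.sum fun j _ => (BddVec.sum fun l _ => ?_).smul (BddMeas.const _)).smul
    (BddMeas.const _)
  refine (E.bddVec_sampleGrad_prod w hπ hζ).comp
    (h := fun v : Params d × Batch N T M S A => (v.1, v.2.1 j l)) ?_
  exact measurable_fst.prodMk ((measurable_pi_apply l).comp
    ((measurable_pi_apply j).comp measurable_snd.fst))

theorem smoothScores (E : UPOMDP N S O A) (k : ScoreKind) (hπ : IsRegularPolicy π ζ L K)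
    (hζ : 0 < ζ) (hR : E.IsReturnBound T π R) :
    SmoothScores (E.scoreVec T k π) (R * (T * (L / ζ)))
      (R * (T * (3 * (L ^ 2 / ζ ^ 2) + K / ζ))) := by
  have hd := fun i => E.differentiable_expReturn hπ hζ hR i
  refine ⟨fun i => (hd i).const_sub _, fun i x => ?_, fun i x y => ?_⟩
  · rw [gradient_scoreVec, norm_neg]
    exact E.norm_gradient_expReturn_le hπ hζ hR i x
  · rw [gradient_scoreVec, inner_neg_left]
    have h := E.abs_expReturn_sub_sub_inner_le hπ hζ hR i x y
    rw [← abs_neg] at h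
    convert! h using 2
    simp only [scoreVec, score]
    ring

/-- The policy gradient estimator is unbiased. -/
theorem integral_batchGrad (E : UPOMDP N S O A) (k : ScoreKind) (w : WeightKind)
    (hπ : IsRegularPolicy π ζ L K) (hζ : 0 < ζ) (hR : E.IsReturnBound T π R) (hN : 0 < N)
    (hξ : 0 < ξ) (x : Params d) (hy : y ∈ truncSimplex N ξ) (c : Fin d) :
    ∫ β, E.batchGrad w π x β c ∂(Measure.pi fun _ : Fin N => E.sampleLaw T (π x) y) =
      SmoothScores.mixGrad (E.scoreVec T k π) x y c := by
  have := E.isProbabilityMeasure_sampleLaw (T := T) (hπ.policy x) hξ hy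
  have hN' : (N : ℝ) ≠ 0 := by positivity
  have hG := E.bddVec_sampleGrad (T := T) w hπ hζ x
  have e : ∀ β : Fin N → Fin N × Traj T S A, E.batchGrad w π x β c =
      -(1 : ℝ) / N * ∑ l, E.sampleGrad w π x (β l) c := fun β => by simp [batchGrad]
  simp only [e]
  rw [integral_const_mul, integral_finsetSum _ fun l _ =>
    ((hG c).comp (measurable_pi_apply l)).integrable _]
  simp only [integral_eval_pi (fun _ : Fin N => E.sampleLaw T (π x) y) _ (hG c)]
  rw [E.integral_sampleLaw (hπ.policy x) hξ hy (hG c)]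
  -- Coordinate `c` of a sample is the weighted sum for the `c`-th basis direction, to which the
  -- policy gradient theorem applies.
  have h1 : ∀ i, ∫ τ, E.sampleGrad w π x (i, τ) c ∂(E.trajLaw T (π x) i) =
      gradient (fun x => E.expReturn T (π x) i) x c := fun i => by
    have h2 : gradient (fun x => E.expReturn T (π x) i) x c = inner ℝ
        (gradient (fun x => E.expReturn T (π x) i) x) (EuclideanSpace.single c 1) := by
      rw [EuclideanSpace.inner_single_right]; simp
    rw [h2, E.inner_gradient_expReturn_eq_weightedSum w hπ hζ hR]
    refine integral_congr_ae (Filter.Eventually.of_forall fun τ => ?_)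
    simp only [sampleGrad, weightedSum, dirLogGrad, EuclideanSpace.inner_single_right]
    simp
  simp only [h1, SmoothScores.mixGrad, gradient_scoreVec]
  simp only [Finset.sum_const, Finset.card_univ, Fintype.card_fin, nsmul_eq_mul, smul_neg,
    Finset.sum_neg_distrib, PiLp.neg_apply, WithLp.ofLp_sum, Finset.sum_apply, PiLp.smul_apply,
    smul_eq_mul]
  field_simp

theorem ae_norm_batchGrad_le (E : UPOMDP N S O A) (w : WeightKind)
    (hπ : IsRegularPolicy π ζ L K) (hζ : 0 < ζ) (hR : E.IsReturnBound T π R) (hN : 0 < N)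
    (hξ : 0 < ξ) (x : Params d) (hy : y ∈ truncSimplex N ξ) :
    ∀ᵐ β ∂(Measure.pi fun _ : Fin N => E.sampleLaw T (π x) y),
      ‖E.batchGrad w π x β‖ ^ 2 ≤ (2 * R * (T * (L / ζ))) ^ 2 := by
  have := E.isProbabilityMeasure_sampleLaw (T := T) (hπ.policy x) hξ hy
  have hR0 := E.return_bound_nonneg hN hπ hR
  have hG := E.bddVec_sampleGrad (T := T) w hπ hζ x
  have h1 : ∀ᵐ z ∂(E.sampleLaw T (π x) y), ‖E.sampleGrad w π x z‖ ≤ 2 * R * (T * (L / ζ)) := by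
    refine E.ae_sampleLaw (measurableSet_le hG.measurable.norm measurable_const) fun i => ?_
    have h2 := ae_all_iff.2 (E.ae_abs_weight_le w (hπ.policy x)
      (fun o a => (hπ.pos hζ x o a).ne') i (hR x i))
    filter_upwards [h2] with τ hτ
    calc ‖E.sampleGrad w π x (i, τ)‖ ≤ ∑ t : Fin T, 2 * R * (L / ζ) := by
          refine (norm_sum_le _ _).trans (Finset.sum_le_sum fun t _ => ?_)
          rw [norm_smul]
          exact mul_le_mul (hτ t) (hπ.norm_logGrad_le hζ _ _ _) (norm_nonneg _) (by positivity)
      _ = 2 * R * (T * (L / ζ)) := by simp; ring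
  have h3 : ∀ᵐ β ∂(Measure.pi fun _ : Fin N => E.sampleLaw T (π x) y), ∀ l,
      ‖E.sampleGrad w π x (β l)‖ ≤ 2 * R * (T * (L / ζ)) := ae_all_iff.2 fun l =>
    (Measure.quasiMeasurePreserving_eval (fun _ : Fin N => E.sampleLaw T (π x) y) l).ae h1
  filter_upwards [h3] with β hβ
  refine pow_le_pow_left₀ (norm_nonneg _) ?_ 2
  have hN' : (0 : ℝ) < N := Nat.cast_pos.2 hN
  rw [batchGrad, norm_smul, norm_div, norm_neg, norm_one, Real.norm_of_nonneg hN'.le]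
  calc 1 / (N : ℝ) * ‖∑ l, E.sampleGrad w π x (β l)‖
      ≤ 1 / N * ∑ _l : Fin N, 2 * R * (T * (L / ζ)) :=
        mul_le_mul_of_nonneg_left ((norm_sum_le _ _).trans (Finset.sum_le_sum fun l _ => hβ l))
          (by positivity)
    _ = 2 * R * (T * (L / ζ)) := by
        simp only [Finset.sum_const, Finset.card_univ, Fintype.card_fin, nsmul_eq_mul]
        field_simp

theorem bddVec_retVec (E : UPOMDP N S O A) : BddVec (E.retVec (T := T)) := fun i =>
  (E.bddMeas_ret i).comp (measurable_pi_apply i)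

theorem integral_retVec (E : UPOMDP N S O A) (hp : IsPolicy p) (i : Fin N) :
    ∫ β, E.retVec β i ∂(Measure.pi fun i : Fin N => E.trajLaw T p i) = E.expReturn T p i := by
  have := E.isProbabilityMeasure_trajLaw (T := T) hp
  exact integral_eval_pi (fun i : Fin N => E.trajLaw T p i) i (E.bddMeas_ret i)

section Moments

variable (E : UPOMDP N S O A) (k : ScoreKind) (w : WeightKind)

theorem integral_inner_agentNoise (hπ : IsRegularPolicy π ζ L K) (hζ : 0 < ζ)
    (hR : E.IsReturnBound T π R) (hN : 0 < N) (hM : 0 < M) (hξ : 0 < ξ) (x u : Params d)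
    (hy : y ∈ truncSimplex N ξ) :
    ∫ b, inner ℝ u (E.agentNoise k w π x y b) ∂(E.batchLaw T M (π x) y) = 0 := by
  have := E.isProbabilityMeasure_sampleLaw (T := T) (hπ.policy x) hξ hy
  simp only [agentNoise, agentGrad_eq]
  rw [E.integral_batchLaw_fst (hπ.policy x) hξ hy fun b =>
    inner ℝ u (empMean (E.batchGrad w π x) b - SmoothScores.mixGrad (E.scoreVec T k π) x y)]
  exact integral_inner_empMean_sub hM (E.bddVec_batchGrad w hπ hζ x) u _
    (E.integral_batchGrad k w hπ hζ hR hN hξ x hy)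

/-- Almost surely a batch has norm at most `2 * R * (T * (L / ζ))`, whose square is the second term
of `varConst`; the first term is there for the adversary. -/
theorem integral_norm_agentNoise_sq_le (hπ : IsRegularPolicy π ζ L K) (hζ : 0 < ζ)
    (hR : E.IsReturnBound T π R) (hN : 0 < N) (hM : 0 < M) (hξ : 0 < ξ) (x : Params d)
    (hy : y ∈ truncSimplex N ξ) :
    ∫ b, ‖E.agentNoise k w π x y b‖ ^ 2 ∂(E.batchLaw T M (π x) y) ≤ varConst N T R ζ L / M := by
  have := E.isProbabilityMeasure_sampleLaw (T := T) (hπ.policy x) hξ hy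
  simp only [agentNoise, agentGrad_eq]
  rw [E.integral_batchLaw_fst (hπ.policy x) hξ hy fun b =>
    ‖empMean (E.batchGrad w π x) b - SmoothScores.mixGrad (E.scoreVec T k π) x y‖ ^ 2]
  refine (integral_norm_empMean_sub_sq_le hM (E.bddVec_batchGrad w hπ hζ x) _
    (E.integral_batchGrad k w hπ hζ hR hN hξ x hy)
    (E.ae_norm_batchGrad_le w hπ hζ hR hN hξ x hy)).trans ?_
  refine div_le_div_of_nonneg_right ?_ (Nat.cast_nonneg M)
  have h : 0 ≤ 4 * R ^ 2 * (N : ℝ) := by positivity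
  have e : varConst N T R ζ L = (2 * R * (T * (L / ζ))) ^ 2 + 4 * R ^ 2 * N := by
    rw [varConst]; ring
  linarith

theorem integral_inner_advNoise (hπ : IsRegularPolicy π ζ L K) (hM : 0 < M) (hξ : 0 < ξ)
    (x : Params d) (u : LevelVec N) (hy : y ∈ truncSimplex N ξ) :
    ∫ b, inner ℝ u (E.advNoise π x b) ∂(E.batchLaw T M (π x) y) = 0 := by
  have := E.isProbabilityMeasure_trajLaw (T := T) (hπ.policy x)
  have h := integral_inner_empMean_sub (ν := Measure.pi fun i : Fin N => E.trajLaw T (π x) i) hM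
    E.bddVec_retVec u (WithLp.toLp 2 fun i => E.expReturn T (π x) i)
    fun i => E.integral_retVec (hπ.policy x) i
  simp only [advNoise]
  rw [E.integral_batchLaw_snd (hπ.policy x) hξ hy fun b =>
    inner ℝ u ((WithLp.toLp 2 fun i => E.expReturn T (π x) i) - empMean E.retVec b), ← neg_eq_zero,
    ← integral_neg, ← h]
  refine integral_congr_ae (Filter.Eventually.of_forall fun b => ?_)
  simp only [← inner_neg_right, neg_sub]

theorem integral_norm_advNoise_sq_le (hπ : IsRegularPolicy π ζ L K)
    (hR : E.IsReturnBound T π R) (hM : 0 < M) (hξ : 0 < ξ) (x : Params d)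
    (hy : y ∈ truncSimplex N ξ) :
    ∫ b, ‖E.advNoise π x b‖ ^ 2 ∂(E.batchLaw T M (π x) y) ≤ varConst N T R ζ L / M := by
  have := E.isProbabilityMeasure_trajLaw (T := T) (hπ.policy x)
  simp only [advNoise, norm_sub_rev _ (empMean _ _)]
  rw [E.integral_batchLaw_snd (hπ.policy x) hξ hy fun b =>
    ‖empMean E.retVec b - (WithLp.toLp 2 fun i => E.expReturn T (π x) i)‖ ^ 2]
  refine (integral_norm_empMean_sub_sq_le hM E.bddVec_retVec _
    (fun i => E.integral_retVec (hπ.policy x) i) (E.ae_norm_retVec_le hπ hR x)).trans ?_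
  refine div_le_div_of_nonneg_right ?_ (Nat.cast_nonneg M)
  have h : 0 ≤ 3 * N * R ^ 2 + 4 * R ^ 2 * ((T : ℝ) ^ 2 * (L : ℝ) ^ 2 / ζ ^ 2) := by positivity
  have e : varConst N T R ζ L = N * R ^ 2 +
      (3 * N * R ^ 2 + 4 * R ^ 2 * ((T : ℝ) ^ 2 * (L : ℝ) ^ 2 / ζ ^ 2)) := by
    rw [varConst]; ring
  linarith

end Moments

end UPOMDP

/-! ### Step sizes and telescoping -/

section StepSizes

/-- The step size conditions imply the conditions for the decrease of the potential. -/
lemma step_size_bounds {G H ℓ α c ηx ηy β w κ : ℝ} (hG0 : 0 ≤ G) (hG : G ≤ ℓ)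
    (hH : H ≤ 3 * ℓ) (hα : 0 < α) (hαℓ : α ≤ ℓ) (hc : 0 < c) (hc1 : c ≤ 1)
    (hηy1 : c * (1 / ℓ) ≤ ηy) (hηy2 : ηy ≤ 1 / ℓ) (hηx0 : 0 < ηx)
    (hηx : ηx ≤ c / 20 * (α ^ 2 / ℓ ^ 3)) (hβ : β = ηy * α / 4) (hw : w = 2 * G ^ 2 / (ηy * α))
    (hκ : κ = (2 * G ^ 2 / α + H) * ηx ^ 2 + ηx * w * (1 + 1 / β) * (2 * G / α) ^ 2 * ηx ^ 2) :
    κ ≤ ηx / 2 ∧ κ + ηx * w * (1 + β) * ηy ^ 2 ≤ 3 * ηx * (ℓ / α) ∧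
      w ≤ 2 * ℓ ^ 3 / (c * α) := by
  have hℓ : 0 < ℓ := hα.trans_le hαℓ
  have hηy0 : 0 < ηy := lt_of_lt_of_le (by positivity) hηy1
  have hβ0 : 0 < β := by rw [hβ]; positivity
  have hβ4 : β ≤ 1 / 4 := by
    have : ηy * α ≤ 1 / ℓ * ℓ := mul_le_mul hηy2 hαℓ hα.le (by positivity)
    rw [one_div_mul_cancel hℓ.ne'] at this
    rw [hβ]; linarith
  have hw0 : 0 ≤ w := by rw [hw]; positivity
  have hG2 : G ^ 2 ≤ ℓ ^ 2 := pow_le_pow_left₀ hG0 hG 2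
  have hw1 : w ≤ 2 * ℓ ^ 3 / (c * α) := by
    rw [hw]
    calc 2 * G ^ 2 / (ηy * α) ≤ 2 * ℓ ^ 2 / (c * (1 / ℓ) * α) := by gcongr
      _ = 2 * ℓ ^ 3 / (c * α) := by field_simp
  have hβ1 : 1 + 1 / β ≤ 5 * ℓ / (c * α) := by
    have h1 : c * α / (4 * ℓ) ≤ β := by
      rw [hβ]
      calc c * α / (4 * ℓ) = c * (1 / ℓ) * α / 4 := by field_simp
        _ ≤ _ := by gcongr
    have h2 : 1 / β ≤ 4 * ℓ / (c * α) := by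
      calc 1 / β ≤ 1 / (c * α / (4 * ℓ)) := one_div_le_one_div_of_le (by positivity) h1
        _ = _ := by field_simp
    have h3 : 1 ≤ ℓ / (c * α) := by
      rw [le_div_iff₀ (by positivity)]
      nlinarith
    calc 1 + 1 / β ≤ ℓ / (c * α) + 4 * ℓ / (c * α) := add_le_add h3 h2
      _ = _ := by ring
  have t1 : (2 * G ^ 2 / α + H) * ηx ≤ 1 / 4 := by
    have h1 : 2 * G ^ 2 / α + H ≤ 5 * ℓ ^ 2 / α := by
      have h2 : 2 * G ^ 2 / α ≤ 2 * ℓ ^ 2 / α := by gcongr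
      have h3 : 3 * ℓ ≤ 3 * ℓ ^ 2 / α := by
        rw [le_div_iff₀ hα]; nlinarith
      calc 2 * G ^ 2 / α + H ≤ 2 * ℓ ^ 2 / α + 3 * ℓ ^ 2 / α := by linarith
        _ = _ := by ring
    calc (2 * G ^ 2 / α + H) * ηx ≤ 5 * ℓ ^ 2 / α * ηx := mul_le_mul_of_nonneg_right h1 hηx0.le
      _ ≤ 5 * ℓ ^ 2 / α * (c / 20 * (α ^ 2 / ℓ ^ 3)) := by gcongr
      _ = c * (α / ℓ) / 4 := by field_simp; ring
      _ ≤ 1 / 4 := by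
        have : α / ℓ ≤ 1 := (div_le_one hℓ).2 hαℓ
        have : c * (α / ℓ) ≤ 1 * 1 := mul_le_mul hc1 this (by positivity) zero_le_one
        linarith
  -- All parameters cancel: `w` and `1 + 1 / β` each bring a factor `1 / c`, and `ηx ^ 2` brings `c
  -- ^ 2`. This explains both the scale `α ^ 2 / ℓ ^ 3` of `ηx` and its threshold proportional to
  -- `c`.
  have t2 : w * (1 + 1 / β) * (2 * G / α) ^ 2 * ηx ^ 2 ≤ 1 / 10 := by
    calc w * (1 + 1 / β) * (2 * G / α) ^ 2 * ηx ^ 2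
        ≤ (2 * ℓ ^ 3 / (c * α)) * (5 * ℓ / (c * α)) * (2 * ℓ / α) ^ 2 *
          (c / 20 * (α ^ 2 / ℓ ^ 3)) ^ 2 := by gcongr
      _ = 1 / 10 := by field_simp; norm_num
  have hκ1 : κ ≤ ηx / 2 := by
    calc κ = ηx * ((2 * G ^ 2 / α + H) * ηx + w * (1 + 1 / β) * (2 * G / α) ^ 2 * ηx ^ 2) := by
          rw [hκ]; ring
      _ ≤ ηx * (1 / 4 + 1 / 10) := by gcongr
      _ ≤ ηx / 2 := by linarith
  refine ⟨hκ1, ?_, hw1⟩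
  have t3 : w * (1 + β) * ηy ^ 2 ≤ 5 / 2 * (ℓ / α) := by
    calc w * (1 + β) * ηy ^ 2 = 2 * G ^ 2 / α * (1 + β) * ηy := by rw [hw]; field_simp
      _ ≤ 2 * ℓ ^ 2 / α * (1 + 1 / 4) * (1 / ℓ) := by gcongr
      _ = 5 / 2 * (ℓ / α) := by field_simp; ring
  have t4 : 1 ≤ ℓ / α := (one_le_div hα).2 hαℓ
  calc κ + ηx * w * (1 + β) * ηy ^ 2 ≤ ηx / 2 + ηx * (5 / 2 * (ℓ / α)) := by
        refine add_le_add hκ1 ?_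
        calc ηx * w * (1 + β) * ηy ^ 2 = ηx * (w * (1 + β) * ηy ^ 2) := by ring
          _ ≤ _ := mul_le_mul_of_nonneg_left t3 hηx0.le
    _ ≤ 3 * ηx * (ℓ / α) := by nlinarith

/-- If a potential decreases by `a` on average, up to an error, then some decrease is small. -/
lemma exists_lt_of_potential_decrease {a v : ℕ → ℝ} {η e D : ℝ} {n : ℕ}
    (hstep : ∀ t, v (t + 1) ≤ v t - η * a t + e) (hη : 0 < η)
    (hgap : v 0 - v n ≤ D) {δ : ℝ} (hn : D + n * e < n * (η * δ)) : ∃ t < n, a t < δ := by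
  -- If no `a t` were below `δ`, the steps would add up to a decrease larger than `D`.
  by_contra! hcon
  have h : ∀ m ≤ n, v m ≤ v 0 - m * (η * δ) + m * e := by
    intro m
    induction m with
    | zero => intro _; simp
    | succ m ih =>
      intro hm
      have h1 := hstep m
      have h2 := ih (by omega)
      have h3 := mul_le_mul_of_nonneg_left (hcon m (by omega)) hη.le
      push_cast
      linarith
  have := h n le_rfl
  linarith

end StepSizes

/-! ### Measurability and boundedness of the terms of the potential -/

namespace SmoothScores

variable {N d : ℕ} {s : Params d → LevelVec N} {G H ξ α ηy : ℝ}

lemma bddVec_mixGrad (hs : SmoothScores s G H) (hξ : 0 < ξ) :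
    BddVec fun z : Params d × truncSimplex N ξ => mixGrad s z.1 z.2 := by
  refine BddVec.of_norm_le (C := G) (fun c => ?_) fun z => hs.norm_mixGrad_le hξ z.1 z.2.2
  have e : ∀ z : Params d × truncSimplex N ξ, mixGrad s z.1 z.2 c = ∑ i, (z.2 : LevelVec N) i *
      fderiv ℝ (fun x => s x i) z.1 (EuclideanSpace.single c 1) := fun z => by
    have h := inner_mixGrad (s := s) z.1 (EuclideanSpace.single c 1) z.2
    rw [EuclideanSpace.inner_single_right] at h
    simp only [inner_gradient] at h
    simpa using h
  simp only [e]
  refine Finset.measurable_sum _ fun i _ => Measurable.mul (by fun_prop) ?_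
  exact (measurable_fderiv_apply_const ℝ (fun x => s x i) _).comp measurable_fst

/-- Although chosen pointwise, the best response is Lipschitz in the parameter. -/
lemma measurable_bestResponse (hs : SmoothScores s G H) (hN : 0 < N) (hξ : 0 < ξ)
    (hξN : ξ * N ≤ 1) (hα : 0 < α) : Measurable fun x => bestResponse α ξ (s x) := by
  have hG : 0 ≤ G := (norm_nonneg _).trans (hs.norm_gradient_le ⟨0, hN⟩ 0)
  have : LipschitzWith (Real.toNNReal (2 * G / α)) fun x => bestResponse α ξ (s x) :=
    LipschitzWith.of_dist_le_mul fun x y => by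
      rw [dist_eq_norm, dist_eq_norm, Real.coe_toNNReal _ (by positivity)]
      exact (norm_le_l1 _).trans (hs.l1_bestResponse_sub_le hN hξ hξN hα y x)
  exact this.continuous.measurable

lemma bddVec_maxGrad (hs : SmoothScores s G H) (hN : 0 < N) (hξ : 0 < ξ)
    (hξN : ξ * N ≤ 1) (hα : 0 < α) : BddVec fun x => maxGrad α ξ s x := by
  have hm : Measurable fun x : Params d => ((x, ⟨bestResponse α ξ (s x),
      (bestResponse_spec hN hξ hξN (s x)).1⟩) : Params d × truncSimplex N ξ) :=
    measurable_id.prodMk (hs.measurable_bestResponse hN hξ hξN hα).subtype_mk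
  exact (hs.bddVec_mixGrad hξ).comp hm

lemma norm_maxGrad_le (hs : SmoothScores s G H) (hN : 0 < N) (hξ : 0 < ξ)
    (hξN : ξ * N ≤ 1) (x : Params d) : ‖maxGrad α ξ s x‖ ≤ G :=
  hs.norm_mixGrad_le hξ x (bestResponse_spec hN hξ hξN (s x)).1

lemma bddVec_simplex (hξ : 0 < ξ) : BddVec fun y : truncSimplex N ξ => (y : LevelVec N) :=
  fun i => ⟨by fun_prop, 1, fun y => by
    rw [abs_of_pos (pos_of_mem hξ y.2 i)]; exact le_one_of_mem hξ y.2 i⟩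

lemma bddVec_gradient_entropy (hξ : 0 < ξ) :
    BddVec fun y : truncSimplex N ξ => gradient (entropy : LevelVec N → ℝ) y := fun i => by
  have e : ∀ y : truncSimplex N ξ, gradient (entropy : LevelVec N → ℝ) y i =
      -Real.log ((y : LevelVec N) i) - 1 := fun y => gradient_entropy (pos_of_mem hξ y.2) i
  simp only [e]
  refine ⟨by fun_prop, -Real.log ξ + 1, fun y => ?_⟩
  have h1 := Real.log_le_log hξ (y.2.1 i)
  have h2 := Real.log_nonpos (pos_of_mem hξ y.2 i).le (le_one_of_mem hξ y.2 i)
  rw [abs_le]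
  constructor <;> linarith

lemma bddVec_ascentGap (hs : SmoothScores s G H) (hN : 0 < N) (hξ : 0 < ξ)
    (hξN : ξ * N ≤ 1) (hα : 0 < α) :
    BddVec fun z : Params d × truncSimplex N ξ => ascentGap α ξ ηy s z.1 z.2 := by
  have hb : Measurable fun z : Params d × truncSimplex N ξ =>
      (⟨bestResponse α ξ (s z.1), (bestResponse_spec hN hξ hξN (s z.1)).1⟩ : truncSimplex N ξ) :=
    ((hs.measurable_bestResponse hN hξ hξN hα).comp measurable_fst).subtype_mk
  exact (((bddVec_simplex hξ).comp measurable_snd).sub ((bddVec_simplex hξ).comp hb)).add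
    ((((bddVec_gradient_entropy hξ).comp measurable_snd).sub
      ((bddVec_gradient_entropy hξ).comp hb)).smul (BddMeas.const (ηy * α)))

lemma bddMeas_maxPayoff (hs : SmoothScores s G H) (hb : BddVec s) (hN : 0 < N) (hξ : 0 < ξ)
    (hξN : ξ * N ≤ 1) (hα : 0 < α) : BddMeas fun x => maxPayoff α ξ (s x) := by
  have hm := hs.measurable_bestResponse hN hξ hξN hα
  have hc : BddVec fun x => bestResponse α ξ (s x) :=
    (bddVec_simplex hξ).comp (h := fun x => ⟨bestResponse α ξ (s x),
      (bestResponse_spec hN hξ hξN (s x)).1⟩) hm.subtype_mk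
  have he : BddMeas fun x => entropy (bestResponse α ξ (s x)) := by
    refine BddMeas.sum fun i _ => ⟨Real.continuous_negMulLog.measurable.comp (hc i).1, ?_⟩
    obtain ⟨C, hC⟩ := (isCompact_Icc (a := (0 : ℝ)) (b := 1)).exists_bound_of_continuousOn
      Real.continuous_negMulLog.continuousOn
    have hmem := fun x => (bestResponse_spec (α := α) hN hξ hξN (s x)).1
    exact ⟨C, fun x => hC _ ⟨(pos_of_mem hξ (hmem x) i).le, le_one_of_mem hξ (hmem x) i⟩⟩
  simp only [maxPayoff_eq hN hξ hξN, payoff]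
  exact (BddMeas.sum fun i _ => (hc i).mul (hb i)).add (he.const_mul α)

lemma bddMeas_potential (hs : SmoothScores s G H) (hb : BddVec s) (hN : 0 < N) (hξ : 0 < ξ)
    (hξN : ξ * N ≤ 1) (hα : 0 < α) (w : ℝ) :
    BddMeas fun z : Params d × truncSimplex N ξ => potential α ξ w s z.1 z.2 := by
  have hc : Measurable fun z : Params d × truncSimplex N ξ =>
      (⟨bestResponse α ξ (s z.1), (bestResponse_spec hN hξ hξN (s z.1)).1⟩ : truncSimplex N ξ) :=
    ((hs.measurable_bestResponse hN hξ hξN hα).comp measurable_fst).subtype_mk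
  exact ((hs.bddMeas_maxPayoff hb hN hξ hξN hα).comp measurable_fst).add
    ((((bddVec_simplex hξ).comp measurable_snd).sub ((bddVec_simplex hξ).comp hc)).norm_sq.const_mul
      w)

end SmoothScores

/-! ### Runs: conditioning on the past and expected decrease -/

namespace UPOMDP

variable {N T M d : ℕ} {S O A : Type*} [MeasurableSpace S] [MeasurableSpace O]
  [MeasurableSpace A] [Fintype A]
  {E : UPOMDP N S O A} {k : ScoreKind} {w : WeightKind} {π : Params d → O → A → ℝ}
  {ζ R α ξ ηx ηy : ℝ} {L K : NNReal} {x₀ : Params d}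
  {Ω : Type*} {mΩ : MeasurableSpace Ω} {μ : Measure Ω} {ℱ : Filtration ℕ mΩ}
  {X : ℕ → Ω → Params d} {Y : ℕ → Ω → LevelVec N} {B : ℕ → Ω → Batch N T M S A}

namespace IsRun

theorem mem_truncSimplex (h : E.IsRun k w π α ξ ηx ηy x₀ μ ℱ X Y B) (hN : 0 < N)
    (hξN : ξ * N ≤ 1) (n : ℕ) (ω : Ω) : Y n ω ∈ truncSimplex N ξ := by
  cases n with
  | zero => exact const_mem_truncSimplex hN hξN (h.y_zero ω)
  | succ n => exact (h.y_succ n ω).1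

/-- The pair of iterates, as a point of the product of the parameter space and the simplex. -/
def iterate (h : E.IsRun k w π α ξ ηx ηy x₀ μ ℱ X Y B) (hN : 0 < N) (hξN : ξ * N ≤ 1) (n : ℕ)
    (ω : Ω) : Params d × truncSimplex N ξ :=
  (X n ω, ⟨Y n ω, h.mem_truncSimplex hN hξN n ω⟩)

theorem measurable_iterate_filtration (h : E.IsRun k w π α ξ ηx ηy x₀ μ ℱ X Y B) (hN : 0 < N)
    (hξN : ξ * N ≤ 1) (n : ℕ) : Measurable[ℱ n] (h.iterate hN hξN n) :=
  Measurable.prodMk (h.x_meas n) (Measurable.subtype_mk (h.y_meas n))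

theorem measurable_iterate (h : E.IsRun k w π α ξ ηx ηy x₀ μ ℱ X Y B) (hN : 0 < N)
    (hξN : ξ * N ≤ 1) (n : ℕ) : Measurable (h.iterate hN hξN n) :=
  (h.measurable_iterate_filtration hN hξN n).mono (ℱ.le n) le_rfl

/-- Expectations of functions of the iterates and the next batch. -/
theorem integral_eq [IsProbabilityMeasure μ] (h : E.IsRun k w π α ξ ηx ηy x₀ μ ℱ X Y B)
    (hN : 0 < N) (hξ : 0 < ξ) (hξN : ξ * N ≤ 1) (hπ : IsRegularPolicy π ζ L K) (n : ℕ)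
    {f : (Params d × truncSimplex N ξ) × Batch N T M S A → ℝ} (hf : BddMeas f) :
    ∫ ω, f (h.iterate hN hξN n ω, B n ω) ∂μ =
      ∫ ω, ∫ b, f (h.iterate hN hξN n ω, b) ∂(E.batchLaw T M (π (X n ω)) (Y n ω)) ∂μ := by
  have hz := h.measurable_iterate hN hξN n
  have hB := h.batch_meas n
  let κ : Kernel (Params d × truncSimplex N ξ) (Batch N T M S A) :=
    ⟨fun z => E.batchLaw T M (π z.1) z.2, E.measurable_batchLaw hπ hξ⟩
  have hκ : IsMarkovKernel κ :=
    ⟨fun z => E.isProbabilityMeasure_batchLaw (hπ.policy z.1) hξ z.2.2⟩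
  have hP : IsProbabilityMeasure (μ.map (h.iterate hN hξN n)) :=
    Measure.isProbabilityMeasure_map hz.aemeasurable
  have hP' : IsProbabilityMeasure (μ.map fun ω => (h.iterate hN hξN n ω, B n ω)) :=
    Measure.isProbabilityMeasure_map (hz.prodMk hB).aemeasurable
  -- Given the past, the batch has law `κ` at the current iterates; rectangles suffice to identify
  -- the joint law.
  have hlaw : μ.map (fun ω => (h.iterate hN hξN n ω, B n ω)) =
      (μ.map (h.iterate hN hξN n)) ⊗ₘ κ := by
    refine Measure.ext_prod fun {s t} hs ht => ?_
    rw [Measure.map_apply (hz.prodMk hB) (hs.prod ht), Measure.compProd_apply_prod hs ht,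
      setLIntegral_map hs (κ.measurable_coe ht) hz]
    exact h.batch_law n _ (h.measurable_iterate_filtration hN hξN n hs) t ht
  calc ∫ ω, f (h.iterate hN hξN n ω, B n ω) ∂μ
      = ∫ v, f v ∂((μ.map (h.iterate hN hξN n)) ⊗ₘ κ) := by
        rw [← hlaw, integral_map (hz.prodMk hB).aemeasurable hf.1.aestronglyMeasurable]
    _ = ∫ z, ∫ b, f (z, b) ∂(κ z) ∂(μ.map (h.iterate hN hξN n)) :=
        Measure.integral_compProd (hf.integrable _)
    _ = _ := by
        rw [integral_map hz.aemeasurable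
          (hf.integral_kernel κ.measurable).1.aestronglyMeasurable]
        rfl

open SmoothScores in
theorem bddMeas_potential (h : E.IsRun k w π α ξ ηx ηy x₀ μ ℱ X Y B) (hN : 0 < N) (hξ : 0 < ξ)
    (hξN : ξ * N ≤ 1) (hα : 0 < α) {s : Params d → LevelVec N} {G H : ℝ} (hs : SmoothScores s G H)
    (hb : BddVec s) (c : ℝ) (n : ℕ) : BddMeas fun ω => potential α ξ c s (X n ω) (Y n ω) := by
  have := (hs.bddMeas_potential hb hN hξ hξN hα c).comp (h.measurable_iterate hN hξN n)
  exact this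

end IsRun

/-- Integration of a pathwise descent inequality with centred noise. -/
lemma integral_le_of_noisy_descent [IsProbabilityMeasure μ] {p p' g f₁ f₂ f₃ f₄ : Ω → ℝ}
    {η κ c D : ℝ} (hp : BddMeas p) (hp' : BddMeas p') (hg : BddMeas g) (hf₁ : BddMeas f₁)
    (hf₂ : BddMeas f₂) (hf₃ : BddMeas f₃) (hf₄ : BddMeas f₄) (hκ : 0 ≤ κ) (hc : 0 ≤ c)
    (h₁ : ∫ ω, f₁ ω ∂μ = 0) (h₂ : ∫ ω, f₂ ω ∂μ = 0) (h₃ : ∫ ω, f₃ ω ∂μ ≤ D)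
    (h₄ : ∫ ω, f₄ ω ∂μ ≤ D)
    (hle : ∀ ω, p' ω ≤ p ω - η * g ω + f₁ ω + f₂ ω + κ * f₃ ω + c * f₄ ω) :
    ∫ ω, p' ω ∂μ ≤ ∫ ω, p ω ∂μ - η * ∫ ω, g ω ∂μ + (κ + c) * D := by
  have b₀ := hp.sub (hg.const_mul η)
  have b₁ := b₀.add hf₁
  have b₂ := b₁.add hf₂
  have b₃ := b₂.add (hf₃.const_mul κ)
  have b₄ := b₃.add (hf₄.const_mul c)
  have key := integral_mono (hp'.integrable μ) (b₄.integrable μ) hle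
  rw [b₃.integral_add (hf₄.const_mul c), b₂.integral_add (hf₃.const_mul κ), b₁.integral_add hf₂,
    b₀.integral_add hf₁, hp.integral_sub (hg.const_mul η), integral_const_mul, integral_const_mul,
    integral_const_mul, h₁, h₂] at key
  have e₃ := mul_le_mul_of_nonneg_left h₃ hκ
  have e₄ := mul_le_mul_of_nonneg_left h₄ hc
  linarith

variable [DiscreteMeasurableSpace A]

theorem bddVec_expReturn (hπ : IsRegularPolicy π ζ L K) :
    BddVec fun x => (WithLp.toLp 2 fun i => E.expReturn T (π x) i : LevelVec N) := fun i => by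
  have := fun x => E.isProbabilityMeasure_trajLaw (T := T) (hπ.policy x) i
  exact ((E.bddMeas_ret i).comp measurable_snd).integral_kernel
    (E.measurable_trajLaw_prod hπ.policy hπ.measurable_prod i)

theorem bddVec_scoreVec (hπ : IsRegularPolicy π ζ L K) : BddVec (E.scoreVec T k π) := fun i =>
  (BddMeas.const _).sub (bddVec_expReturn hπ i)

theorem bddVec_agentNoise (w : WeightKind) (hπ : IsRegularPolicy π ζ L K) (hζ : 0 < ζ)
    (hR : E.IsReturnBound T π R) (hξ : 0 < ξ) :
    BddVec fun v : (Params d × truncSimplex N ξ) × Batch N T M S A =>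
      E.agentNoise k w π v.1.1 v.1.2 v.2 :=
  ((E.bddVec_agentGrad w hπ hζ).comp
    (h := fun v : (Params d × truncSimplex N ξ) × Batch N T M S A => (v.1.1, v.2))
    (measurable_fst.fst.prodMk measurable_snd)).sub
    (((E.smoothScores k hπ hζ hR).bddVec_mixGrad hξ).comp measurable_fst)

theorem bddVec_advNoise (hπ : IsRegularPolicy π ζ L K) :
    BddVec fun v : (Params d × truncSimplex N ξ) × Batch N T M S A =>
      E.advNoise π v.1.1 v.2 :=
  ((bddVec_expReturn hπ).comp
    (h := fun v : (Params d × truncSimplex N ξ) × Batch N T M S A => v.1.1)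
    measurable_fst.fst).sub ((bddVec_empMean E.bddVec_retVec).comp measurable_snd.snd)

open SmoothScores in
/-- Expected decrease of the potential along a run. -/
theorem IsRun.integral_potential_succ_le [IsProbabilityMeasure μ]
    (h : E.IsRun k w π α ξ ηx ηy x₀ μ ℱ X Y B) (hN : 0 < N) (hM : 0 < M) (hζ : 0 < ζ)
    (hξ : 0 < ξ) (hξN : ξ * N ≤ 1) (hα : 0 < α) (hπ : IsRegularPolicy π ζ L K)
    (hR : E.IsReturnBound T π R) (hηx : 0 < ηx) (hηy : 0 < ηy) (hηξ : ηy * α ≤ ξ)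
    {G H β c κ : ℝ} (hs : SmoothScores (E.scoreVec T k π) G H)
    (hβ : β = ηy * α / 4) (hc : c = 2 * G ^ 2 / (ηy * α))
    (hκ : κ = (2 * G ^ 2 / α + H) * ηx ^ 2 + ηx * c * (1 + 1 / β) * (2 * G / α) ^ 2 * ηx ^ 2)
    (hκ0 : 0 ≤ κ) (hκ2 : κ ≤ ηx / 2) (n : ℕ) :
    ∫ ω, potential α ξ (ηx * c) (E.scoreVec T k π) (X (n + 1) ω) (Y (n + 1) ω) ∂μ ≤
      ∫ ω, potential α ξ (ηx * c) (E.scoreVec T k π) (X n ω) (Y n ω) ∂μ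
      - ηx / 2 * ∫ ω, ‖maxGrad α ξ (E.scoreVec T k π) (X n ω)‖ ^ 2 ∂μ
      + (κ + ηx * c * (1 + β) * ηy ^ 2) * (varConst N T R ζ L / M) := by
  set s := E.scoreVec T k π with hsdef
  set z := h.iterate hN hξN with hz
  have hzm := h.measurable_iterate hN hξN
  have hzB : Measurable fun ω => (z n ω, B n ω) := (hzm n).prodMk (h.batch_meas n)
  have hβ0 : 0 < β := by rw [hβ]; positivity
  have hc0 : 0 ≤ c := by rw [hc]; positivity
  set c2 := ηx * c * (1 + β) * ηy ^ 2 with hc2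
  have hc20 : 0 ≤ c2 := by positivity
  have hpot := h.bddMeas_potential hN hξ hξN hα hs (bddVec_scoreVec hπ) (ηx * c)
  -- The coefficients `U` and `W` of the linear noise terms depend only on the current iterates, so
  -- those terms have conditional mean zero.
  let U : Params d × truncSimplex N ξ → Params d := fun z =>
    (2 * κ) • mixGrad s z.1 z.2 - ηx • maxGrad α ξ s z.1
  let W : Params d × truncSimplex N ξ → LevelVec N := fun z =>
    (ηx * c * (1 + β) * (2 * ηy)) • ascentGap α ξ ηy s z.1 z.2
  have hU : BddVec U := ((hs.bddVec_mixGrad hξ).smul (BddMeas.const _)).sub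
    (((hs.bddVec_maxGrad hN hξ hξN hα).comp measurable_fst).smul (BddMeas.const _))
  have hW : BddVec W := (hs.bddVec_ascentGap hN hξ hξN hα).smul (BddMeas.const _)
  have hEx := bddVec_agentNoise (E := E) (M := M) (k := k) w hπ hζ hR hξ
  have hEy := bddVec_advNoise (E := E) (M := M) (T := T) (ξ := ξ) hπ
  let f1 : (Params d × truncSimplex N ξ) × Batch N T M S A → ℝ := fun v =>
    inner ℝ (U v.1) (E.agentNoise k w π v.1.1 v.1.2 v.2)
  let f2 : (Params d × truncSimplex N ξ) × Batch N T M S A → ℝ := fun v =>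
    inner ℝ (W v.1) (E.advNoise π v.1.1 v.2)
  let f3 : (Params d × truncSimplex N ξ) × Batch N T M S A → ℝ := fun v =>
    ‖E.agentNoise k w π v.1.1 v.1.2 v.2‖ ^ 2
  let f4 : (Params d × truncSimplex N ξ) × Batch N T M S A → ℝ := fun v =>
    ‖E.advNoise π v.1.1 v.2‖ ^ 2
  have hf1 : BddMeas f1 := (hU.comp measurable_fst).inner hEx
  have hf2 : BddMeas f2 := (hW.comp measurable_fst).inner hEy
  have hf3 : BddMeas f3 := hEx.norm_sq
  have hf4 : BddMeas f4 := hEy.norm_sq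
  have i1 : ∫ ω, f1 (z n ω, B n ω) ∂μ = 0 := by
    rw [h.integral_eq hN hξ hξN hπ n hf1]
    refine (integral_congr_ae (Filter.Eventually.of_forall fun ω => ?_)).trans (integral_zero Ω ℝ)
    exact E.integral_inner_agentNoise k w hπ hζ hR hN hM hξ (X n ω) (U (z n ω))
      (h.mem_truncSimplex hN hξN n ω)
  have i2 : ∫ ω, f2 (z n ω, B n ω) ∂μ = 0 := by
    rw [h.integral_eq hN hξ hξN hπ n hf2]
    refine (integral_congr_ae (Filter.Eventually.of_forall fun ω => ?_)).trans (integral_zero Ω ℝ)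
    exact E.integral_inner_advNoise hπ hM hξ (X n ω) (W (z n ω)) (h.mem_truncSimplex hN hξN n ω)
  have hle : ∀ {f : (Params d × truncSimplex N ξ) × Batch N T M S A → ℝ}, BddMeas f → ∀ {D : ℝ},
      (∀ ω, ∫ b, f (z n ω, b) ∂(E.batchLaw T M (π (X n ω)) (Y n ω)) ≤ D) →
      ∫ ω, f (z n ω, B n ω) ∂μ ≤ D := fun {f} hf {D} hD => by
    have hp : ∀ v : Params d × truncSimplex N ξ,
        IsProbabilityMeasure (E.batchLaw T M (π v.1) v.2) := fun v =>
      E.isProbabilityMeasure_batchLaw (hπ.policy _) hξ v.2.2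
    have hb := (hf.integral_kernel (E.measurable_batchLaw hπ hξ)).comp (hzm n)
    rw [h.integral_eq hN hξ hξN hπ n hf]
    calc _ ≤ ∫ _, D ∂μ := integral_mono (hb.integrable μ) (integrable_const D) hD
      _ = D := by simp
  have i3 : ∫ ω, f3 (z n ω, B n ω) ∂μ ≤ varConst N T R ζ L / M := hle hf3 fun ω =>
    E.integral_norm_agentNoise_sq_le k w hπ hζ hR hN hM hξ (X n ω) (h.mem_truncSimplex hN hξN n ω)
  have i4 : ∫ ω, f4 (z n ω, B n ω) ∂μ ≤ varConst N T R ζ L / M := hle hf4 fun ω =>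
    E.integral_norm_advNoise_sq_le hπ hR hM hξ (X n ω) (h.mem_truncSimplex hN hξN n ω)
  refine integral_le_of_noisy_descent (hpot n) (hpot (n + 1))
    (((hs.bddVec_maxGrad hN hξ hξN hα).norm_sq).comp (hzm n).fst) (hf1.comp hzB) (hf2.comp hzB)
    (hf3.comp hzB) (hf4.comp hzB) hκ0 hc20 i1 i2 i3 i4 fun ω => ?_
  have hx : X (n + 1) ω = X n ω - ηx • (mixGrad s (X n ω) (Y n ω) +
      E.agentNoise k w π (X n ω) (Y n ω) (B n ω)) := by
    rw [h.x_succ, agentNoise, add_sub_cancel]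
  have hy := h.y_succ n ω
  rw [advGrad_eq E k α π (X n ω)] at hy
  have key := hs.potential_step hN hξ hξN hα hηx hηy hηξ hβ hc hκ hκ2
    (x := X n ω) (ex := E.agentNoise k w π (X n ω) (Y n ω) (B n ω))
    (h.mem_truncSimplex hN hξN n ω) hy
  rw [← hx] at key
  refine key.trans (le_of_eq ?_)
  simp only [f1, f2, f3, f4, U, W, hc2, hz, iterate]

end UPOMDP

/-! ### Comparison with the constants of the theorem -/

section StepSizes

variable {T : ℕ} {R ζ ξ α : ℝ} {L K : NNReal}

/-- For `T ≥ 1` the summand `2 * T * L` alone dominates `L`; for `T = 0` the factor `T` makes the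
comparison trivial. -/
lemma gradient_bound_le_smoothConst (hR : 0 ≤ R) (hζ : 0 < ζ) (hξ : 0 < ξ) (hα : 0 < α) :
    R * (T * (L / ζ)) ≤ smoothConst T R ζ ξ α L K := by
  have h : (T : ℝ) * L ≤ T * (T * (L : ℝ) ^ 2 + K + (L : ℝ) ^ 2 / ζ + 2 * T * L) := by
    rcases Nat.eq_zero_or_pos T with rfl | hT
    · simp
    have hT' : (1 : ℝ) ≤ T := by exact_mod_cast hT
    have h1 : (L : ℝ) ≤ T * L := le_mul_of_one_le_left L.2 hT'
    have h2 : 0 ≤ (T : ℝ) * (L : ℝ) ^ 2 + K + (L : ℝ) ^ 2 / ζ + T * L := by positivity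
    refine mul_le_mul_of_nonneg_left ?_ (by positivity)
    linarith
  calc R * (T * (L / ζ)) = R / ζ * (T * L) := by ring
    _ ≤ R / ζ * (T * (T * (L : ℝ) ^ 2 + K + (L : ℝ) ^ 2 / ζ + 2 * T * L)) := by gcongr
    _ = T * R / ζ * (T * (L : ℝ) ^ 2 + K + (L : ℝ) ^ 2 / ζ + 2 * T * L) + 0 := by ring
    _ ≤ _ := add_le_add le_rfl (by positivity)

/-- The summands `K` and `L ^ 2 / ζ` suffice; the factor 3 is that of
`integral_abs_pathProd_sub_le`. -/
lemma taylor_bound_le_smoothConst (hR : 0 ≤ R) (hζ : 0 < ζ) (hξ : 0 < ξ) (hα : 0 < α) :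
    R * (T * (3 * (L ^ 2 / ζ ^ 2) + K / ζ)) ≤ 3 * smoothConst T R ζ ξ α L K := by
  calc R * (T * (3 * (L ^ 2 / ζ ^ 2) + K / ζ))
      = 3 * (T * R / ζ * ((L : ℝ) ^ 2 / ζ + K / 3) + 0) := by field_simp; ring
    _ ≤ 3 * (T * R / ζ * (T * (L : ℝ) ^ 2 + K + (L : ℝ) ^ 2 / ζ + 2 * T * L) + α / ξ) := by
        have h : (L : ℝ) ^ 2 / ζ + K / 3 ≤ T * (L : ℝ) ^ 2 + K + (L : ℝ) ^ 2 / ζ + 2 * T * L := by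
          have h1 : 0 ≤ (T : ℝ) * (L : ℝ) ^ 2 + 2 * T * L := by positivity
          have h2 : 0 ≤ (K : ℝ) := K.2
          linarith
        gcongr
        positivity
    _ = _ := rfl

lemma div_le_smoothConst (hR : 0 ≤ R) (hζ : 0 < ζ) : α / ξ ≤ smoothConst T R ζ ξ α L K :=
  le_add_of_nonneg_left (by positivity)

/-- The batch size makes the sampling error small. -/
lemma sampling_error_le {V ℓ α ε M : ℝ} (hα : 0 < α) (hε : 0 < ε)
    (hM : 12 * max 1 (V * ℓ / (α * ε ^ 2)) ≤ M) : V / M * (ℓ / α) ≤ ε ^ 2 / 12 := by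
  have h1 : 0 < M := by linarith [le_max_left 1 (V * ℓ / (α * ε ^ 2))]
  have h2 : V * ℓ / (α * ε ^ 2) ≤ M / 12 := by linarith [le_max_right 1 (V * ℓ / (α * ε ^ 2))]
  rw [div_le_iff₀ (by positivity)] at h2
  rw [div_mul_div_comm, div_le_iff₀ (by positivity)]
  linarith

/-- The number of iterations outweighs the initial value of the potential. -/
lemma initial_gap_lt {Δ w ℓ α ε c₁ c₂ η n : ℝ} (hΔ : 0 ≤ Δ) (hℓ : 0 < ℓ) (hα : 0 < α)
    (hε : 0 < ε) (hc₁ : 0 < c₁) (hc₂ : 0 < c₂) (hη : c₁ * (α ^ 2 / ℓ ^ 3) ≤ η)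
    (hw : w ≤ 2 * ℓ ^ 3 / (c₂ * α))
    (hn : 3 * (2 / c₁ + 16 / c₂) *
      (Δ * ℓ ^ 3 / (α ^ 2 * ε ^ 2) + ℓ ^ 3 / (α * min (ε ^ 2) (ε ^ 4))) ≤ n) :
    Δ + 4 * (η * w) < n * (η * ε ^ 2 / 4) := by
  have hη0 : 0 < η := lt_of_lt_of_le (by positivity) hη
  set P := Δ * ℓ ^ 3 / (α ^ 2 * ε ^ 2) with hP
  set Q := ℓ ^ 3 / (α * ε ^ 2) with hQ
  have hP0 : 0 ≤ P := by positivity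
  have hQ0 : 0 < Q := by positivity
  -- Only `ε ^ 2` is needed here: the initial distance enters the potential with weight `η * w`, and
  -- its factor `η` cancels against that of the descent.
  have hQ' : Q ≤ ℓ ^ 3 / (α * min (ε ^ 2) (ε ^ 4)) := by
    have : 0 < min (ε ^ 2) (ε ^ 4) := lt_min (by positivity) (by positivity)
    rw [hQ]
    gcongr
    exact min_le_left _ _
  have h1 : Δ ≤ P / c₁ * (η * ε ^ 2) := by
    calc Δ = P / c₁ * (c₁ * (α ^ 2 / ℓ ^ 3) * ε ^ 2) := by rw [hP]; field_simp
      _ ≤ _ := by gcongr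
  have h2 : w ≤ 2 * (Q / c₂ * ε ^ 2) := by
    refine hw.trans_eq ?_
    rw [hQ]; field_simp
  have h3 : 4 * (P / c₁) + 32 * (Q / c₂) < n := by
    have e1 : 0 ≤ P / c₁ := by positivity
    have e2 : 0 < Q / c₂ := by positivity
    have e3 : 0 ≤ P / c₂ := by positivity
    have e4 : 0 < Q / c₁ := by positivity
    calc 4 * (P / c₁) + 32 * (Q / c₂) < 3 * (2 * (P / c₁) + 2 * (Q / c₁) + 16 * (P / c₂)
          + 16 * (Q / c₂)) := by linarith
      _ = 3 * (2 / c₁ + 16 / c₂) * (P + Q) := by ring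
      _ ≤ 3 * (2 / c₁ + 16 / c₂) *
          (P + ℓ ^ 3 / (α * min (ε ^ 2) (ε ^ 4))) := by gcongr
      _ ≤ n := hn
  calc Δ + 4 * (η * w) ≤ P / c₁ * (η * ε ^ 2) + 4 * (η * (2 * (Q / c₂ * ε ^ 2))) := by gcongr
    _ = (4 * (P / c₁) + 32 * (Q / c₂)) * (η * ε ^ 2 / 4) := by ring
    _ < n * (η * ε ^ 2 / 4) := by gcongr

end StepSizes

/-! ### The expected gradient norm and the best iterate -/

namespace UPOMDP

variable {N T M d : ℕ} {S O A : Type*} [MeasurableSpace S] [MeasurableSpace O]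
  [MeasurableSpace A] [Fintype A] [DiscreteMeasurableSpace A]
  {E : UPOMDP N S O A} {k : ScoreKind} {w : WeightKind} {π : Params d → O → A → ℝ}
  {ζ R α ξ ηx ηy : ℝ} {L K : NNReal} {x₀ : Params d}
  {Ω : Type*} {mΩ : MeasurableSpace Ω} {μ : Measure Ω} {ℱ : Filtration ℕ mΩ}
  {X : ℕ → Ω → Params d} {Y : ℕ → Ω → LevelVec N} {B : ℕ → Ω → Batch N T M S A}

-- `maxObjective` unfolds to `maxPayoff` at the score vector, so the abstract statement applies as
-- it stands.
open SmoothScores in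
theorem hasGradientAt_maxObjective (hN : 0 < N) (hζ : 0 < ζ) (hξ : 0 < ξ) (hξN : ξ * N ≤ 1)
    (hα : 0 < α) (hπ : IsRegularPolicy π ζ L K) (hR : E.IsReturnBound T π R) (x : Params d) :
    HasGradientAt (E.maxObjective T k π α ξ) (maxGrad α ξ (E.scoreVec T k π) x) x :=
  (E.smoothScores k hπ hζ hR).hasGradientAt_maxPayoff hN hξ hξN hα x

theorem bddBelow_maxObjective (hN : 0 < N) (hζ : 0 < ζ) (hξ : 0 < ξ) (hξN : ξ * N ≤ 1)
    (hα : 0 < α) (hπ : IsRegularPolicy π ζ L K) (hR : E.IsReturnBound T π R) :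
    BddBelow (Set.range (E.maxObjective T k π α ξ)) := by
  obtain ⟨-, C, hC⟩ := (E.smoothScores k hπ hζ hR).bddMeas_maxPayoff (bddVec_scoreVec hπ)
    hN hξ hξN hα
  refine ⟨-C, ?_⟩
  rintro _ ⟨x, rfl⟩
  exact (abs_le.1 (hC x)).1

open SmoothScores in
/-- Initial excess of the potential of a run over its later expectation. -/
theorem IsRun.integral_potential_sub_le [IsProbabilityMeasure μ]
    (h : E.IsRun k w π α ξ ηx ηy x₀ μ ℱ X Y B) (hN : 0 < N) (hζ : 0 < ζ) (hξ : 0 < ξ)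
    (hξN : ξ * N ≤ 1) (hα : 0 < α) (hπ : IsRegularPolicy π ζ L K) (hR : E.IsReturnBound T π R)
    {c : ℝ} (hc : 0 ≤ c) (n : ℕ) :
    ∫ ω, potential α ξ c (E.scoreVec T k π) (X 0 ω) (Y 0 ω) ∂μ
      - ∫ ω, potential α ξ c (E.scoreVec T k π) (X n ω) (Y n ω) ∂μ ≤
      E.initialGap T k π α ξ x₀ + 4 * c := by
  have hb := h.bddMeas_potential hN hξ hξN hα (E.smoothScores k hπ hζ hR) (bddVec_scoreVec hπ) c
  have h0 : ∫ ω, potential α ξ c (E.scoreVec T k π) (X 0 ω) (Y 0 ω) ∂μ ≤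
      E.maxObjective T k π α ξ x₀ + 4 * c := by
    refine (integral_mono ((hb 0).integrable μ) (integrable_const _) fun ω => ?_).trans_eq
      (by simp : ∫ _, (E.maxObjective T k π α ξ x₀ + 4 * c) ∂μ = _)
    -- The simplex has diameter at most 2, whence the term `4 * c`.
    have h1 := norm_sub_le_two hξ (h.mem_truncSimplex hN hξN 0 ω)
      (bestResponse_spec (α := α) hN hξ hξN (E.scoreVec T k π (X 0 ω))).1
    have h2 := pow_le_pow_left₀ (norm_nonneg _) h1 2
    have h3 := mul_le_mul_of_nonneg_left h2 hc
    have h4 : maxPayoff α ξ (E.scoreVec T k π (X 0 ω)) = E.maxObjective T k π α ξ x₀ := by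
      rw [h.x_zero]; rfl
    simp only [potential, h4]
    linarith
  have hn : ⨅ x, E.maxObjective T k π α ξ x ≤
      ∫ ω, potential α ξ c (E.scoreVec T k π) (X n ω) (Y n ω) ∂μ := by
    refine (by simp : _ = ∫ _, (⨅ x, E.maxObjective T k π α ξ x) ∂μ).trans_le
      (integral_mono (integrable_const _) ((hb n).integrable μ) fun ω => ?_)
    refine (ciInf_le (bddBelow_maxObjective hN hζ hξ hξN hα hπ hR) (X n ω)).trans ?_
    exact le_add_of_nonneg_right (by positivity)
  rw [initialGap]
  linarith

open SmoothScores in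
/-- Some iterate has a small expected squared gradient. -/
theorem IsRun.exists_integral_norm_sq_lt [IsProbabilityMeasure μ]
    (h : E.IsRun k w π α ξ ηx ηy x₀ μ ℱ X Y B) (hN : 0 < N) (hζ : 0 < ζ) (hξ : 0 < ξ)
    (hξN : ξ * N ≤ 1) (hα : 0 < α) (hπ : IsRegularPolicy π ζ L K) (hR : E.IsReturnBound T π R)
    {ε ℓ c₁ c₂ : ℝ} (hε : 0 < ε) (hℓ : ℓ = smoothConst T R ζ ξ α L K) (hc₁ : 0 < c₁)
    (hc₂ : 0 < c₂) (hc₂1 : c₂ ≤ 1) (hηx1 : c₁ * (α ^ 2 / ℓ ^ 3) ≤ ηx)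
    (hηx2 : ηx ≤ c₂ / 20 * (α ^ 2 / ℓ ^ 3)) (hηy1 : c₂ * (1 / ℓ) ≤ ηy) (hηy2 : ηy ≤ 1 / ℓ)
    (hM : 12 * max 1 (varConst N T R ζ L * ℓ / (α * ε ^ 2)) ≤ M) {n : ℕ}
    (hn : 3 * (2 / c₁ + 16 / c₂) * (E.initialGap T k π α ξ x₀ * ℓ ^ 3 / (α ^ 2 * ε ^ 2) +
      ℓ ^ 3 / (α * min (ε ^ 2) (ε ^ 4))) ≤ n) :
    ∃ t < n, ∫ ω, ‖maxGrad α ξ (E.scoreVec T k π) (X t ω)‖ ^ 2 ∂μ < ε ^ 2 := by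
  have hR0 := E.return_bound_nonneg hN hπ hR
  have hs := E.smoothScores k hπ hζ hR
  set G := R * (T * (L / ζ)) with hGdef
  set H := R * (T * (3 * (L ^ 2 / ζ ^ 2) + K / ζ)) with hHdef
  have hG0 : 0 ≤ G := by positivity
  have hH0 : 0 ≤ H := by positivity
  have hG : G ≤ ℓ := hℓ ▸ gradient_bound_le_smoothConst hR0 hζ hξ hα
  have hH : H ≤ 3 * ℓ := hℓ ▸ taylor_bound_le_smoothConst hR0 hζ hξ hα
  have hξℓ : α / ξ ≤ ℓ := hℓ ▸ div_le_smoothConst hR0 hζ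
  have hN1 : (1 : ℝ) ≤ N := by exact_mod_cast hN
  have hξ1 : ξ ≤ 1 := (le_mul_of_one_le_right hξ.le hN1).trans hξN
  have hαℓ : α ≤ ℓ := (le_div_self hα.le hξ hξ1).trans hξℓ
  have hℓ0 : 0 < ℓ := hα.trans_le hαℓ
  have hηy0 : 0 < ηy := lt_of_lt_of_le (by positivity) hηy1
  have hηx0 : 0 < ηx := lt_of_lt_of_le (by positivity) hηx1
  have hηξ : ηy * α ≤ ξ := by
    rw [div_le_iff₀ hξ] at hξℓ
    calc ηy * α ≤ 1 / ℓ * (ℓ * ξ) := by gcongr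
      _ = ξ := by field_simp
  have hM0 : 0 < M := by
    have : (0 : ℝ) < M := by linarith [le_max_left 1 (varConst N T R ζ L * ℓ / (α * ε ^ 2))]
    exact_mod_cast this
  set β := ηy * α / 4 with hβ
  set v := 2 * G ^ 2 / (ηy * α) with hv
  have hv0 : 0 ≤ v := by positivity
  have hβ0 : 0 < β := by positivity
  set κ := (2 * G ^ 2 / α + H) * ηx ^ 2 + ηx * v * (1 + 1 / β) * (2 * G / α) ^ 2 * ηx ^ 2 with hκ
  have hκ0 : 0 ≤ κ := by positivity
  obtain ⟨b1, b2, b3⟩ :=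
    step_size_bounds hG0 hG hH hα hαℓ hc₂ hc₂1 hηy1 hηy2 hηx0 hηx2 hβ hv hκ
  have hΔ : 0 ≤ E.initialGap T k π α ξ x₀ :=
    sub_nonneg.2 (ciInf_le (bddBelow_maxObjective hN hζ hξ hξN hα hπ hR) x₀)
  have hV : 0 ≤ varConst N T R ζ L := by unfold varConst; positivity
  -- Half of the descent `ηx / 2 * ε ^ 2` is reserved for the noise; the other half outweighs the
  -- initial excess of the potential.
  have herr : (κ + ηx * v * (1 + β) * ηy ^ 2) * (varConst N T R ζ L / M) ≤ ηx * ε ^ 2 / 4 := by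
    have e := sampling_error_le hα hε hM
    calc (κ + ηx * v * (1 + β) * ηy ^ 2) * (varConst N T R ζ L / M)
        ≤ 3 * ηx * (ℓ / α) * (varConst N T R ζ L / M) := by gcongr
      _ = 3 * ηx * (varConst N T R ζ L / M * (ℓ / α)) := by ring
      _ ≤ 3 * ηx * (ε ^ 2 / 12) := by gcongr
      _ = _ := by ring
  refine exists_lt_of_potential_decrease (v := fun m =>
      ∫ ω, potential α ξ (ηx * v) (E.scoreVec T k π) (X m ω) (Y m ω) ∂μ) (fun t => h.integral_potential_succ_le hN hM0 hζ hξ hξN hα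
    hπ hR hηx0 hηy0 hηξ hs hβ hv hκ hκ0 b1 t) (half_pos hηx0)
    (h.integral_potential_sub_le (c := ηx * v) hN hζ hξ hξN hα hπ hR (by positivity) n) ?_
  have h1 := initial_gap_lt hΔ hℓ0 hα hε hc₁ hc₂ hηx1 b3 hn
  have h2 := mul_le_mul_of_nonneg_left herr (Nat.cast_nonneg (α := ℝ) n)
  linarith

/-- A best iterate has expected gradient norm at most that of any fixed iterate. -/
theorem integral_best_le [IsProbabilityMeasure μ] {g : Params d → ℝ} {C : ℝ} (hg : Measurable g)
    (hg0 : ∀ x, |g x| ≤ C) (hX : ∀ n, Measurable (X n)) {n : ℕ} {xs : Ω → Params d}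
    (hxs : ∀ ω, (∃ t ≤ n, xs ω = X t ω) ∧ ∀ t ≤ n, g (xs ω) ≤ g (X t ω)) {t : ℕ} (ht : t ≤ n) :
    Integrable (fun ω => g (xs ω)) μ ∧ ∫ ω, g (xs ω) ∂μ ≤ ∫ ω, g (X t ω) ∂μ := by
  -- `xs` is not assumed measurable, but `g` along it is a minimum of finitely many measurable
  -- functions.
  have e : (fun ω => g (xs ω)) = fun ω => ⨅ m : Fin (n + 1), g (X m ω) := by
    funext ω
    refine le_antisymm (le_ciInf fun m => (hxs ω).2 m (Nat.lt_succ_iff.1 m.2)) ?_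
    obtain ⟨m, hm, hm'⟩ := (hxs ω).1
    rw [hm']
    exact ciInf_le (Set.finite_range fun m : Fin (n + 1) => g (X m ω)).bddBelow
      ⟨m, Nat.lt_succ_iff.2 hm⟩
  have hb : BddMeas fun ω => g (xs ω) :=
    ⟨by rw [e]; exact .iInf fun m => hg.comp (hX m), C, fun ω => hg0 _⟩
  have hbt : BddMeas fun ω => g (X t ω) := ⟨hg.comp (hX t), C, fun ω => hg0 _⟩
  exact ⟨hb.integrable μ, integral_mono (hb.integrable μ) (hbt.integrable μ)
    fun ω => (hxs ω).2 t ht⟩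

end UPOMDP

end UED

end

/-- Best-iterate convergence. The constants do not depend on the problem. The step sizes may be
anything between `cy₁ / ℓ` and `cy₂ / ℓ`, and between `cx₁ α² / ℓ³` and `cx₂ α² / ℓ³`, where `cy₁` and
`cx₁` are arbitrary positive numbers below the thresholds `cy₂` and `cx₂ = cx₂(cy₁)`. -/
theorem theorem1 :
    ∃ cy₂ : ℝ, 0 < cy₂ ∧ ∀ cy₁ : ℝ, 0 < cy₁ → cy₁ ≤ cy₂ →
    ∃ cx₂ : ℝ, 0 < cx₂ ∧ ∀ cx₁ : ℝ, 0 < cx₁ → cx₁ ≤ cx₂ →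
    ∃ cM : ℝ, 0 < cM ∧ ∃ C : ℝ, 0 < C ∧
    ∀ (N T M d : ℕ) (S O A : Type*) [MeasurableSpace S] [MeasurableSpace O] [MeasurableSpace A]
      [Fintype A] [DiscreteMeasurableSpace A]
      (E : UED.UPOMDP N S O A) (k : UED.ScoreKind) (w : UED.WeightKind)
      (π : UED.Params d → O → A → ℝ) (ζ ξ α R ε ℓ σ Δ ηx ηy : ℝ) (L K : NNReal)
      (x₀ : UED.Params d),
      0 < N → 0 < ζ → 0 < ξ → ξ * N ≤ 1 → 0 < α → 0 < ε →
      UED.IsRegularPolicy π ζ L K →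
      E.IsReturnBound T π R →
      ℓ = UED.smoothConst T R ζ ξ α L K →
      σ = Real.sqrt (UED.varConst N T R ζ L) →
      Δ = E.initialGap T k π α ξ x₀ →
      cx₁ * (α ^ 2 / ℓ ^ 3) ≤ ηx → ηx ≤ cx₂ * (α ^ 2 / ℓ ^ 3) →
      cy₁ * (1 / ℓ) ≤ ηy → ηy ≤ cy₂ * (1 / ℓ) →
      cM * max 1 (σ ^ 2 * ℓ / (α * ε ^ 2)) ≤ M →
      Differentiable ℝ (E.maxObjective T k π α ξ) ∧
      ∀ (Ω : Type*) (mΩ : MeasurableSpace Ω) (μ : Measure Ω) [IsProbabilityMeasure μ]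
        (ℱ : Filtration ℕ mΩ) (X : ℕ → Ω → UED.Params d) (Y : ℕ → Ω → UED.LevelVec N)
        (B : ℕ → Ω → UED.Batch N T M S A),
        E.IsRun k w π α ξ ηx ηy x₀ μ ℱ X Y B →
        ∀ n : ℕ, C * (Δ * ℓ ^ 3 / (α ^ 2 * ε ^ 2) + ℓ ^ 3 / (α * min (ε ^ 2) (ε ^ 4))) ≤ n →
          (∃ t ≤ n, Integrable (fun ω => ‖gradient (E.maxObjective T k π α ξ) (X t ω)‖) μ ∧
            ∫ ω, ‖gradient (E.maxObjective T k π α ξ) (X t ω)‖ ∂μ < ε) ∧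
          ∀ xs : Ω → UED.Params d,
            (∀ ω, (∃ t ≤ n, xs ω = X t ω) ∧
              ∀ t ≤ n, ‖gradient (E.maxObjective T k π α ξ) (xs ω)‖
                ≤ ‖gradient (E.maxObjective T k π α ξ) (X t ω)‖) →
            Integrable (fun ω => ‖gradient (E.maxObjective T k π α ξ) (xs ω)‖) μ ∧
            ∫ ω, ‖gradient (E.maxObjective T k π α ξ) (xs ω)‖ ∂μ < ε := by
  -- With `1` as the upper constant for `ηy`, `α / ξ ≤ ℓ` yields `ηy * α ≤ ξ`. The 20 comes from
  -- `step_size_bounds`, the 12 from `sampling_error_le`, and the iteration constant from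
  -- `initial_gap_lt`.
  refine ⟨1, one_pos, fun c₂ hc₂ hc₂1 => ⟨c₂ / 20, by positivity, fun c₁ hc₁ hc₁2 =>
    ⟨12, by norm_num, 3 * (2 / c₁ + 16 / c₂), by positivity, ?_⟩⟩⟩
  intro N T M d S O A _ _ _ _ _ E k w π ζ ξ α R ε ℓ σ Δ ηx ηy L K x₀ hN hζ hξ hξN hα hε hπ hR hℓ hσ
    hΔ hηx1 hηx2 hηy1 hηy2 hM
  have hgrad := UED.UPOMDP.hasGradientAt_maxObjective (k := k) hN hζ hξ hξN hα hπ hR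
  refine ⟨fun x => (hgrad x).differentiableAt, fun Ω mΩ μ _ ℱ X Y B h n hn => ?_⟩
  have hV : 0 ≤ UED.varConst N T R ζ L := by unfold UED.varConst; positivity
  rw [hσ, Real.sq_sqrt hV] at hM
  rw [one_mul] at hηy2
  rw [hΔ] at hn
  have hs := E.smoothScores (T := T) k hπ hζ hR
  have hX : ∀ t, Measurable (X t) := fun t => (h.x_meas t).mono (ℱ.le t) le_rfl
  obtain ⟨t, htn, ht⟩ := h.exists_integral_norm_sq_lt hN hζ hξ hξN hα hπ hR hε hℓ hc₁ hc₂ hc₂1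
    hηx1 hηx2 hηy1 hηy2 hM hn
  have hgeq : gradient (E.maxObjective T k π α ξ) =
      UED.SmoothScores.maxGrad α ξ (E.scoreVec T k π) := funext fun x => (hgrad x).gradient
  rw [hgeq]
  have hg : Measurable fun x => ‖UED.SmoothScores.maxGrad α ξ (E.scoreVec T k π) x‖ :=
    (hs.bddVec_maxGrad hN hξ hξN hα).measurable.norm
  have hgC : ∀ x, |‖UED.SmoothScores.maxGrad α ξ (E.scoreVec T k π) x‖| ≤ R * (T * (L / ζ)) :=
    fun x => (abs_norm _).trans_le (hs.norm_maxGrad_le hN hξ hξN x)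
  have hb : UED.BddMeas fun ω => ‖UED.SmoothScores.maxGrad α ξ (E.scoreVec T k π) (X t ω)‖ :=
    ⟨hg.comp (hX t), _, fun ω => hgC _⟩
  -- Jensen's inequality passes from the second moment to the mean.
  have hlt : ∫ ω, ‖UED.SmoothScores.maxGrad α ξ (E.scoreVec T k π) (X t ω)‖ ∂μ < ε :=
    lt_of_pow_lt_pow_left₀ 2 hε.le ((UED.sq_integral_le hb).trans_lt ht)
  refine ⟨⟨t, htn.le, hb.integrable μ, hlt⟩, fun xs hxs => ?_⟩
  obtain ⟨h1, h2⟩ := UED.UPOMDP.integral_best_le hg hgC hX hxs htn.le (μ := μ)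
  exact ⟨h1, h2.trans_lt hlt⟩
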